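/- **Setting.** For $k\ge 0$ let $g(k)=\sqrt{k}\,(k^2+a^2)^{-2}$ with $a=\tfrac32$, and $G(k)=g(k)^2$. Let $\mathcal H_1=\mathbb C\oplus L^2(\mathbb R^3)$ and $\hat g(k)=\dfrac{g(|k|)}{\sqrt{4\pi}\,|k|}\in L^2(\mathbb R^3)$, so that the factor $4\pi$ of the solid angle is absorbed in the coupling constant and $\int_{\mathbb R^3}\frac{|\hat g(k)|^2}{|k|-z}\,d^3k=\int_0^\infty\frac{G(k)}{k-z}\,dk$. For real $E_0,\beta$ let $H$ be the one-excitation (Friedrichs) Hamiltonian $$H(z,f)=\bigl(E_0z+\beta\langle \hat g,f\rangle,\ \beta z\,\hat g+|k|f\bigr),\qquad D(H)=\{(z,f):\ |k|f\in L^2(\mathbb R^3)\}.$$ Let $\Phi_1=(1,0)$ be the Weisskopf–Wigner state, let $\Gamma=2\pi\beta^2G(E_0)$ be its half-width, and put $$R(t)=(\Phi_1,e^{-itH}\Phi_1),\quad Q(t)=|R(t)|^2,\quad \tau_H=\int_0^\infty|R(t)|^2\,dt,\quad (\Delta E)^2=\|H\Phi_1\|^2-(\Phi_1,H\Phi_1)^2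 .$$ **Theorem 5.2.** 0. For all $E_0,\beta\in\mathbb R$ there is exactly one strongly continuous one-parameter unitary group $e^{-itH}$ on $\mathcal H_1$ with generator $H$. 1. Let $E_0>0$ and $\beta>0$ satisfy $E_0>\beta^2\int_0^\infty\frac{G(k)}{k}\,dk$. Then $R\in L^2(-\infty,\infty)$, $\Phi_1\in D(H)$, and $$\tau_H\,\Delta E\ \ge\ \frac{3\pi\sqrt5}{25}.$$ Moreover $\lim_{t\to\infty}tQ(t)=0$, and the sojourn time is the average lifetime of the decaying state: $Q$ is continuously differentiable and $$-\int_0^\infty tQ'(t)\,dt=\lim_{T\to\infty}\Bigl(-\int_0^T tQ'(t)\,dt\Bigr)=\tau_H .$$ 2. The estimates $$\Bigl|\tau_H-\frac1\Gamma\Bigr|\le\frac{10^{-4}}{\Gamma},\qquad \Delta E\ \ge\ 0.843\,\Gamma$$ hold in each of the following two cases. * (Physical values.) For some $\alpha$ with $0<\alpha\le\frac1{137}$ one has $\frac\alpha3\le E_0\le\frac\alpha2$ and $0<\beta^2\le4\pi\alpha^3$, $\beta>0$. This contains the Lyman $\alpha$ value $E_0=\frac38\alpha$, with $\beta=\alpha^{3/2}$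 and also with $\beta^2=4\pi\alpha^3$. * (Small coupling.) $E_0>0$ is arbitrary and $0<\beta<b$, where $b>0$ depends only on $E_0$. -/

import Mathlib

open MeasureTheory Set Filter Topology
open scoped InnerProductSpace

noncomputable section

namespace WeisskopfWigner

section Abstract

variable {E : Type*} [NormedAddCommGroup E] [InnerProductSpace ℂ E]

/-- `U t = exp (-i t H)`: the strongly continuous one-parameter unitary group whose generator is
exactly the (unbounded) operator `H`. A vector `ψ` lies in the domain of `H` with `H ψ = φ` if and
only if `t ↦ U t ψ` is differentiable at `0` with derivative `-i φ`. -/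
structure IsUnitaryGroupOf (H : E →ₗ.[ℂ] E) (U : ℝ → E ≃ₗᵢ[ℂ] E) : Prop where
  map_zero : ∀ ψ, U 0 ψ = ψ
  map_add : ∀ s t ψ, U (s + t) ψ = U s (U t ψ)
  continuous : ∀ ψ, Continuous fun t => U t ψ
  generator : ∀ ψ φ, (ψ, φ) ∈ H.graph ↔ HasDerivAt (fun t => U t ψ) (-(Complex.I • φ)) 0

/-- The return probability amplitude `R_ψ(t) = (ψ, U(t) ψ)`. -/
def returnAmplitude (U : ℝ → E ≃ₗᵢ[ℂ] E) (ψ : E) (t : ℝ) : ℂ := ⟪ψ, U t ψ⟫_ℂ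

/-- The return probability `Q(t) = |R_ψ(t)|²`. -/
def returnProbability (U : ℝ → E ≃ₗᵢ[ℂ] E) (ψ : E) (t : ℝ) : ℝ := ‖returnAmplitude U ψ t‖ ^ 2

/-- The sojourn time `τ_H(ψ) = ∫₀^∞ |R_ψ(t)|² dt`. -/
def sojournTime (U : ℝ → E ≃ₗᵢ[ℂ] E) (ψ : E) : ℝ := ∫ t in Ioi (0 : ℝ), returnProbability U ψ t

/-- The energy uncertainty `ΔE` of `ψ ∈ D(H)`, with
`(ΔE)² = (ψ, H² ψ) - (ψ, H ψ)²` and `(ψ, H² ψ) = ‖H ψ‖²`. -/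
def energyUncertainty (H : E →ₗ.[ℂ] E) (ψ : H.domain) : ℝ :=
  √(‖H ψ‖ ^ 2 - (⟪(ψ : E), H ψ⟫_ℂ).re ^ 2)

end Abstract

/-- Momentum space `ℝ³`. -/
abbrev Momentum : Type := EuclideanSpace ℝ (Fin 3)

/-- `L²(ℝ³)` with Lebesgue measure: the one-photon space. -/
abbrev Photon : Type := Lp ℂ 2 (volume : Measure Momentum)

/-- The one-excitation space `ℂ ⊕ L²(ℝ³)` (orthogonal direct sum of Hilbert spaces). -/
abbrev Space : Type := WithLp 2 (ℂ × Photon)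

/-- The radial form factor `g(k) = √k (k² + a²)⁻²` with `a = 3/2`. -/
def formFactor (k : ℝ) : ℝ := √k * ((k ^ 2 + (3 / 2) ^ 2) ^ 2)⁻¹

/-- `G(k) = g(k)²`. -/
def G (k : ℝ) : ℝ := formFactor k ^ 2

/-- The coupling function on `ℝ³`. It is the radial function whose angular integral
`∫ |coupling (k ω)|² k² dω` is `G(k)`: the factor `4π` of the solid angle is normalised away and
the Jacobian `k²` of polar coordinates is accounted for, so that
`∫ |coupling k|² / (|k| - z) d³k = ∫₀^∞ G(k) / (k - z) dk`. -/
def coupling (k : Momentum) : ℂ := ((formFactor ‖k‖ / (√(4 * Real.pi) * ‖k‖) : ℝ) : ℂ)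

lemma integrableOn_G : IntegrableOn G (Ioi 0) := by
  have h1 : Integrable (fun x : ℝ => (1 + x ^ 2)⁻¹) := integrable_inv_one_add_sq
  refine Integrable.mono' h1.integrableOn ?_ ?_
  · unfold G formFactor
    have : Measurable fun k : ℝ => (√k * ((k ^ 2 + (3 / 2) ^ 2) ^ 2)⁻¹) ^ 2 := by fun_prop
    exact this.aestronglyMeasurable
  · refine (ae_restrict_iff' measurableSet_Ioi).2 (ae_of_all _ fun x hx => ?_)
    have hx0 : (0 : ℝ) ≤ x := le_of_lt hx
    have hG : G x = x * ((x ^ 2 + (3 / 2) ^ 2) ^ 4)⁻¹ := by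
      unfold G formFactor
      rw [mul_pow, Real.sq_sqrt hx0, inv_pow]; ring
    have hpos : 0 < (x ^ 2 + (3 / 2 : ℝ) ^ 2) := by positivity
    rw [hG, Real.norm_of_nonneg (by positivity), ← div_eq_mul_inv, ← one_div,
      div_le_div_iff₀ (by positivity) (by positivity)]
    have h2 : (1 + x ^ 2) ≤ (x ^ 2 + (3 / 2 : ℝ) ^ 2) := by nlinarith
    have h3 : x ≤ (x ^ 2 + (3 / 2 : ℝ) ^ 2) := by nlinarith [sq_nonneg (x - 1)]
    have h4 : 1 ≤ (x ^ 2 + (3 / 2 : ℝ) ^ 2) ^ 2 := by nlinarith [sq_nonneg x]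
    calc x * (1 + x ^ 2) ≤ (x ^ 2 + (3 / 2 : ℝ) ^ 2) * (x ^ 2 + (3 / 2 : ℝ) ^ 2) := by gcongr
      _ ≤ 1 * (x ^ 2 + (3 / 2 : ℝ) ^ 2) ^ 4 := by nlinarith [sq_nonneg (x ^ 2 + (3 / 2 : ℝ) ^ 2)]

lemma memLp_coupling : MemLp coupling 2 (volume : Measure Momentum) := by
  have hm : Measurable coupling := by unfold coupling formFactor; fun_prop
  rw [memLp_two_iff_integrable_sq_norm hm.aestronglyMeasurable]
  have h := (integrable_fun_norm_addHaar (E := Momentum) volume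
    (f := fun r : ℝ => (formFactor r / (√(4 * Real.pi) * r)) ^ 2)).2 ?_
  · refine h.congr (ae_of_all _ fun k => ?_)
    simp only [coupling, Complex.norm_real, Real.norm_eq_abs, sq_abs]
  · have hi : IntegrableOn (fun r => (4 * Real.pi)⁻¹ * G r) (Ioi 0) :=
      Integrable.const_mul integrableOn_G _
    refine hi.congr_fun (fun r hr => ?_) measurableSet_Ioi
    have hr0 : r ≠ 0 := ne_of_gt hr
    have hs : √(4 * Real.pi) ^ 2 = 4 * Real.pi := Real.sq_sqrt (by positivity)
    simp only [finrank_euclideanSpace, Fintype.card_fin, smul_eq_mul, G, div_pow, mul_pow, hs]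
    field_simp

/-- The coupling function as a vector of `L²(ℝ³)`. -/
def couplingVec : Photon := memLp_coupling.toLp coupling

/-- The maximal domain of multiplication by `|k|` in the second component:
pairs `(z, f)` with `|k| f ∈ L²(ℝ³)`. -/
def hamiltonianDomain : Submodule ℂ Space where
  carrier := {ψ | MemLp (fun k : Momentum => (‖k‖ : ℂ) * ψ.snd k) 2 volume}
  zero_mem' := by
    refine (MemLp.zero (ε := ℂ)).ae_eq ?_
    filter_upwards [Lp.coeFn_zero ℂ 2 (volume : Measure Momentum)] with k hk
    simp [hk]
  add_mem' := by
    intro ψ φ hψ hφ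
    refine (MemLp.add hψ hφ).ae_eq ?_
    filter_upwards [Lp.coeFn_add ψ.snd φ.snd] with k hk
    simp only [WithLp.add_snd, Pi.add_apply] at hk ⊢
    rw [hk, mul_add]
  smul_mem' := by
    intro c ψ hψ
    refine (MemLp.const_smul hψ c).ae_eq ?_
    filter_upwards [Lp.coeFn_smul c ψ.snd] with k hk
    simp only [WithLp.smul_snd, Pi.smul_apply, smul_eq_mul] at hk ⊢
    rw [hk, mul_left_comm]

/-- Multiplication by `|k|` on the second component of vectors in the domain. -/
def photonEnergy : hamiltonianDomain →ₗ[ℂ] Photon where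
  toFun ψ := MemLp.toLp (fun k : Momentum => (‖k‖ : ℂ) * (ψ : Space).snd k) ψ.2
  map_add' ψ φ := by
    refine Lp.ext ?_
    filter_upwards [Lp.coeFn_add (ψ : Space).snd (φ : Space).snd,
      MemLp.coeFn_toLp (show MemLp (fun k : Momentum => (‖k‖ : ℂ) * (ψ : Space).snd k) 2 volume
        from ψ.2),
      MemLp.coeFn_toLp (show MemLp (fun k : Momentum => (‖k‖ : ℂ) * (φ : Space).snd k) 2 volume
        from φ.2),
      MemLp.coeFn_toLp (show MemLp (fun k : Momentum => (‖k‖ : ℂ) *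
        ((ψ + φ : hamiltonianDomain) : Space).snd k) 2 volume from (ψ + φ).2),
      Lp.coeFn_add
        (MemLp.toLp (fun k : Momentum => (‖k‖ : ℂ) * (ψ : Space).snd k) ψ.2)
        (MemLp.toLp (fun k : Momentum => (‖k‖ : ℂ) * (φ : Space).snd k) φ.2)]
      with k h1 h2 h3 h4 h5
    rw [h4, h5, Pi.add_apply, h2, h3]
    simp only [Submodule.coe_add, WithLp.add_snd, Pi.add_apply] at h1 ⊢
    rw [h1, mul_add]
  map_smul' c ψ := by
    refine Lp.ext ?_
    filter_upwards [Lp.coeFn_smul c (ψ : Space).snd,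
      MemLp.coeFn_toLp (show MemLp (fun k : Momentum => (‖k‖ : ℂ) * (ψ : Space).snd k) 2 volume
        from ψ.2),
      MemLp.coeFn_toLp (show MemLp (fun k : Momentum => (‖k‖ : ℂ) *
        ((c • ψ : hamiltonianDomain) : Space).snd k) 2 volume from (c • ψ).2),
      Lp.coeFn_smul c (MemLp.toLp (fun k : Momentum => (‖k‖ : ℂ) * (ψ : Space).snd k) ψ.2)]
      with k h1 h2 h3 h4
    rw [h3, RingHom.id_apply, h4, Pi.smul_apply, h2]
    simp only [Submodule.coe_smul, WithLp.smul_snd, Pi.smul_apply, smul_eq_mul] at h1 ⊢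
    rw [h1, mul_left_comm]

/-- The Hamiltonian in the one-excitation sector (Friedrichs model),
`H (z, f) = (E₀ z + β ⟨g, f⟩, β z g + |k| f)`. -/
def hamiltonian (E₀ β : ℝ) : Space →ₗ.[ℂ] Space where
  domain := hamiltonianDomain
  toFun :=
    { toFun := fun ψ => WithLp.toLp 2
        ((E₀ : ℂ) * (ψ : Space).fst + (β : ℂ) * ⟪couplingVec, (ψ : Space).snd⟫_ℂ,
          ((β : ℂ) * (ψ : Space).fst) • couplingVec + photonEnergy ψ)
      map_add' := by
        intro ψ φ
        rw [map_add, ← WithLp.toLp_add, Prod.mk_add_mk]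
        congr 2
        · simp only [Submodule.coe_add, WithLp.add_snd, WithLp.add_fst, inner_add_right]; ring
        · simp only [Submodule.coe_add, WithLp.add_fst, mul_add, add_smul]; abel
      map_smul' := by
        intro c ψ
        rw [map_smul, RingHom.id_apply, ← WithLp.toLp_smul, Prod.smul_mk]
        congr 2
        · simp only [Submodule.coe_smul, WithLp.smul_snd, WithLp.smul_fst, inner_smul_right,
            smul_eq_mul]; ring
        · simp only [Submodule.coe_smul, WithLp.smul_fst, smul_add, smul_smul, smul_eq_mul,
            mul_left_comm] }

/-- The Weisskopf–Wigner state `Φ₁ = (1, 0)`: excited atom, no photon. -/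
def Φ₁ : Space := WithLp.toLp 2 (1, 0)

/-- The half-width `Γ = 2π β² G(E₀)`. -/
def halfWidth (E₀ β : ℝ) : ℝ := 2 * Real.pi * β ^ 2 * G E₀

end WeisskopfWigner

end

open WeisskopfWigner

namespace WeisskopfWigner

/-! ### Unitary groups with a prescribed generator: uniqueness and Laplace transforms -/

section UnitaryGroup

variable {E : Type*} [NormedAddCommGroup E] [InnerProductSpace ℂ E]
  {H : E →ₗ.[ℂ] E} {U V : ℝ → E ≃ₗᵢ[ℂ] E}

/-! Dynamics. Eliminating the photon component (a Schur complement) solves `(H - z) x = y`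
explicitly for every non-real `z`; the only obstruction would be a zero of `F(z) = E₀ - z - β² ∫
G(k)/(k - z) dk`, and `Im F` never vanishes off the real axis. Being symmetric with `H - ic` onto,
`H` generates a unitary group by a Yosida approximation (`exists_isUnitaryGroupOf`). The same
computation gives `⟨Φ₁, (H - z)⁻¹ Φ₁⟩ = 1/F(z)`, so the Laplace transform of `R` is `-i/F`
(`integral_exp_mul_returnAmplitude`).

Decay. The condition `β² ∫ G/k < E₀` keeps `F` away from zero at and below the threshold; above it
`Im F` does so, as `G > 0` there. Together they give `|F(x + iε)| ≥ c (1 + |x|)` uniformly for `0 <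
ε ≤ 1` (`exists_le_norm_denominator`). Hence `1/F` has boundary values on the real axis, and `R` is
the Fourier transform of the density `ρ = Im(1/F(x + i0))/π`. Plancherel gives the sojourn time
twice: `τ = (2π)⁻¹ ∫ |1/F|² = π ∫ ρ²`. Since `F'` has only an integrable singularity at the
threshold, `R = O(1/t)`; this yields `R ∈ L²`, `t Q(t) → 0`, and the average lifetime formula by
integration by parts.

Uncertainty. The variance of `ρ` about `E₀` is at most `ΔE²` (`variance_le`), and a density of
variance at most `σ²` has `∫ ρ² ≥ 3√5/(25σ)`, the extremal being a truncated parabola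
(`le_mul_integral_sq`).

Lifetime. On the axis `Im(1/F) = π β² G |1/F|²`. With `w = β² |1/F|²`, the normalization `R(0) = 1`
reads `∫ G w = 1`, while `Γ τ = G(E₀) ∫ w`. Thus `Γ τ - 1 = ∫ (G(E₀) - G) w`, which is small because
`w` is concentrated near `E₀` and `G` is Lipschitz (`abs_halfWidth_mul_sojournTime_sub_one_le`).
What remains is numerical: a window around `E₀` where `G` is almost constant, and explicit majorants
outside it. -/

lemma hasDerivAt_norm_sq {f : ℝ → E} {f' : E} {t : ℝ} (h : HasDerivAt f f' t) :
    HasDerivAt (fun s => ‖f s‖ ^ 2) (2 * (⟪f t, f'⟫_ℂ).re) t := by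
  let _ := InnerProductSpace.rclikeToReal ℂ E
  exact HasDerivAt.norm_sq h

namespace IsUnitaryGroupOf

lemma hasDerivAt_of_hasDerivAt_zero (hU : IsUnitaryGroupOf H U) {ψ φ : E}
    (h : HasDerivAt (fun t => U t ψ) φ 0) (t : ℝ) : HasDerivAt (fun t => U t ψ) (U t φ) t := by
  have h1 : HasDerivAt (fun s => U t (U s ψ)) (U t φ) (t - t) := by
    rw [sub_self]
    exact (U t).toContinuousLinearEquiv.toContinuousLinearMap.hasFDerivAt.restrictScalars ℝ
      |>.comp_hasDerivAt 0 h
  have h2 := HasDerivAt.comp_sub_const (f := fun s => U t (U s ψ)) t t h1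
  refine h2.congr_of_eventuallyEq (Eventually.of_forall fun s => ?_)
  simp only
  rw [← hU.map_add]
  congr 2; ring

lemma hasDerivAt (hU : IsUnitaryGroupOf H U) {ψ φ : E} (h : (ψ, φ) ∈ H.graph) (t : ℝ) :
    HasDerivAt (fun t => U t ψ) (-(Complex.I • U t φ)) t := by
  have := hU.hasDerivAt_of_hasDerivAt_zero ((hU.generator ψ φ).1 h) t
  simpa using this

lemma graph_apply (hU : IsUnitaryGroupOf H U) {ψ φ : E} (h : (ψ, φ) ∈ H.graph) (t : ℝ) :
    (U t ψ, U t φ) ∈ H.graph := by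
  rw [hU.generator]
  have h1 := hU.hasDerivAt h t
  have h2 : HasDerivAt (fun s => U (s + t) ψ) (-(Complex.I • U t φ)) 0 :=
    HasDerivAt.comp_add_const 0 t (by simpa using h1)
  refine h2.congr_of_eventuallyEq (Eventually.of_forall fun s => ?_)
  exact (hU.map_add s t ψ).symm

/-- Norm conservation differentiated at `t = 0`: the form of symmetry of `H` that uniqueness uses.
-/
lemma im_inner_eq_zero (hU : IsUnitaryGroupOf H U) {ψ φ : E} (h : (ψ, φ) ∈ H.graph) :
    (⟪ψ, φ⟫_ℂ).im = 0 := by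
  have h1 := hasDerivAt_norm_sq ((hU.generator ψ φ).1 h)
  have h2 : HasDerivAt (fun t => ‖U t ψ‖ ^ 2) 0 0 := by
    simpa using hasDerivAt_const (0 : ℝ) (‖ψ‖ ^ 2)
  have h3 := h1.unique h2
  rw [hU.map_zero, inner_neg_right, inner_smul_right] at h3
  simpa using h3

/-- The difference `d` of two orbits with the same initial vector in the domain solves the same
equation, so `‖d‖²` has derivative `2 Im⟨d, H d⟩ = 0` and stays zero; density does the rest. -/
theorem unique (hU : IsUnitaryGroupOf H U) (hV : IsUnitaryGroupOf H V)
    (hd : Dense (H.domain : Set E)) : U = V := by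
  funext t
  ext ψ
  have key : ∀ ψ ∈ (H.domain : Set E), U t ψ = V t ψ := by
    intro ψ hψ
    obtain ⟨φ, hφ⟩ := LinearPMap.mem_domain_iff.1 hψ
    have hder : ∀ s, HasDerivAt (fun s => ‖U s ψ - V s ψ‖ ^ 2) 0 s := by
      intro s
      have h1 := hasDerivAt_norm_sq ((hU.hasDerivAt hφ s).sub (hV.hasDerivAt hφ s))
      have h2 : (U s ψ - V s ψ, U s φ - V s φ) ∈ H.graph :=
        H.graph.sub_mem (hU.graph_apply hφ s) (hV.graph_apply hφ s)
      refine h1.congr_deriv ?_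
      rw [← neg_sub', inner_neg_right, ← smul_sub, inner_smul_right]
      simp [hU.im_inner_eq_zero h2]
    have h0 := is_const_of_deriv_eq_zero (fun s => (hder s).differentiableAt)
      (fun s => (hder s).deriv) t 0
    simp only [hU.map_zero, hV.map_zero, sub_self, norm_zero] at h0
    simpa [sub_eq_zero] using h0
  exact congrFun (Continuous.ext_on hd (U t).continuous (V t).continuous key) ψ

lemma continuous_returnAmplitude (hU : IsUnitaryGroupOf H U) (ψ : E) :
    Continuous (returnAmplitude U ψ) := continuous_const.inner (hU.continuous ψ)

lemma norm_returnAmplitude_le (ψ : E) (t : ℝ) : ‖returnAmplitude U ψ t‖ ≤ ‖ψ‖ ^ 2 := by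
  refine (norm_inner_le_norm _ _).trans ?_
  rw [LinearIsometryEquiv.norm_map, sq]

lemma returnAmplitude_neg (hU : IsUnitaryGroupOf H U) (ψ : E) (t : ℝ) :
    returnAmplitude U ψ (-t) = starRingEnd ℂ (returnAmplitude U ψ t) := by
  unfold returnAmplitude
  rw [inner_conj_symm, ← (U t).inner_map_map, ← hU.map_add, add_neg_cancel, hU.map_zero]

lemma hasDerivAt_returnAmplitude (hU : IsUnitaryGroupOf H U) {ψ φ : E} (h : (ψ, φ) ∈ H.graph)
    (t : ℝ) : HasDerivAt (returnAmplitude U ψ) (-(Complex.I * ⟪ψ, U t φ⟫_ℂ)) t := by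
  have := (hasDerivAt_const t ψ).inner ℂ (hU.hasDerivAt h t)
  exact this.congr_deriv (by simp [inner_smul_right])

lemma contDiff_returnProbability (hU : IsUnitaryGroupOf H U) {ψ φ : E} (h : (ψ, φ) ∈ H.graph) :
    ContDiff ℝ 1 (returnProbability U ψ) := by
  have h1 : ContDiff ℝ 1 (returnAmplitude U ψ) := by
    rw [contDiff_one_iff_deriv]
    refine ⟨fun t => (hU.hasDerivAt_returnAmplitude h t).differentiableAt, ?_⟩
    rw [show deriv (returnAmplitude U ψ) = fun t => -(Complex.I * ⟪ψ, U t φ⟫_ℂ) from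
      funext fun t => (hU.hasDerivAt_returnAmplitude h t).deriv]
    exact (continuous_const.mul (continuous_const.inner (hU.continuous φ))).neg
  exact h1.norm_sq ℝ

/-- The Laplace transform of a matrix element of the group is a matrix element of the resolvent. -/
theorem integral_exp_mul_inner (hU : IsUnitaryGroupOf H U) {ψ φ χ : E} (h : (ψ, φ) ∈ H.graph)
    {z : ℂ} (hz : 0 < z.im) :
    ∫ t in Ioi (0 : ℝ), Complex.exp (Complex.I * z * t) * ⟪χ, U t (φ - z • ψ)⟫_ℂ
      = -Complex.I * ⟪χ, ψ⟫_ℂ := by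
  have hre : (Complex.I * z).re < 0 := by simpa using hz
  -- `exp(izt) ⟨χ, U t ψ⟩` is a primitive of `-i` times the integrand, and `Im z > 0` kills the
  -- boundary term at infinity.
  have hd : ∀ t : ℝ, HasDerivAt (fun t : ℝ => Complex.exp (Complex.I * z * t) * ⟪χ, U t ψ⟫_ℂ)
      (-Complex.I * (Complex.exp (Complex.I * z * t) * ⟪χ, U t (φ - z • ψ)⟫_ℂ)) t := by
    intro t
    have h1 : HasDerivAt (fun t : ℝ => Complex.exp (Complex.I * z * t))
        (Complex.exp (Complex.I * z * t) * (Complex.I * z)) t := by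
      have := ((hasDerivAt_id (t : ℂ)).const_mul (Complex.I * z)).cexp.comp_ofReal
      simpa using this
    have h2 := (hasDerivAt_const t χ).inner ℂ (hU.hasDerivAt h t)
    refine (h1.mul h2).congr_deriv ?_
    simp only [map_sub, map_smul, inner_sub_right, inner_smul_right, inner_neg_right,
      inner_zero_left]
    ring
  have hb : ∀ (t : ℝ) (ξ : E), ‖Complex.exp (Complex.I * z * t) * ⟪χ, U t ξ⟫_ℂ‖
      ≤ Real.exp ((Complex.I * z).re * t) * (‖χ‖ * ‖ξ‖) := by
    intro t ξ
    rw [norm_mul, Complex.norm_exp, Complex.re_mul_ofReal]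
    gcongr
    simpa using norm_inner_le_norm (𝕜 := ℂ) χ (U t ξ)
  have hint : IntegrableOn
      (fun t : ℝ => Complex.exp (Complex.I * z * t) * ⟪χ, U t (φ - z • ψ)⟫_ℂ) (Ioi 0) := by
    refine Integrable.mono' ((integrableOn_exp_mul_Ioi hre 0).mul_const (‖χ‖ * ‖φ - z • ψ‖)) ?_
      (ae_of_all _ fun t => hb t _)
    have := hU.continuous (φ - z • ψ)
    exact (Continuous.aestronglyMeasurable (by fun_prop))
  have hlim : Tendsto (fun t : ℝ => Complex.exp (Complex.I * z * t) * ⟪χ, U t ψ⟫_ℂ) atTop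
      (𝓝 0) := by
    refine squeeze_zero_norm (fun t => hb t ψ) ?_
    have h3 : Tendsto (fun t : ℝ => (Complex.I * z).re * t) atTop atBot :=
      tendsto_id.const_mul_atTop_of_neg hre
    simpa using (Real.tendsto_exp_atBot.comp h3).mul_const (‖χ‖ * ‖ψ‖)
  have h4 := integral_Ioi_of_hasDerivAt_of_tendsto' (fun t _ => hd t) (hint.const_mul _) hlim
  rw [integral_const_mul] at h4
  have h5 : (∫ t in Ioi (0 : ℝ), Complex.exp (Complex.I * z * t) * ⟪χ, U t (φ - z • ψ)⟫_ℂ)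
      = Complex.I * (-Complex.I * ∫ t in Ioi (0 : ℝ),
        Complex.exp (Complex.I * z * t) * ⟪χ, U t (φ - z • ψ)⟫_ℂ) := by
    rw [← mul_assoc]; simp
  rw [h5, h4]
  simp [hU.map_zero]

end IsUnitaryGroupOf

end UnitaryGroup

/-! ### Strong limits of bounded unitary groups -/

section Yosida

variable {E : Type*} [NormedAddCommGroup E] [InnerProductSpace ℂ E] [CompleteSpace E]

/-- The exponential `exp (-i t A)` of a bounded operator. -/
noncomputable def boundedGroup (A : E →L[ℂ] E) (t : ℝ) : E →L[ℂ] E :=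
  NormedSpace.exp (t • -(Complex.I • A))

variable {A B : E →L[ℂ] E}

lemma boundedGroup_zero (A : E →L[ℂ] E) : boundedGroup A 0 = 1 := by
  simp [boundedGroup, NormedSpace.exp_zero]

lemma boundedGroup_add (A : E →L[ℂ] E) (s t : ℝ) :
    boundedGroup A (s + t) = boundedGroup A s * boundedGroup A t := by
  let +nondep : NormedAlgebra ℚ (E →L[ℂ] E) := .restrictScalars ℚ ℂ (E →L[ℂ] E)
  unfold boundedGroup
  rw [add_smul, NormedSpace.exp_add_of_commute]
  exact ((Commute.refl _).smul_left _).smul_right _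

lemma boundedGroup_add_generator (h : Commute A B) (t : ℝ) :
    boundedGroup (A + B) t = boundedGroup A t * boundedGroup B t := by
  let +nondep : NormedAlgebra ℚ (E →L[ℂ] E) := .restrictScalars ℚ ℂ (E →L[ℂ] E)
  unfold boundedGroup
  rw [smul_add, neg_add, smul_add, NormedSpace.exp_add_of_commute]
  exact ((((h.smul_left _).smul_right _).neg_left.neg_right).smul_left _).smul_right _

lemma hasDerivAt_boundedGroup (A : E →L[ℂ] E) (x : E) (t : ℝ) :
    HasDerivAt (fun t => boundedGroup A t x) (boundedGroup A t (-(Complex.I • A x))) t := by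
  have h := hasDerivAt_exp_smul_const (𝕂 := ℝ) (-(Complex.I • A)) t
  have h2 := ((ContinuousLinearMap.apply ℂ E x).restrictScalars ℝ).hasFDerivAt.comp_hasDerivAt t h
  refine h2.congr_deriv ?_
  simp [boundedGroup]

lemma hasDerivAt_boundedGroup' (A : E →L[ℂ] E) (x : E) (t : ℝ) :
    HasDerivAt (fun t => boundedGroup A t x) (-(Complex.I • A (boundedGroup A t x))) t := by
  have h := hasDerivAt_exp_smul_const' (𝕂 := ℝ) (-(Complex.I • A)) t
  have h2 := ((ContinuousLinearMap.apply ℂ E x).restrictScalars ℝ).hasFDerivAt.comp_hasDerivAt t h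
  refine h2.congr_deriv ?_
  simp [boundedGroup]

lemma norm_boundedGroup (hA : (A : E →ₗ[ℂ] E).IsSymmetric) (t : ℝ) (x : E) :
    ‖boundedGroup A t x‖ = ‖x‖ := by
  have hder : ∀ s, HasDerivAt (fun s => ‖boundedGroup A s x‖ ^ 2) 0 s := by
    intro s
    refine (hasDerivAt_norm_sq (hasDerivAt_boundedGroup' A x s)).congr_deriv ?_
    have h1 : (⟪boundedGroup A s x, A (boundedGroup A s x)⟫_ℂ).im = 0 :=
      hA.im_inner_self_apply _
    rw [inner_neg_right, inner_smul_right]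
    simp [h1]
  have h0 := is_const_of_deriv_eq_zero (fun s => (hder s).differentiableAt)
    (fun s => (hder s).deriv) t 0
  simp only [boundedGroup_zero, one_apply_eq_self] at h0
  exact (sq_eq_sq₀ (norm_nonneg _) (norm_nonneg _)).1 h0

lemma norm_boundedGroup_sub_self_le (hA : (A : E →ₗ[ℂ] E).IsSymmetric) (t : ℝ) (x : E) :
    ‖boundedGroup A t x - x‖ ≤ ‖A x‖ * |t| := by
  have := convex_univ.norm_image_sub_le_of_norm_hasDerivWithin_le (C := ‖A x‖)
    (fun s _ => (hasDerivAt_boundedGroup A x s).hasDerivWithinAt)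
    (fun s _ => by rw [norm_boundedGroup hA, norm_neg, norm_smul]; simp)
    (mem_univ 0) (mem_univ t)
  simpa [boundedGroup_zero] using this

/-- Commutativity factors one exponential as the other times `exp(-it(A - B))`; the isometric factor
drops out of the norm, and what is left moves `x` by at most `‖(A - B) x‖ |t|`. -/
lemma norm_boundedGroup_sub_le (hA : (A : E →ₗ[ℂ] E).IsSymmetric)
    (hB : (B : E →ₗ[ℂ] E).IsSymmetric) (h : Commute A B) (t : ℝ) (x : E) :
    ‖boundedGroup A t x - boundedGroup B t x‖ ≤ ‖A x - B x‖ * |t| := by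
  have h1 : boundedGroup A t = boundedGroup B t * boundedGroup (A - B) t := by
    rw [← boundedGroup_add_generator (h.symm.sub_right (Commute.refl _)), add_sub_cancel]
  rw [h1, mul_apply_eq_comp, ← map_sub, norm_boundedGroup hB]
  exact norm_boundedGroup_sub_self_le (A := A - B) (hA.sub hB) t x

/-- Commuting bounded self-adjoint operators which converge on a dense set generate unitary groups
which converge to a strongly continuous unitary group. -/
theorem exists_limit_group (A : ℕ → E →L[ℂ] E) (hA : ∀ n, (A n : E →ₗ[ℂ] E).IsSymmetric)
    (hc : ∀ m n, Commute (A m) (A n)) {D : Set E} (hD : Dense D)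
    (hlim : ∀ x ∈ D, ∃ y, Tendsto (fun n => A n x) atTop (𝓝 y)) :
    ∃ U : ℝ → E ≃ₗᵢ[ℂ] E, (∀ x, U 0 x = x) ∧ (∀ s t x, U (s + t) x = U s (U t x)) ∧
      (∀ x, Continuous fun t => U t x) ∧
      ∀ x y, Tendsto (fun n => A n x) atTop (𝓝 y) →
        HasDerivAt (fun t => U t x) (-(Complex.I • y)) 0 := by
  -- Convergence on `D` is the commuting estimate; isometry lets it pass to all of `E` by an `ε/3`
  -- argument.
  have hcau : ∀ (t : ℝ) (x : E), ∃ y, Tendsto (fun n => boundedGroup (A n) t x) atTop (𝓝 y) := by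
    intro t x
    refine cauchySeq_tendsto_of_complete (Metric.cauchySeq_iff'.2 fun ε hε => ?_)
    obtain ⟨x', hx', hxx'⟩ := hD.exists_dist_lt x (show 0 < ε / 3 by positivity)
    obtain ⟨y, hy⟩ := hlim x' hx'
    obtain ⟨N, hN⟩ := Metric.cauchySeq_iff'.1 hy.cauchySeq (ε / 3 / (|t| + 1)) (by positivity)
    refine ⟨N, fun n hn => ?_⟩
    have h1 := norm_boundedGroup_sub_le (hA n) (hA N) (hc n N) t x'
    have h2 := hN n hn
    rw [dist_eq_norm] at h2 hxx' ⊢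
    have h3 : ‖A n x' - A N x'‖ * |t| ≤ ε / 3 := by
      rw [lt_div_iff₀ (by positivity)] at h2
      nlinarith [norm_nonneg (A n x' - A N x'), abs_nonneg t]
    calc ‖boundedGroup (A n) t x - boundedGroup (A N) t x‖
        = ‖boundedGroup (A n) t (x - x') + (boundedGroup (A n) t x' - boundedGroup (A N) t x')
          - boundedGroup (A N) t (x - x')‖ := by
          congr 1; simp only [map_sub]; abel
      _ ≤ ‖boundedGroup (A n) t (x - x')‖ + ‖boundedGroup (A n) t x' - boundedGroup (A N) t x'‖
          + ‖boundedGroup (A N) t (x - x')‖ := (norm_sub_le _ _).trans (by gcongr; exact norm_add_le _ _)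
      _ < ε := by rw [norm_boundedGroup (hA n), norm_boundedGroup (hA N)]; linarith
  choose u hu using hcau
  have hnorm : ∀ t x, ‖u t x‖ = ‖x‖ := fun t x =>
    tendsto_nhds_unique (hu t x).norm (by simp [norm_boundedGroup (hA _)])
  have hadd : ∀ s t x, u (s + t) x = u s (u t x) := by
    intro s t x
    refine tendsto_nhds_unique (hu (s + t) x) ?_
    have h1 : Tendsto (fun n => boundedGroup (A n) s (boundedGroup (A n) t x - u t x)) atTop
        (𝓝 0) := by
      refine tendsto_zero_iff_norm_tendsto_zero.2 ?_
      simp only [norm_boundedGroup (hA _)]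
      exact tendsto_zero_iff_norm_tendsto_zero.1 (by simpa using (hu t x).sub_const (u t x))
    have h2 := h1.add (hu s (u t x))
    rw [zero_add] at h2
    refine h2.congr fun n => ?_
    rw [boundedGroup_add, map_sub, sub_add_cancel, mul_apply_eq_comp]
  have hzero : ∀ x, u 0 x = x := fun x =>
    tendsto_nhds_unique (hu 0 x) (by simp [boundedGroup_zero])
  let ul : ℝ → E →ₗ[ℂ] E := fun t =>
    { toFun := u t
      map_add' := fun x y => tendsto_nhds_unique (hu t (x + y))
        (by simpa using (hu t x).add (hu t y))
      map_smul' := fun c x => tendsto_nhds_unique (hu t (c • x))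
        (by simpa using (hu t x).const_smul c) }
  -- Surjectivity is free: the group law makes `u (-t)` the inverse.
  let U : ℝ → E ≃ₗᵢ[ℂ] E := fun t =>
    { toLinearEquiv := LinearEquiv.ofLinearMap (ul t) (ul (-t))
        (by ext x; change u t (u (-t) x) = x; rw [← hadd, add_neg_cancel, hzero])
        (by ext x; change u (-t) (u t x) = x; rw [← hadd, neg_add_cancel, hzero])
      norm_map' := fun x => hnorm t x }
  have hUu : ∀ t x, U t x = u t x := fun t x => rfl
  have hlip : ∀ x y, Tendsto (fun n => A n x) atTop (𝓝 y) → ∀ t, ‖u t x - x‖ ≤ ‖y‖ * |t| := by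
    intro x y hy t
    exact le_of_tendsto_of_tendsto ((hu t x).sub_const x).norm (hy.norm.mul_const _)
      (Eventually.of_forall fun n => norm_boundedGroup_sub_self_le (hA n) t x)
  have hcontD : ∀ x ∈ D, Continuous fun t => u t x := by
    intro x hx
    obtain ⟨y, hy⟩ := hlim x hx
    refine (LipschitzWith.of_dist_le_mul (K := ‖y‖₊) fun s t => ?_).continuous
    have h1 : u s x - u t x = U t (u (s - t) x - x) := by
      rw [map_sub, hUu, hUu, ← hadd]; congr 2; ring
    rw [dist_eq_norm, h1, LinearIsometryEquiv.norm_map, Real.dist_eq]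
    exact hlip x y hy (s - t)
  have hcont : ∀ x, Continuous fun t => u t x := by
    intro x
    refine continuous_of_uniform_approx_of_continuous fun V hV => ?_
    obtain ⟨ε, hε, hεV⟩ := Metric.mem_uniformity_dist.1 hV
    obtain ⟨x', hx', hxx'⟩ := hD.exists_dist_lt x hε
    refine ⟨_, hcontD x' hx', fun t => hεV ?_⟩
    rw [← hUu, ← hUu, LinearIsometryEquiv.dist_map]
    exact hxx'
  refine ⟨U, hzero, hadd, hcont, fun x y hy => ?_⟩
  -- The integrated form of the evolution equation survives the strong limit; differentiating it at
  -- `0` then identifies the generator on such `x`.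
  have hint : ∀ t, u t x - x = ∫ s in (0 : ℝ)..t, u s (-(Complex.I • y)) := by
    intro t
    have h1 : ∀ n, boundedGroup (A n) t x - x
        = ∫ s in (0 : ℝ)..t, boundedGroup (A n) s (-(Complex.I • A n x)) := by
      intro n
      rw [intervalIntegral.integral_eq_sub_of_hasDerivAt
        (fun s _ => hasDerivAt_boundedGroup (A n) x s)]
      · simp [boundedGroup_zero]
      · refine Continuous.intervalIntegrable ?_ _ _
        exact continuous_iff_continuousAt.2 fun s =>
          (hasDerivAt_boundedGroup (A n) _ s).continuousAt
    refine tendsto_nhds_unique ((hu t x).sub_const x) ?_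
    simp only [h1]
    refine intervalIntegral.tendsto_integral_filter_of_dominated_convergence
      (fun _ => ‖y‖ + 1) (Eventually.of_forall fun n => ?_) ?_ intervalIntegrable_const
      (ae_of_all _ fun s _ => ?_)
    · exact (continuous_iff_continuousAt.2 fun s =>
          (hasDerivAt_boundedGroup (A n) _ s).continuousAt).aestronglyMeasurable
    · filter_upwards [hy.norm.eventually_le_const (lt_add_one ‖y‖)] with n hn
      refine ae_of_all _ fun s _ => ?_
      rw [norm_boundedGroup (hA n), norm_neg, norm_smul]
      simpa using hn
    · have h2 : Tendsto (fun n => boundedGroup (A n) s (Complex.I • y - Complex.I • A n x)) atTop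
          (𝓝 0) := by
        refine tendsto_zero_iff_norm_tendsto_zero.2 ?_
        simp only [norm_boundedGroup (hA _)]
        exact tendsto_zero_iff_norm_tendsto_zero.1
          (by simpa using (hy.const_smul Complex.I).const_sub (Complex.I • y))
      have h3 := h2.add (hu s (-(Complex.I • y)))
      rw [zero_add] at h3
      refine h3.congr fun n => ?_
      rw [← map_add]
      congr 1; abel
  have h4 := ((hcont (-(Complex.I • y))).integral_hasStrictDerivAt 0 0).hasDerivAt.add_const x
  rw [hzero] at h4
  refine h4.congr_of_eventuallyEq (Eventually.of_forall fun t => ?_)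
  simp only [hUu, ← hint]
  abel

end Yosida

/-! ### Stone's theorem from surjectivity of `H - ic` -/

section Stone

variable {E : Type*} [NormedAddCommGroup E] [InnerProductSpace ℂ E] {H : E →ₗ.[ℂ] E}

lemma inner_self_eq_ofReal (x : E) : ⟪x, x⟫_ℂ = ((‖x‖ ^ 2 : ℝ) : ℂ) := by
  rw [inner_self_eq_norm_sq_to_K]; push_cast; rfl

/-- `⟨x, H x⟩` is real, so the imaginary part of `⟨x, (H - ic) x⟩` is `-c ‖x‖²`; then
Cauchy–Schwarz. This gives injectivity of `H - ic` and the resolvent bound `1/|c|`. -/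
lemma mul_norm_le_norm_sub_I_smul (hs : ∀ x y : H.domain, ⟪H x, (y : E)⟫_ℂ = ⟪(x : E), H y⟫_ℂ)
    (c : ℝ) (x : H.domain) : |c| * ‖(x : E)‖ ≤ ‖H x - (c * Complex.I) • (x : E)‖ := by
  have h1 : (⟪(x : E), H x⟫_ℂ).im = 0 := by
    have h := congrArg Complex.im (inner_conj_symm (𝕜 := ℂ) (x : E) (H x))
    rw [hs, Complex.conj_im] at h
    linarith
  have h2 : (⟪(x : E), H x - (c * Complex.I) • (x : E)⟫_ℂ).im = -(c * ‖(x : E)‖ ^ 2) := by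
    rw [inner_sub_right, inner_smul_right, Complex.sub_im, h1, inner_self_eq_ofReal,
      zero_sub, mul_assoc, Complex.im_ofReal_mul, mul_comm Complex.I, Complex.im_ofReal_mul]
    simp
  have h3 : |c| * ‖(x : E)‖ ^ 2 ≤ ‖(x : E)‖ * ‖H x - (c * Complex.I) • (x : E)‖ := by
    refine le_trans ?_ (norm_inner_le_norm (𝕜 := ℂ) _ _)
    refine le_trans (le_of_eq ?_) (Complex.abs_im_le_norm _)
    rw [h2, abs_neg, abs_mul, abs_of_nonneg (sq_nonneg ‖(x : E)‖)]
  rcases (norm_nonneg (x : E)).eq_or_lt with h | h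
  · rw [← h]; simp
  · refine le_of_mul_le_mul_left ?_ h
    linarith

lemma exists_resolvent (hs : ∀ x y : H.domain, ⟪H x, (y : E)⟫_ℂ = ⟪(x : E), H y⟫_ℂ) {c : ℝ}
    (hc : c ≠ 0) (hr : ∀ y, ∃ x : H.domain, H x - (c * Complex.I) • (x : E) = y) :
    ∃ R : E →L[ℂ] E, (∀ y, ‖R y‖ ≤ |c|⁻¹ * ‖y‖) ∧
      (∀ x : H.domain, R (H x - (c * Complex.I) • (x : E)) = x) ∧
      ∀ y, ∃ x : H.domain, (x : E) = R y ∧ H x - (c * Complex.I) • (x : E) = y := by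
  choose r hr using hr
  have hinj : ∀ x x' : H.domain, H x - (c * Complex.I) • (x : E)
      = H x' - (c * Complex.I) • (x' : E) → (x : E) = x' := by
    intro x x' h
    have h1 := mul_norm_le_norm_sub_I_smul hs c (x - x')
    have h2 : H (x - x') - (c * Complex.I) • ((x - x' : H.domain) : E) = 0 := by
      rw [LinearPMap.map_sub, Submodule.coe_sub, smul_sub, sub_sub_sub_comm, h, sub_self]
    rw [h2, norm_zero] at h1
    have h3 : ‖((x - x' : H.domain) : E)‖ ≤ 0 := by
      have : 0 < |c| := abs_pos.2 hc
      by_contra! h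
      nlinarith
    simpa [sub_eq_zero] using h3
  have hb : ∀ y, ‖(r y : E)‖ ≤ |c|⁻¹ * ‖y‖ := by
    intro y
    have h1 := mul_norm_le_norm_sub_I_smul hs c (r y)
    rw [hr] at h1
    rwa [inv_mul_eq_div, le_div_iff₀' (abs_pos.2 hc)]
  let Rl : E →ₗ[ℂ] E :=
    { toFun := fun y => r y
      map_add' := fun y y' => by
        rw [← Submodule.coe_add]
        refine hinj _ _ ?_
        rw [hr, LinearPMap.map_add, Submodule.coe_add, smul_add, add_sub_add_comm, hr, hr]
      map_smul' := fun a y => by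
        rw [RingHom.id_apply, ← Submodule.coe_smul]
        refine hinj _ _ ?_
        rw [hr, LinearPMap.map_smul, Submodule.coe_smul, smul_comm _ a, ← smul_sub, hr] }
  refine ⟨Rl.mkContinuous |c|⁻¹ hb, hb, fun x => hinj _ _ (hr _), fun y => ⟨r y, rfl, hr y⟩⟩

/-- **Stone's theorem** (existence): a densely defined symmetric operator `H` such that `H - i c` is
onto for all real `c ≠ 0` generates a strongly continuous unitary group. -/
theorem exists_isUnitaryGroupOf [CompleteSpace E] (hd : Dense (H.domain : Set E))
    (hs : ∀ x y : H.domain, ⟪H x, (y : E)⟫_ℂ = ⟪(x : E), H y⟫_ℂ)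
    (hr : ∀ c : ℝ, c ≠ 0 → ∀ y, ∃ x : H.domain, H x - (c * Complex.I) • (x : E) = y) :
    ∃ U : ℝ → E ≃ₗᵢ[ℂ] E, IsUnitaryGroupOf H U := by
  choose! R hRb hRl hRr using fun (c : ℝ) (hc : c ≠ 0) => exists_resolvent hs hc (hr c hc)
  have hadj : ∀ c : ℝ, c ≠ 0 → ∀ y y', ⟪R c y, y'⟫_ℂ = ⟪y, R (-c) y'⟫_ℂ := by
    intro c hc y y'
    obtain ⟨x, hx, hxy⟩ := hRr c hc y
    obtain ⟨x', hx', hxy'⟩ := hRr (-c) (neg_ne_zero.2 hc) y'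
    rw [← hx, ← hx', ← hxy, ← hxy', inner_sub_left, inner_sub_right, hs, inner_smul_left,
      inner_smul_right]
    simp
  have hres : ∀ c d : ℝ, c ≠ 0 → d ≠ 0 → ∀ y,
      R c y - R d y = (Complex.I * (c - d)) • R c (R d y) := by
    intro c d hc hd y
    obtain ⟨x, hx, hxy⟩ := hRr c hc y
    obtain ⟨x', hx', hxy'⟩ := hRr d hd y
    have h1 := hRl c hc (x - x')
    rw [← map_smul, ← hx, ← hx', ← Submodule.coe_sub, ← h1]
    congr 1
    rw [LinearPMap.map_sub, Submodule.coe_sub, sub_eq_iff_eq_add.1 hxy, sub_eq_iff_eq_add.1 hxy']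
    module
  -- Comparing the resolvent identity with itself after exchanging `c` and `d`.
  have hcomm : ∀ c d : ℝ, c ≠ 0 → d ≠ 0 → Commute (R c) (R d) := by
    intro c d hc hd
    rcases eq_or_ne c d with rfl | hcd
    · exact Commute.refl _
    ext y
    have h1 := hres c d hc hd y
    have h2 := hres d c hd hc y
    have h3 : (Complex.I * (c - d)) • (R c (R d y) - R d (R c y)) = 0 := by
      rw [smul_sub, ← h1, show Complex.I * ((c : ℂ) - d) = -(Complex.I * (d - c)) by ring,
        neg_smul, ← h2]
      abel
    have h4 : (Complex.I * ((c : ℂ) - d)) ≠ 0 :=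
      mul_ne_zero Complex.I_ne_zero (sub_ne_zero.2 (by exact_mod_cast hcd))
    exact sub_eq_zero.1 ((smul_eq_zero.1 h3).resolve_left h4)
  let N : ℕ → ℝ := fun n => n + 1
  have hN : ∀ n, N n ≠ 0 := fun n => by positivity
  have hN' : ∀ n, -N n ≠ 0 := fun n => neg_ne_zero.2 (hN n)
  -- Symmetrized Yosida approximation, formally `N² H (H² + N²)⁻¹`; combining `±N` makes it
  -- symmetric.
  let A : ℕ → E →L[ℂ] E := fun n => ((N n ^ 2 / 2 : ℝ) : ℂ) • (R (N n) + R (-N n))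
  have hA : ∀ n, (A n : E →ₗ[ℂ] E).IsSymmetric := by
    intro n x y
    have h1 := hadj (N n) (hN n) x y
    have h2 := hadj (-N n) (hN' n) x y
    rw [neg_neg] at h2
    simp only [A, ContinuousLinearMap.coe_coe, smul_apply, add_apply]
    rw [inner_smul_left, inner_smul_right, inner_add_left, inner_add_right, h1, h2,
      Complex.conj_ofReal, add_comm]
  have hAc : ∀ m n, Commute (A m) (A n) := by
    intro m n
    refine ((Commute.add_left ?_ ?_).smul_left _).smul_right _ <;> refine Commute.add_right ?_ ?_
    · exact hcomm _ _ (hN m) (hN n)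
    · exact hcomm _ _ (hN m) (hN' n)
    · exact hcomm _ _ (hN' m) (hN n)
    · exact hcomm _ _ (hN' m) (hN' n)
  -- Formally `N² (H² + N²)⁻¹`: a contraction converging strongly to the identity, with `A n = J n ∘
  -- H` on the domain.
  let J : ℕ → E →L[ℂ] E := fun n => (-(Complex.I * N n) / 2) • (R (N n) - R (-N n))
  have hRx : ∀ (x : H.domain) (c : ℝ), c ≠ 0 → (Complex.I * c) • R c x = R c (H x) - x := by
    intro x c hc
    have h1 := hRl c hc x
    rw [map_sub, map_smul] at h1
    rw [mul_comm, ← sub_eq_iff_eq_add'.2 (sub_eq_iff_eq_add.1 h1)]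
  have hAJ : ∀ n (x : H.domain), A n x = J n (H x) := by
    intro n x
    have h1 := hRx x (N n) (hN n)
    have h2 := hRx x (-N n) (hN' n)
    have h3 : A n x = (-(Complex.I * N n) / 2) •
        ((Complex.I * N n) • R (N n) x - (Complex.I * ((-N n : ℝ) : ℂ)) • R (-N n) x) := by
      simp only [A, smul_apply, add_apply]
      rw [Complex.ofReal_neg, mul_neg, neg_smul, sub_neg_eq_add, ← smul_add, smul_smul]
      congr 1
      push_cast
      linear_combination ((N n : ℂ) ^ 2 / 2) * Complex.I_mul_I
    rw [h3, h1, h2]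
    simp only [J, smul_apply, sub_apply]
    congr 1; abel
  have hJb : ∀ n y, ‖J n y‖ ≤ ‖y‖ := by
    intro n y
    have h1 := hRb (N n) (hN n) y
    have h2 := hRb (-N n) (hN' n) y
    have hp : 0 < N n := by positivity
    rw [abs_neg] at h2
    simp only [J, smul_apply, sub_apply]
    rw [norm_smul]
    have h3 : ‖-(Complex.I * (N n : ℂ)) / 2‖ = N n / 2 := by
      simp [abs_of_pos hp]
    rw [h3]
    rw [abs_of_pos hp] at h1 h2
    calc N n / 2 * ‖R (N n) y - R (-N n) y‖ ≤ N n / 2 * ((N n)⁻¹ * ‖y‖ + (N n)⁻¹ * ‖y‖) := by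
          gcongr
          exact (norm_sub_le _ _).trans (add_le_add h1 h2)
      _ = ‖y‖ := by field_simp; ring
  have hR0 : ∀ y, Tendsto (fun n => R (N n) y) atTop (𝓝 0) ∧
      Tendsto (fun n => R (-N n) y) atTop (𝓝 0) := by
    intro y
    have h1 : Tendsto (fun n : ℕ => |N n|⁻¹ * ‖y‖) atTop (𝓝 0) := by
      have : Tendsto (fun n : ℕ => |N n|) atTop atTop :=
        tendsto_abs_atTop_atTop.comp (tendsto_atTop_add_const_right _ _ tendsto_natCast_atTop_atTop)
      simpa using this.inv_tendsto_atTop.mul_const ‖y‖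
    exact ⟨squeeze_zero_norm (fun n => hRb _ (hN n) y) h1,
      squeeze_zero_norm (fun n => by simpa using hRb _ (hN' n) y) h1⟩
  have hJ : ∀ y, Tendsto (fun n => J n y) atTop (𝓝 y) := by
    intro y
    have hD : ∀ x : H.domain, Tendsto (fun n => J n x) atTop (𝓝 (x : E)) := by
      intro x
      have h1 : ∀ n, J n x = (x : E) - (1 / 2 : ℂ) • (R (N n) (H x) + R (-N n) (H x)) := by
        intro n
        have h2 := hRx x (N n) (hN n)
        have h3 := hRx x (-N n) (hN' n)
        have h4 : J n x = (-1 / 2 : ℂ) •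
            ((Complex.I * N n) • R (N n) x + (Complex.I * ((-N n : ℝ) : ℂ)) • R (-N n) x) := by
          simp only [J, smul_apply, sub_apply]
          push_cast
          module
        rw [h4, h2, h3]
        module
      simp only [h1]
      simpa using (((hR0 (H x)).1.add (hR0 (H x)).2).const_smul (1 / 2 : ℂ)).const_sub (x : E)
    refine Metric.tendsto_atTop.2 fun ε hε => ?_
    obtain ⟨x, hx, hxy⟩ := hd.exists_dist_lt y (show 0 < ε / 3 by positivity)
    obtain ⟨M, hM⟩ := Metric.tendsto_atTop.1 (hD ⟨x, hx⟩) (ε / 3) (by positivity)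
    refine ⟨M, fun n hn => ?_⟩
    have h1 := hM n hn
    have h2 := hJb n (y - x)
    rw [map_sub, ← dist_eq_norm, ← dist_eq_norm] at h2
    calc dist (J n y) y ≤ dist (J n y) (J n x) + dist (J n x) x + dist x y := dist_triangle4 _ _ _ _
      _ < ε := by rw [dist_comm x y]; simp only at h1; linarith
  have hlim : ∀ x : H.domain, Tendsto (fun n => A n x) atTop (𝓝 (H x)) := fun x => by
    simp only [hAJ]; exact hJ _
  obtain ⟨U, h0, hadd, hcont, hgen⟩ := exists_limit_group A hA hAc hd
    (fun x hx => ⟨_, hlim ⟨x, hx⟩⟩)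
  refine ⟨U, h0, hadd, hcont, fun ψ φ => ⟨fun h => ?_, fun h => ?_⟩⟩
  · obtain ⟨x, hx, hxy⟩ := (LinearPMap.mem_graph_iff H).1 h
    simp only at hx hxy
    rw [← hx, ← hxy]
    exact hgen x (H x) (hlim x)
  -- The generator is no larger than `H`: with `(H - i) x = φ - iψ`, the orbit of `x - ψ` has
  -- derivative `x - ψ` at `0`. Growth at that rate contradicts conservation of the norm unless `x =
  -- ψ`.
  · obtain ⟨x, hx⟩ := hr 1 one_ne_zero (φ - Complex.I • ψ)
    have h1 := (hgen x (H x) (hlim x)).sub h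
    have h2 : HasDerivAt (fun t => U t ((x : E) - ψ)) ((x : E) - ψ) 0 := by
      simp only [map_sub]
      refine h1.congr_deriv ?_
      rw [sub_eq_iff_eq_add.1 hx, Complex.ofReal_one, one_mul, smul_add, smul_sub, smul_smul,
        smul_smul, Complex.I_mul_I]
      module
    have h3 := hasDerivAt_norm_sq h2
    have h4 : HasDerivAt (fun t => ‖U t ((x : E) - ψ)‖ ^ 2) 0 0 := by
      simp only [LinearIsometryEquiv.norm_map]
      exact hasDerivAt_const (0 : ℝ) (‖(x : E) - ψ‖ ^ 2)
    have h5 := h3.unique h4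
    rw [h0, inner_self_eq_ofReal, Complex.ofReal_re] at h5
    have h6 : (x : E) = ψ := by
      have : ‖(x : E) - ψ‖ ^ 2 = 0 := by linarith
      simpa [sub_eq_zero] using this
    refine (LinearPMap.mem_graph_iff H).2 ⟨x, h6, ?_⟩
    simp only
    rw [sub_eq_iff_eq_add.1 hx, h6]
    simp

end Stone

/-! ### Density of the domain -/

section Density

variable {E : Type*} [NormedAddCommGroup E] [InnerProductSpace ℂ E] {H : E →ₗ.[ℂ] E}

/-- If `y = (H - i) x` is orthogonal to the domain, then `⟨x, y⟩ = 0`, whose imaginary part is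
`-‖x‖²`. -/
lemma dense_domain_of_resolvent [CompleteSpace E]
    (hs : ∀ x y : H.domain, ⟪H x, (y : E)⟫_ℂ = ⟪(x : E), H y⟫_ℂ)
    (hr : ∀ c : ℝ, c ≠ 0 → ∀ y, ∃ x : H.domain, H x - (c * Complex.I) • (x : E) = y) :
    Dense (H.domain : Set E) := by
  rw [Submodule.dense_iff_topologicalClosure_eq_top, Submodule.topologicalClosure_eq_top_iff,
    Submodule.eq_bot_iff]
  intro y hy
  obtain ⟨x, hx⟩ := hr 1 one_ne_zero y
  have h1 : ⟪(x : E), y⟫_ℂ = 0 := (Submodule.mem_orthogonal _ _).1 hy x x.2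
  have h2 : (⟪(x : E), H x⟫_ℂ).im = 0 := by
    have h := congrArg Complex.im (inner_conj_symm (𝕜 := ℂ) (x : E) (H x))
    rw [hs, Complex.conj_im] at h
    linarith
  have h3 := congrArg Complex.im h1
  rw [← hx, inner_sub_right, inner_smul_right, Complex.sub_im, h2, inner_self_eq_ofReal,
    Complex.ofReal_one, one_mul, mul_comm Complex.I, Complex.im_ofReal_mul] at h3
  have h4 : ‖(x : E)‖ ^ 2 = 0 := by simpa using h3
  have h5 : x = 0 := by
    rw [sq_eq_zero_iff, norm_eq_zero] at h4
    exact_mod_cast h4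
  rw [← hx, h5]
  simp

end Density

/-! ### The Friedrichs Hamiltonian and its resolvent -/

section Hamiltonian

/-- The Cauchy transform `∫₀^∞ φ(k) / (k - z) dk`. -/
noncomputable def cauchyTransform (φ : ℝ → ℝ) (z : ℂ) : ℂ := ∫ k in Ioi (0 : ℝ), (φ k : ℂ) / (k - z)

/-- The denominator `F(z) = E₀ - z - β² ∫₀^∞ G(k) / (k - z) dk` of the resolvent. -/
noncomputable def denominator (E₀ β : ℝ) (z : ℂ) : ℂ := E₀ - z - β ^ 2 * cauchyTransform G z

lemma G_nonneg (k : ℝ) : 0 ≤ G k := sq_nonneg _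

lemma ofReal_sub_ne_zero {z : ℂ} (hz : z.im ≠ 0) (k : ℝ) : (k : ℂ) - z ≠ 0 := by
  intro h
  have := congrArg Complex.im h
  simp at this
  exact hz this

lemma norm_inv_ofReal_sub_le {z : ℂ} (hz : z.im ≠ 0) (k : ℝ) : ‖((k : ℂ) - z)⁻¹‖ ≤ |z.im|⁻¹ := by
  rw [norm_inv]
  refine inv_anti₀ (abs_pos.2 hz) ?_
  simpa using Complex.abs_im_le_norm ((k : ℂ) - z)

lemma integrableOn_div_sub {φ : ℝ → ℝ} (hφ : IntegrableOn φ (Ioi 0)) {z : ℂ} (hz : z.im ≠ 0) :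
    IntegrableOn (fun k : ℝ => (φ k : ℂ) / (k - z)) (Ioi 0) := by
  have hm : AEStronglyMeasurable (fun k : ℝ => ((k : ℂ) - z)⁻¹) (volume.restrict (Ioi 0)) :=
    (Measurable.aestronglyMeasurable (by fun_prop))
  have h := (Integrable.ofReal (𝕜 := ℂ) hφ).bdd_mul (c := |z.im|⁻¹) hm
    (ae_of_all _ fun k => norm_inv_ofReal_sub_le hz k)
  refine h.congr (ae_of_all _ fun k => ?_)
  simp [div_eq_inv_mul]

lemma im_inv_ofReal_sub (z : ℂ) (k : ℝ) :
    (((k : ℂ) - z)⁻¹).im = z.im / ((k - z.re) ^ 2 + z.im ^ 2) := by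
  rw [Complex.inv_im, Complex.normSq_apply]
  simp [sq]

lemma im_cauchyTransform {φ : ℝ → ℝ} (hφ : IntegrableOn φ (Ioi 0)) {z : ℂ} (hz : z.im ≠ 0) :
    (cauchyTransform φ z).im = ∫ k in Ioi (0 : ℝ), φ k * (z.im / ((k - z.re) ^ 2 + z.im ^ 2)) := by
  have h := integral_im (𝕜 := ℂ) (integrableOn_div_sub hφ hz)
  unfold cauchyTransform
  refine Eq.trans h.symm (integral_congr_ae (ae_of_all _ fun k => ?_))
  simp only [div_eq_mul_inv (φ k : ℂ)]
  change ((φ k : ℂ) * (((k : ℂ) - z)⁻¹)).im = _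
  rw [Complex.im_ofReal_mul, im_inv_ofReal_sub]

/-- The bracket is at least `1`, so `Im F` and `Im z` have opposite signs and `F` has no non-real
zeros. -/
lemma im_denominator (E₀ β : ℝ) {z : ℂ} (hz : z.im ≠ 0) :
    (denominator E₀ β z).im = -(z.im *
      (1 + β ^ 2 * ∫ k in Ioi (0 : ℝ), G k * (1 / ((k - z.re) ^ 2 + z.im ^ 2)))) := by
  have h1 : (denominator E₀ β z).im = -z.im - β ^ 2 * (cauchyTransform G z).im := by
    unfold denominator
    rw [Complex.sub_im, Complex.sub_im, ← Complex.ofReal_pow, Complex.im_ofReal_mul]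
    simp
  rw [h1, im_cauchyTransform integrableOn_G hz]
  have h2 : (∫ k in Ioi (0 : ℝ), G k * (z.im / ((k - z.re) ^ 2 + z.im ^ 2)))
      = z.im * ∫ k in Ioi (0 : ℝ), G k * (1 / ((k - z.re) ^ 2 + z.im ^ 2)) := by
    rw [← integral_const_mul]
    congr 1
    ext k
    ring
  rw [h2]
  ring

lemma denominator_ne_zero (E₀ β : ℝ) {z : ℂ} (hz : z.im ≠ 0) : denominator E₀ β z ≠ 0 := by
  intro h
  have h1 := im_denominator E₀ β hz
  rw [h, Complex.zero_im, eq_comm, neg_eq_zero, mul_eq_zero] at h1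
  have h2 : 0 ≤ ∫ k in Ioi (0 : ℝ), G k * (1 / ((k - z.re) ^ 2 + z.im ^ 2)) :=
    integral_nonneg fun k => mul_nonneg (G_nonneg k) (by positivity)
  have h3 : 0 < 1 + β ^ 2 * ∫ k in Ioi (0 : ℝ), G k * (1 / ((k - z.re) ^ 2 + z.im ^ 2)) := by
    positivity
  exact h1.elim hz h3.ne'

/-- The identity `|k| (|k| - z)⁻¹ = 1 + z (|k| - z)⁻¹` shows that the free resolvent maps into the
domain of `|k|`. -/
lemma exists_photon_resolvent {z : ℂ} (hz : z.im ≠ 0) (f : Photon) :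
    ∃ e : Photon, (e =ᵐ[volume] fun k => ((‖k‖ : ℂ) - z)⁻¹ * f k) ∧
      MemLp (fun k : Momentum => (‖k‖ : ℂ) * e k) 2 volume := by
  have hm : Measurable fun k : Momentum => ((‖k‖ : ℂ) - z)⁻¹ := by fun_prop
  have h1 : MemLp (fun k : Momentum => ((‖k‖ : ℂ) - z)⁻¹ * f k) 2 volume := by
    refine MemLp.of_le_mul (c := |z.im|⁻¹) (Lp.memLp f)
      (hm.aestronglyMeasurable.mul (Lp.aestronglyMeasurable f)) (ae_of_all _ fun k => ?_)
    rw [norm_mul]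
    gcongr
    exact norm_inv_ofReal_sub_le hz _
  refine ⟨h1.toLp _, h1.coeFn_toLp, ?_⟩
  have h2 : MemLp (fun k : Momentum => z * (((‖k‖ : ℂ) - z)⁻¹ * f k) + f k) 2 volume :=
    (h1.const_mul z).add (Lp.memLp f)
  refine h2.ae_eq ?_
  filter_upwards [h1.coeFn_toLp] with k hk
  rw [hk]
  have := ofReal_sub_ne_zero hz ‖k‖
  field_simp
  ring

lemma photonEnergy_coeFn (ψ : hamiltonianDomain) :
    photonEnergy ψ =ᵐ[volume] fun k => (‖k‖ : ℂ) * (ψ : Space).snd k :=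
  MemLp.coeFn_toLp (show MemLp (fun k : Momentum => (‖k‖ : ℂ) * (ψ : Space).snd k) 2 volume
    from ψ.2)

lemma hamiltonian_apply (E₀ β : ℝ) (ψ : (hamiltonian E₀ β).domain) :
    hamiltonian E₀ β ψ = WithLp.toLp 2
        ((E₀ : ℂ) * (ψ : Space).fst + (β : ℂ) * ⟪couplingVec, (ψ : Space).snd⟫_ℂ,
          ((β : ℂ) * (ψ : Space).fst) • couplingVec + photonEnergy ψ) := rfl

lemma hamiltonian_symmetric (E₀ β : ℝ) (x y : (hamiltonian E₀ β).domain) :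
    ⟪hamiltonian E₀ β x, (y : Space)⟫_ℂ = ⟪(x : Space), hamiltonian E₀ β y⟫_ℂ := by
  have h1 : ⟪photonEnergy x, (y : Space).snd⟫_ℂ = ⟪(x : Space).snd, photonEnergy y⟫_ℂ := by
    rw [L2.inner_def, L2.inner_def]
    refine integral_congr_ae ?_
    filter_upwards [photonEnergy_coeFn x, photonEnergy_coeFn y] with k hx hy
    rw [hx, hy]
    simp only [RCLike.inner_apply, map_mul, Complex.conj_ofReal]
    ring
  rw [hamiltonian_apply, hamiltonian_apply, WithLp.prod_inner_apply, WithLp.prod_inner_apply]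
  simp only [WithLp.ofLp_fst, WithLp.ofLp_snd, inner_add_left, inner_add_right, inner_smul_left,
    inner_smul_right]
  rw [h1, ← inner_conj_symm (x : Space).snd couplingVec]
  simp only [RCLike.inner_apply, map_mul, Complex.conj_ofReal]
  ring

lemma integral_radial {F : Type*} [NormedAddCommGroup F] [NormedSpace ℝ F] (f : ℝ → F) :
    ∫ k : Momentum, f ‖k‖ = (4 * Real.pi) • ∫ r in Ioi (0 : ℝ), r ^ 2 • f r := by
  have h2 : (volume : Measure Momentum).real (Metric.ball 0 1) = 4 / 3 * Real.pi := by
    rw [Measure.real, EuclideanSpace.volume_ball_fin_three, ENNReal.toReal_mul,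
      ENNReal.toReal_ofReal (by positivity)]
    simp
    ring
  rw [integral_fun_norm_addHaar volume f, h2, finrank_euclideanSpace, Fintype.card_fin,
    ← Nat.cast_smul_eq_nsmul ℝ, smul_smul]
  congr 1
  push_cast
  ring

/-- Polar coordinates: the factor `√(4π) |k|` in `coupling` is there to cancel the solid angle and
the Jacobian. -/
lemma inner_couplingVec_resolvent {z : ℂ} {e : Photon}
    (he : e =ᵐ[volume] fun k => ((‖k‖ : ℂ) - z)⁻¹ * couplingVec k) :
    ⟪couplingVec, e⟫_ℂ = cauchyTransform G z := by
  have h1 : ⟪couplingVec, e⟫_ℂ = ∫ k : Momentum,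
      (fun r : ℝ => (((formFactor r / (√(4 * Real.pi) * r)) ^ 2 : ℝ) : ℂ) / (r - z)) ‖k‖ := by
    rw [L2.inner_def]
    refine integral_congr_ae ?_
    filter_upwards [he, memLp_coupling.coeFn_toLp] with k hk hc
    rw [hk, couplingVec, hc, RCLike.inner_apply, coupling, Complex.conj_ofReal]
    push_cast
    ring
  rw [h1, integral_radial (fun r : ℝ =>
    (((formFactor r / (√(4 * Real.pi) * r)) ^ 2 : ℝ) : ℂ) / (r - z)), cauchyTransform,
    Complex.real_smul, ← integral_const_mul]
  refine setIntegral_congr_fun measurableSet_Ioi fun r hr => ?_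
  have hr0 : (r : ℂ) ≠ 0 := by exact_mod_cast (ne_of_gt hr)
  have hs : √(4 * Real.pi) ^ 2 = 4 * Real.pi := Real.sq_sqrt (by positivity)
  have hpi : (Real.pi : ℂ) ≠ 0 := by exact_mod_cast Real.pi_ne_zero
  simp only [G, div_pow, mul_pow, hs]
  rw [Complex.real_smul]
  push_cast
  field_simp

/-- Schur complement: the photon equation gives the second component in terms of the first, `c`;
substituting it leaves the scalar equation `F(z) c = y₁ - β ⟨g, (|k| - z)⁻¹ y₂⟩`. For `y = Φ₁` the
right side is `1`, so `1/F` is the `Φ₁` matrix element of the resolvent. -/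
lemma exists_hamiltonian_sub_smul_eq (E₀ β : ℝ) {z : ℂ} (hz : z.im ≠ 0) (y : Space) :
    ∃ x : (hamiltonian E₀ β).domain, hamiltonian E₀ β x - z • (x : Space) = y ∧
      (y = Φ₁ → (x : Space).fst = (denominator E₀ β z)⁻¹) := by
  obtain ⟨f, hf, hfD⟩ := exists_photon_resolvent hz y.snd
  obtain ⟨e, he, heD⟩ := exists_photon_resolvent hz couplingVec
  have hF := denominator_ne_zero E₀ β hz
  set c : ℂ := (y.fst - β * ⟪couplingVec, f⟫_ℂ) / denominator E₀ β z with hc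
  let x : Space := WithLp.toLp 2 (c, f - (β * c) • e)
  have hxs : x.snd =ᵐ[volume] fun k => f k - β * c * e k := by
    filter_upwards [Lp.coeFn_sub f ((β * c) • e), Lp.coeFn_smul (β * c) e] with k h1 h2
    change (f - (β * c) • e) k = _
    rw [h1, Pi.sub_apply, h2]
    rfl
  have hxD : x ∈ (hamiltonian E₀ β).domain := by
    change MemLp (fun k : Momentum => (‖k‖ : ℂ) * x.snd k) 2 volume
    refine (hfD.sub (heD.const_mul (β * c))).ae_eq ?_
    filter_upwards [hxs] with k hk
    rw [hk]
    simp only [Pi.sub_apply]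
    ring
  refine ⟨⟨x, hxD⟩, ?_, fun hy => ?_⟩
  · rw [hamiltonian_apply]
    refine WithLp.ofLp_injective 2 (Prod.ext ?_ ?_)
    · change (E₀ : ℂ) * c + β * ⟪couplingVec, f - (β * c) • e⟫_ℂ - z * c = y.fst
      rw [inner_sub_right, inner_smul_right, inner_couplingVec_resolvent he]
      have h1 : c * denominator E₀ β z = y.fst - β * ⟪couplingVec, f⟫_ℂ := div_mul_cancel₀ _ hF
      unfold denominator at h1
      linear_combination h1
    · change ((β : ℂ) * c) • couplingVec + photonEnergy ⟨x, hxD⟩ - z • x.snd = y.snd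
      refine Lp.ext ?_
      filter_upwards [Lp.coeFn_sub (((β : ℂ) * c) • couplingVec + photonEnergy ⟨x, hxD⟩)
          (z • x.snd), Lp.coeFn_add (((β : ℂ) * c) • couplingVec) (photonEnergy ⟨x, hxD⟩),
        Lp.coeFn_smul ((β : ℂ) * c) couplingVec, Lp.coeFn_smul z x.snd,
        photonEnergy_coeFn ⟨x, hxD⟩, hxs, hf, he] with k h1 h2 h3 h4 h5 h6 h7 h8
      rw [h1, Pi.sub_apply, h2, Pi.add_apply, h3, h4, h5, Pi.smul_apply, Pi.smul_apply, h6, h7, h8,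
        smul_eq_mul, smul_eq_mul]
      have := ofReal_sub_ne_zero hz ‖k‖
      field_simp
      ring
  · subst hy
    have hf0 : f = 0 := by
      refine Lp.ext ?_
      filter_upwards [hf, Lp.coeFn_zero ℂ 2 (volume : Measure Momentum)] with k h1 h2
      rw [h1, h2]
      change _ * (0 : Photon) k = _
      rw [h2]
      simp
    change c = _
    rw [hc, hf0, inner_zero_right]
    change ((1 : ℂ) - _) / _ = _
    simp

lemma dense_hamiltonian_domain (E₀ β : ℝ) : Dense ((hamiltonian E₀ β).domain : Set Space) :=
  dense_domain_of_resolvent (hamiltonian_symmetric E₀ β) fun c hc y =>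
    let ⟨x, hx, _⟩ := exists_hamiltonian_sub_smul_eq E₀ β (z := c * Complex.I) (by simpa using hc) y
    ⟨x, hx⟩

theorem existsUnique_isUnitaryGroupOf_hamiltonian (E₀ β : ℝ) :
    ∃! U : ℝ → Space ≃ₗᵢ[ℂ] Space, IsUnitaryGroupOf (hamiltonian E₀ β) U := by
  obtain ⟨U, hU⟩ := exists_isUnitaryGroupOf (dense_hamiltonian_domain E₀ β)
    (hamiltonian_symmetric E₀ β) fun c hc y =>
      let ⟨x, hx, _⟩ :=
        exists_hamiltonian_sub_smul_eq E₀ β (z := c * Complex.I) (by simpa using hc) y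
      ⟨x, hx⟩
  exact ⟨U, hU, fun V hV => hV.unique hU (dense_hamiltonian_domain E₀ β)⟩

lemma inner_Φ₁_left (x : Space) : ⟪Φ₁, x⟫_ℂ = x.fst := by
  rw [WithLp.prod_inner_apply]
  simp [Φ₁]

lemma norm_Φ₁ : ‖Φ₁‖ = 1 := by
  have h := inner_self_eq_ofReal Φ₁
  rw [inner_Φ₁_left] at h
  have h1 : (‖Φ₁‖ ^ 2 : ℝ) = 1 := by
    have h2 : ((1 : ℝ) : ℂ) = ((‖Φ₁‖ ^ 2 : ℝ) : ℂ) := by rw [← h]; simp [Φ₁]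
    exact_mod_cast h2.symm
  nlinarith [norm_nonneg Φ₁]

/-- The bridge from the group to the analytic function `F`: the general Laplace formula is applied
to `x = (H - z)⁻¹ Φ₁`, for which `(H - z) x = Φ₁`. -/
theorem integral_exp_mul_returnAmplitude {E₀ β : ℝ} {U : ℝ → Space ≃ₗᵢ[ℂ] Space}
    (hU : IsUnitaryGroupOf (hamiltonian E₀ β) U) {z : ℂ} (hz : 0 < z.im) :
    ∫ t in Ioi (0 : ℝ), Complex.exp (Complex.I * z * t) * returnAmplitude U Φ₁ t
      = -Complex.I * (denominator E₀ β z)⁻¹ := by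
  obtain ⟨x, hx, hx1⟩ := exists_hamiltonian_sub_smul_eq E₀ β hz.ne' Φ₁
  have h := hU.integral_exp_mul_inner ((hamiltonian E₀ β).mem_graph x) (χ := Φ₁) hz
  rwa [hx, inner_Φ₁_left, hx1 rfl] at h

lemma Φ₁_mem_domain (E₀ β : ℝ) : Φ₁ ∈ (hamiltonian E₀ β).domain := by
  change MemLp (fun k : Momentum => (‖k‖ : ℂ) * (0 : Photon) k) 2 volume
  refine (MemLp.zero (ε := ℂ)).ae_eq ?_
  exact ae_of_all _ fun k => by simp

lemma hamiltonian_Φ₁ (E₀ β : ℝ) :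
    hamiltonian E₀ β ⟨Φ₁, Φ₁_mem_domain E₀ β⟩ = WithLp.toLp 2 ((E₀ : ℂ), (β : ℂ) • couplingVec) := by
  have h1 : photonEnergy (⟨Φ₁, Φ₁_mem_domain E₀ β⟩ : (hamiltonian E₀ β).domain) = 0 := by
    refine Lp.ext ?_
    filter_upwards [photonEnergy_coeFn ⟨Φ₁, Φ₁_mem_domain E₀ β⟩,
      Lp.coeFn_zero ℂ 2 (volume : Measure Momentum)] with k h1 h2
    refine h1.trans ?_
    change _ * (0 : Photon) k = (0 : Photon) k
    rw [h2]
    simp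
  refine (hamiltonian_apply E₀ β _).trans ?_
  refine WithLp.ofLp_injective 2 (Prod.ext ?_ ?_)
  · change (E₀ : ℂ) * 1 + β * ⟪couplingVec, (0 : Photon)⟫_ℂ = E₀
    simp
  · change ((β : ℂ) * 1) • couplingVec + _ = (β : ℂ) • couplingVec
    rw [mul_one]
    exact add_eq_left.2 h1

lemma norm_couplingVec_sq : ‖couplingVec‖ ^ 2 = ∫ k in Ioi (0 : ℝ), G k := by
  have h0 : ((‖couplingVec‖ ^ 2 : ℝ) : ℂ) = ∫ k : Momentum,
      (fun r : ℝ => (((formFactor r / (√(4 * Real.pi) * r)) ^ 2 : ℝ) : ℂ)) ‖k‖ := by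
    rw [← inner_self_eq_ofReal, L2.inner_def]
    refine integral_congr_ae ?_
    filter_upwards [memLp_coupling.coeFn_toLp] with k hc
    rw [couplingVec, hc, RCLike.inner_apply, coupling, Complex.conj_ofReal]
    push_cast
    ring
  have h1 : ‖couplingVec‖ ^ 2 = ∫ k : Momentum,
      (fun r : ℝ => (formFactor r / (√(4 * Real.pi) * r)) ^ 2) ‖k‖ := by
    simp only [integral_complex_ofReal] at h0
    exact_mod_cast h0
  rw [h1, integral_radial (fun r : ℝ => (formFactor r / (√(4 * Real.pi) * r)) ^ 2), smul_eq_mul,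
    ← integral_const_mul]
  refine setIntegral_congr_fun measurableSet_Ioi fun r hr => ?_
  have hr0 : r ≠ 0 := ne_of_gt hr
  have hs : √(4 * Real.pi) ^ 2 = 4 * Real.pi := Real.sq_sqrt (by positivity)
  simp only [G, div_pow, mul_pow, hs, smul_eq_mul]
  field_simp

lemma energyUncertainty_Φ₁ (E₀ β : ℝ) (hΦ : Φ₁ ∈ (hamiltonian E₀ β).domain) :
    energyUncertainty (hamiltonian E₀ β) ⟨Φ₁, hΦ⟩ = √(β ^ 2 * ∫ k in Ioi (0 : ℝ), G k) := by
  unfold energyUncertainty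
  rw [hamiltonian_Φ₁, inner_Φ₁_left, WithLp.prod_norm_sq_eq_of_L2]
  congr 1
  simp only [WithLp.toLp_fst, WithLp.toLp_snd, norm_smul, mul_pow, norm_couplingVec_sq]
  simp

end Hamiltonian

/-! ### Plancherel for integrable square-integrable functions -/

section Plancherel

open FourierTransform SchwartzMap

/-- Both transforms are locally integrable and have the same pairing with every smooth compactly
supported function: on the `L²` side by compatibility with tempered distributions, on the integral
side by Fubini. -/
lemma fourier_toLp_ae_eq {f : ℝ → ℂ} (h1 : Integrable f) (h2 : MemLp f 2) :
    (𝓕 (h2.toLp f) : Lp ℂ 2 (volume : Measure ℝ)) =ᵐ[volume] 𝓕 f := by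
  have hcont : Continuous (𝓕 f) := by
    have hL : Continuous fun p : ℝ × ℝ => (innerₗ ℝ) p.1 p.2 := continuous_inner
    exact VectorFourier.fourierIntegral_continuous Real.continuous_fourierChar hL h1
  refine ae_eq_of_integral_contDiff_smul_eq
    ((Lp.memLp _).locallyIntegrable (by norm_num)) hcont.locallyIntegrable fun g hg hgs => ?_
  have hgs' : HasCompactSupport fun x => (g x : ℂ) :=
    hgs.comp_left (g := fun x : ℝ => (x : ℂ)) Complex.ofReal_zero
  have hg' : ContDiff ℝ (⊤ : ℕ∞) fun x => (g x : ℂ) := Complex.ofRealCLM.contDiff.comp hg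
  let φ : 𝓢(ℝ, ℂ) := hgs'.toSchwartzMap hg'
  have hφ : ∀ x, φ x = g x := fun x => rfl
  have h3 := congrArg (fun T => T φ) (Lp.fourier_toTemperedDistribution_eq (h2.toLp f))
  simp only [TemperedDistribution.fourier_apply, Lp.toTemperedDistribution_apply] at h3
  have h4 : ∫ x, (g x) • (𝓕 (h2.toLp f) : Lp ℂ 2 (volume : Measure ℝ)) x
      = ∫ x, φ x • (𝓕 (h2.toLp f) : Lp ℂ 2 (volume : Measure ℝ)) x := by
    simp [hφ]
  have h5 : ∫ x, (𝓕 φ) x • (h2.toLp f) x = ∫ x, (𝓕 φ) x • f x := by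
    refine integral_congr_ae ?_
    filter_upwards [h2.coeFn_toLp] with x hx
    rw [hx]
  rw [h4, ← h3, h5, SchwartzMap.fourier_coe]
  have h6 := VectorFourier.integral_fourierIntegral_smul_eq_flip (L := innerₗ ℝ) (μ := volume)
    (ν := volume) Real.continuous_fourierChar continuous_inner φ.integrable h1
  have h7 : ∫ x, 𝓕 (φ : ℝ → ℂ) x • f x = ∫ x, φ x • 𝓕 f x := by
    simpa [flip_innerₗ] using! h6
  rw [h7]
  simp [hφ]

/-- **Plancherel's theorem** for functions in `L¹ ∩ L²`. -/
theorem integral_norm_sq_fourier {f : ℝ → ℂ} (h1 : Integrable f) (h2 : MemLp f 2) :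
    ∫ w, ‖𝓕 f w‖ ^ 2 = ∫ t, ‖f t‖ ^ 2 := by
  have key : ∀ g : Lp ℂ 2 (volume : Measure ℝ), ((‖g‖ ^ 2 : ℝ) : ℂ) = ∫ t, ((‖g t‖ ^ 2 : ℝ) : ℂ) := by
    intro g
    rw [← inner_self_eq_ofReal, L2.inner_def]
    exact integral_congr_ae (ae_of_all _ fun t => inner_self_eq_ofReal (g t))
  have key' : ∀ g : Lp ℂ 2 (volume : Measure ℝ), ‖g‖ ^ 2 = ∫ t, ‖g t‖ ^ 2 := fun g => by
    have := key g
    rw [integral_complex_ofReal] at this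
    exact_mod_cast this
  have h3 : ∫ w, ‖𝓕 f w‖ ^ 2 = ‖(𝓕 (h2.toLp f) : Lp ℂ 2 (volume : Measure ℝ))‖ ^ 2 := by
    rw [key']
    refine integral_congr_ae ?_
    filter_upwards [fourier_toLp_ae_eq h1 h2] with x hx
    rw [hx]
  rw [h3, Lp.norm_fourier_eq, key']
  refine integral_congr_ae ?_
  filter_upwards [h2.coeFn_toLp] with x hx
  rw [hx]

end Plancherel

/-! ### Recovering the amplitude from boundary values of its Laplace transform -/

section Laplace

open FourierTransform

/-- A continuous amplitude `R`, bounded by `1` and with `R (-t) = conj (R t)`, whose Laplace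
transform is `-i h` on the upper half plane, where `h`, its derivative and its imaginary part are
bounded near the real axis by fixed integrable functions, and has boundary values `h₀`. -/
structure IsResolventAmplitude (R : ℝ → ℂ) (h h' : ℂ → ℂ) (h₀ : ℝ → ℂ) (C : ℝ) (Ψ : ℝ → ℝ) :
    Prop where
  continuous : Continuous R
  norm_le_one : ∀ t, ‖R t‖ ≤ 1
  map_neg : ∀ t, R (-t) = starRingEnd ℂ (R t)
  laplace : ∀ z : ℂ, 0 < z.im →
    ∫ t in Ioi (0 : ℝ), Complex.exp (Complex.I * z * t) * R t = -Complex.I * h z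
  norm_sq_le : ∀ x ε : ℝ, 0 < ε → ε ≤ 1 → ‖h (x + ε * Complex.I)‖ ^ 2 ≤ C * (1 + x ^ 2)⁻¹
  im_le : ∀ x ε : ℝ, 0 < ε → ε ≤ 1 → |(h (x + ε * Complex.I)).im| ≤ C * (1 + x ^ 2)⁻¹
  hasDerivAt : ∀ z : ℂ, 0 < z.im → HasDerivAt h (h' z) z
  norm_deriv_le : ∀ x ε : ℝ, x ≠ 0 → 0 < ε → ε ≤ 1 → ‖h' (x + ε * Complex.I)‖ ≤ Ψ x
  integrable_bound : Integrable Ψ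
  tendsto : ∀ᵐ x : ℝ, Tendsto (fun ε : ℝ => h (x + ε * Complex.I)) (𝓝[>] 0) (𝓝 (h₀ x))

/-- The one-sided damped amplitude. -/
noncomputable def oneSided (R : ℝ → ℂ) (ε : ℝ) : ℝ → ℂ :=
  (Ioi (0 : ℝ)).indicator fun t => (Real.exp (-ε * t) : ℂ) * R t

/-- The two-sided damped amplitude. -/
noncomputable def twoSided (R : ℝ → ℂ) (ε : ℝ) (t : ℝ) : ℂ := (Real.exp (-ε * |t|) : ℂ) * R t

lemma integral_comp_neg_two_pi_mul {F : Type*} [NormedAddCommGroup F] [NormedSpace ℝ F]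
    (g : ℝ → F) : ∫ w : ℝ, g (-2 * Real.pi * w) = (2 * Real.pi)⁻¹ • ∫ x, g x := by
  rw [Measure.integral_comp_mul_left g (-2 * Real.pi)]
  congr 1
  rw [abs_inv, neg_mul, abs_neg, abs_of_pos (by positivity)]

lemma cast_line (w ε : ℝ) : ((-2 * Real.pi * w : ℝ) : ℂ) + ε * Complex.I
    = -2 * Real.pi * w + ε * Complex.I := by push_cast; ring

namespace IsResolventAmplitude

variable {R : ℝ → ℂ} {h h' : ℂ → ℂ} {h₀ : ℝ → ℂ} {C : ℝ} {Ψ : ℝ → ℝ} {ε : ℝ}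

lemma norm_exp_mul_le (H : IsResolventAmplitude R h h' h₀ C Ψ) (ε t : ℝ) :
    ‖(Real.exp (-ε * t) : ℂ) * R t‖ ≤ Real.exp (-ε * t) := by
  rw [norm_mul, Complex.norm_real, Real.norm_of_nonneg (Real.exp_pos _).le]
  exact mul_le_of_le_one_right (Real.exp_pos _).le (H.norm_le_one t)

lemma integrableOn_exp_mul (H : IsResolventAmplitude R h h' h₀ C Ψ) (hε : 0 < ε) :
    IntegrableOn (fun t : ℝ => (Real.exp (-ε * t) : ℂ) * R t) (Ioi 0) := by
  have hc := H.continuous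
  refine Integrable.mono' (integrableOn_exp_mul_Ioi (neg_lt_zero.2 hε) 0) ?_
    (ae_of_all _ fun t => H.norm_exp_mul_le ε t)
  exact Continuous.aestronglyMeasurable (by fun_prop)

lemma integrable_oneSided (H : IsResolventAmplitude R h h' h₀ C Ψ) (hε : 0 < ε) :
    Integrable (oneSided R ε) :=
  (integrable_indicator_iff measurableSet_Ioi).2 (H.integrableOn_exp_mul hε)

lemma norm_oneSided_le_one (H : IsResolventAmplitude R h h' h₀ C Ψ) (hε : 0 < ε) (t : ℝ) :
    ‖oneSided R ε t‖ ≤ 1 := by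
  unfold oneSided
  by_cases ht : t ∈ Ioi (0 : ℝ)
  · rw [indicator_of_mem ht]
    refine (H.norm_exp_mul_le ε t).trans (Real.exp_le_one_iff.2 ?_)
    have : 0 < t := ht
    nlinarith
  · rw [indicator_of_notMem ht]; simp

lemma memLp_oneSided (H : IsResolventAmplitude R h h' h₀ C Ψ) (hε : 0 < ε) :
    MemLp (oneSided R ε) 2 := by
  have h1 := H.integrable_oneSided hε
  rw [memLp_two_iff_integrable_sq_norm h1.aestronglyMeasurable]
  refine Integrable.mono' h1.norm (h1.aestronglyMeasurable.norm.pow 2) (ae_of_all _ fun t => ?_)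
  rw [Real.norm_of_nonneg (by positivity), sq]
  exact mul_le_of_le_one_right (norm_nonneg _) (H.norm_oneSided_le_one hε t)

lemma exp_line_mul (w t : ℝ) (ε : ℝ) (c : ℂ) :
    Complex.exp (((-2 * Real.pi * t * w : ℝ) : ℂ) * Complex.I) • ((Real.exp (-ε * t) : ℂ) * c)
      = Complex.exp (Complex.I * (-2 * Real.pi * w + ε * Complex.I) * t) * c := by
  rw [smul_eq_mul, Complex.ofReal_exp, ← mul_assoc, ← Complex.exp_add]
  congr 2
  push_cast
  linear_combination (-(ε : ℂ) * t) * Complex.I_mul_I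

lemma fourier_oneSided (H : IsResolventAmplitude R h h' h₀ C Ψ) (hε : 0 < ε) (w : ℝ) :
    𝓕 (oneSided R ε) w = -Complex.I * h (-2 * Real.pi * w + ε * Complex.I) := by
  rw [Real.fourier_real_eq_integral_exp_smul, ← H.laplace _ (by simpa using hε), ← integral_indicator
    measurableSet_Ioi]
  congr 1
  ext t
  unfold oneSided
  by_cases ht : t ∈ Ioi (0 : ℝ)
  · rw [indicator_of_mem ht, indicator_of_mem ht, exp_line_mul]
  · rw [indicator_of_notMem ht, indicator_of_notMem ht, smul_zero]

/-- Plancherel for the one-sided damped amplitude, whose Fourier transform at `w` is `-i h` on the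
line `Im z = ε`; the substitution `x = -2πw` produces the `2π`. -/
lemma integral_exp_norm_sq (H : IsResolventAmplitude R h h' h₀ C Ψ) (hε : 0 < ε) :
    ∫ t in Ioi (0 : ℝ), Real.exp (-ε * t) ^ 2 * ‖R t‖ ^ 2
      = (2 * Real.pi)⁻¹ * ∫ x : ℝ, ‖h (x + ε * Complex.I)‖ ^ 2 := by
  have h1 := integral_norm_sq_fourier (H.integrable_oneSided hε) (H.memLp_oneSided hε)
  have h2 : ∫ w, ‖𝓕 (oneSided R ε) w‖ ^ 2
      = (2 * Real.pi)⁻¹ * ∫ x : ℝ, ‖h (x + ε * Complex.I)‖ ^ 2 := by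
    rw [← smul_eq_mul, ← integral_comp_neg_two_pi_mul fun x : ℝ => ‖h (x + ε * Complex.I)‖ ^ 2]
    congr 1
    ext w
    rw [H.fourier_oneSided hε, cast_line]
    simp
  rw [← h2, h1, ← integral_indicator measurableSet_Ioi]
  congr 1
  ext t
  unfold oneSided
  by_cases ht : t ∈ Ioi (0 : ℝ)
  · rw [indicator_of_mem ht, indicator_of_mem ht, norm_mul, mul_pow, Complex.norm_real,
      Real.norm_of_nonneg (Real.exp_pos _).le]
  · rw [indicator_of_notMem ht, indicator_of_notMem ht]; simp

lemma integrable_bound_inv (C : ℝ) : Integrable fun x : ℝ => C * (1 + x ^ 2)⁻¹ :=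
  integrable_inv_one_add_sq.const_mul C

lemma continuous_line (H : IsResolventAmplitude R h h' h₀ C Ψ) (hε : 0 < ε) :
    Continuous fun x : ℝ => h (x + ε * Complex.I) := by
  refine continuous_iff_continuousAt.2 fun x => ?_
  have h1 := (H.hasDerivAt (x + ε * Complex.I) (by simpa using hε)).continuousAt
  exact ContinuousAt.comp (f := fun x : ℝ => (x : ℂ) + ε * Complex.I) h1
    (Continuous.continuousAt (by fun_prop))

lemma eventually_mem_Ioc : ∀ᶠ ε : ℝ in 𝓝[>] 0, 0 < ε ∧ ε ≤ 1 := by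
  filter_upwards [Ioc_mem_nhdsGT (show (0 : ℝ) < 1 by norm_num)] with ε hε using hε

lemma continuous_twoSided (H : IsResolventAmplitude R h h' h₀ C Ψ) :
    Continuous (twoSided R ε) := by
  have := H.continuous
  unfold twoSided
  fun_prop

lemma twoSided_neg (H : IsResolventAmplitude R h h' h₀ C Ψ) (t : ℝ) :
    twoSided R ε (-t) = starRingEnd ℂ (twoSided R ε t) := by
  unfold twoSided
  rw [H.map_neg, abs_neg, map_mul, Complex.conj_ofReal]

lemma integrableOn_twoSided_Ioi (H : IsResolventAmplitude R h h' h₀ C Ψ) (hε : 0 < ε) :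
    IntegrableOn (twoSided R ε) (Ioi 0) := by
  refine (H.integrableOn_exp_mul hε).congr_fun (fun t ht => ?_) measurableSet_Ioi
  unfold twoSided
  rw [abs_of_pos ht]

lemma integrable_twoSided (H : IsResolventAmplitude R h h' h₀ C Ψ) (hε : 0 < ε) :
    Integrable (twoSided R ε) := by
  have h1 := H.integrableOn_twoSided_Ioi hε
  have h2 : IntegrableOn (fun t => twoSided R ε (-t)) (Iio 0) := by
    have := h1.comp_neg
    simpa using this
  have h3 : IntegrableOn (twoSided R ε) (Iio 0) := by
    have h4 : IntegrableOn (fun t => starRingEnd ℂ (twoSided R ε (-t))) (Iio 0) :=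
      Complex.conjLIE.toContinuousLinearEquiv.toContinuousLinearMap.integrable_comp h2
    simpa [H.twoSided_neg] using h4
  rw [← integrableOn_univ, ← Iio_union_Ici (a := (0 : ℝ))]
  exact h3.union ((integrableOn_Ici_iff_integrableOn_Ioi (by simp)).2 h1)

/-- Since `R(-t)` is the conjugate of `R(t)`, the negative half line contributes the conjugate of
`-i h`, and the sum is `2 Im h`. Unlike `h`, this is dominated by an integrable function, so Fourier
inversion applies. -/
lemma fourier_twoSided (H : IsResolventAmplitude R h h' h₀ C Ψ) (hε : 0 < ε) (w : ℝ) :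
    𝓕 (twoSided R ε) w = ((2 * (h (-2 * Real.pi * w + ε * Complex.I)).im : ℝ) : ℂ) := by
  have hint : Integrable fun t : ℝ =>
      Complex.exp (((-2 * Real.pi * t * w : ℝ) : ℂ) * Complex.I) • twoSided R ε t := by
    refine (H.integrable_twoSided hε).bdd_mul (c := 1)
      (Continuous.aestronglyMeasurable (by fun_prop)) (ae_of_all _ fun t => ?_)
    rw [Complex.norm_exp_ofReal_mul_I]
  have h1 : ∫ t in Ioi (0 : ℝ),
      Complex.exp (((-2 * Real.pi * t * w : ℝ) : ℂ) * Complex.I) • twoSided R ε t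
      = -Complex.I * h (-2 * Real.pi * w + ε * Complex.I) := by
    rw [← H.laplace _ (by simpa using hε)]
    refine setIntegral_congr_fun measurableSet_Ioi fun t ht => ?_
    simp only [twoSided]
    rw [abs_of_pos ht, exp_line_mul]
  have h2 : ∫ t in Iic (0 : ℝ),
      Complex.exp (((-2 * Real.pi * t * w : ℝ) : ℂ) * Complex.I) • twoSided R ε t
      = starRingEnd ℂ (-Complex.I * h (-2 * Real.pi * w + ε * Complex.I)) := by
    rw [← h1, ← integral_conj]
    have := integral_comp_neg_Iic (0 : ℝ) (fun t : ℝ => starRingEnd ℂ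
      (Complex.exp (((-2 * Real.pi * t * w : ℝ) : ℂ) * Complex.I) • twoSided R ε t))
    rw [neg_zero] at this
    rw [← this]
    congr 1
    ext t
    rw [smul_eq_mul, smul_eq_mul, map_mul, ← H.twoSided_neg, neg_neg, ← Complex.exp_conj, map_mul,
      Complex.conj_ofReal, Complex.conj_I]
    congr 2
    push_cast
    ring
  rw [Real.fourier_real_eq_integral_exp_smul, ← intervalIntegral.integral_Iic_add_Ioi
    hint.integrableOn hint.integrableOn, h1, h2]
  apply Complex.ext <;> simp [two_mul]

lemma integrable_im_line (H : IsResolventAmplitude R h h' h₀ C Ψ) (hε : 0 < ε) (hε1 : ε ≤ 1) :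
    Integrable fun x : ℝ => (h (x + ε * Complex.I)).im := by
  refine Integrable.mono' (integrable_bound_inv C)
    (Complex.continuous_im.comp (H.continuous_line hε)).aestronglyMeasurable
    (ae_of_all _ fun x => H.im_le x ε hε hε1)

lemma twoSided_eq_integral (H : IsResolventAmplitude R h h' h₀ C Ψ) (hε : 0 < ε) (hε1 : ε ≤ 1)
    (t : ℝ) : twoSided R ε t = ((Real.pi)⁻¹ : ℝ) • ∫ x : ℝ,
      Complex.exp (((-t * x : ℝ) : ℂ) * Complex.I) * ((h (x + ε * Complex.I)).im : ℂ) := by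
  have h1 : 𝓕 (twoSided R ε)
      = fun w : ℝ => ((2 * (h (((-2 * Real.pi * w : ℝ) : ℂ) + ε * Complex.I)).im : ℝ) : ℂ) := by
    ext w
    rw [H.fourier_twoSided hε, cast_line]
  have h2 : Integrable (𝓕 (twoSided R ε)) := by
    rw [h1]
    exact (((H.integrable_im_line hε hε1).comp_mul_left' (R := -2 * Real.pi)
      (by simp [Real.pi_ne_zero])).const_mul 2).ofReal
  have h3 := congrFun (H.continuous_twoSided.fourierInv_fourier_eq (H.integrable_twoSided hε) h2) t
  rw [← h3, Real.fourierInv_eq', h1]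
  have h4 := integral_comp_neg_two_pi_mul (fun x : ℝ =>
    Complex.exp (((-t * x : ℝ) : ℂ) * Complex.I) * (2 * ((h (x + ε * Complex.I)).im : ℂ)))
  calc _ = ∫ w : ℝ, Complex.exp (((-t * (-2 * Real.pi * w) : ℝ) : ℂ) * Complex.I) *
        (2 * ((h (((-2 * Real.pi * w : ℝ) : ℂ) + ε * Complex.I)).im : ℂ)) := by
        congr 1
        ext w
        rw [smul_eq_mul]
        congr 2
        · simp only [RCLike.inner_apply, conj_trivial]
          push_cast
          ring
        · push_cast; rfl
    _ = _ := by
        rw [h4, mul_inv, mul_comm, ← smul_smul]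
        congr 1
        rw [← integral_smul]
        congr 1
        ext x
        rw [Complex.real_smul]
        push_cast
        ring

lemma tendsto_inv_nat : Tendsto (fun n : ℕ => 1 / ((n : ℝ) + 1)) atTop (𝓝[>] 0) :=
  tendsto_nhdsWithin_iff.2 ⟨tendsto_one_div_add_atTop_nhds_zero_nat,
    Eventually.of_forall fun n => by simp only [mem_Ioi]; positivity⟩

lemma aestronglyMeasurable_boundary (H : IsResolventAmplitude R h h' h₀ C Ψ) :
    AEStronglyMeasurable h₀ := by
  refine aestronglyMeasurable_of_tendsto_ae atTop
    (f := fun (n : ℕ) (x : ℝ) => h (x + ((1 / ((n : ℝ) + 1) : ℝ) : ℂ) * Complex.I))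
    (fun n => (H.continuous_line (by positivity)).aestronglyMeasurable) ?_
  filter_upwards [H.tendsto] with x hx
  exact hx.comp tendsto_inv_nat

lemma norm_sq_boundary_le (H : IsResolventAmplitude R h h' h₀ C Ψ) :
    ∀ᵐ x : ℝ, ‖h₀ x‖ ^ 2 ≤ C * (1 + x ^ 2)⁻¹ := by
  filter_upwards [H.tendsto] with x hx
  refine le_of_tendsto (hx.norm.pow 2) ?_
  filter_upwards [eventually_mem_Ioc] with ε hε using H.norm_sq_le x ε hε.1 hε.2

lemma im_boundary_le (H : IsResolventAmplitude R h h' h₀ C Ψ) :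
    ∀ᵐ x : ℝ, |(h₀ x).im| ≤ C * (1 + x ^ 2)⁻¹ := by
  filter_upwards [H.tendsto] with x hx
  refine le_of_tendsto ((Complex.continuous_im.tendsto _).comp hx).abs ?_
  filter_upwards [eventually_mem_Ioc] with ε hε using H.im_le x ε hε.1 hε.2

lemma integrable_norm_sq_boundary (H : IsResolventAmplitude R h h' h₀ C Ψ) :
    Integrable fun x => ‖h₀ x‖ ^ 2 := by
  refine Integrable.mono' (integrable_bound_inv C) (H.aestronglyMeasurable_boundary.norm.pow 2) ?_
  filter_upwards [H.norm_sq_boundary_le] with x hx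
  rwa [Real.norm_of_nonneg (by positivity)]

lemma integrable_im_boundary (H : IsResolventAmplitude R h h' h₀ C Ψ) :
    Integrable fun x => (h₀ x).im :=
  Integrable.mono' (integrable_bound_inv C)
    (Complex.continuous_im.comp_aestronglyMeasurable H.aestronglyMeasurable_boundary)
    H.im_boundary_le

/-- The amplitude is the Fourier transform of the spectral density `Im h₀ / π`. -/
theorem eq_integral (H : IsResolventAmplitude R h h' h₀ C Ψ) (t : ℝ) :
    R t = ((Real.pi)⁻¹ : ℝ) • ∫ x : ℝ,
      Complex.exp (((-t * x : ℝ) : ℂ) * Complex.I) * ((h₀ x).im : ℂ) := by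
  have h1 : Tendsto (fun ε : ℝ => twoSided R ε t) (𝓝[>] 0) (𝓝 (R t)) := by
    have : Continuous fun ε : ℝ => twoSided R ε t := by unfold twoSided; fun_prop
    have h2 := this.tendsto 0
    simp only [twoSided, neg_zero, zero_mul, Real.exp_zero, Complex.ofReal_one, one_mul] at h2
    exact h2.mono_left nhdsWithin_le_nhds
  have h2 : Tendsto (fun ε : ℝ => ((Real.pi)⁻¹ : ℝ) • ∫ x : ℝ,
      Complex.exp (((-t * x : ℝ) : ℂ) * Complex.I) * ((h (x + ε * Complex.I)).im : ℂ)) (𝓝[>] 0)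
      (𝓝 (((Real.pi)⁻¹ : ℝ) • ∫ x : ℝ,
        Complex.exp (((-t * x : ℝ) : ℂ) * Complex.I) * ((h₀ x).im : ℂ))) := by
    refine Tendsto.const_smul ?_ _
    refine tendsto_integral_filter_of_dominated_convergence (fun x : ℝ => C * (1 + x ^ 2)⁻¹)
      ?_ ?_ (integrable_bound_inv C) ?_
    · filter_upwards [eventually_mem_Ioc] with ε hε
      have := H.continuous_line hε.1
      have h3 : Continuous fun x : ℝ => Complex.exp (((-t * x : ℝ) : ℂ) * Complex.I) := by fun_prop
      exact (h3.mul (Complex.continuous_ofReal.comp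
        (Complex.continuous_im.comp this))).aestronglyMeasurable
    · filter_upwards [eventually_mem_Ioc] with ε hε
      refine ae_of_all _ fun x => ?_
      rw [norm_mul, Complex.norm_exp_ofReal_mul_I, one_mul, Complex.norm_real]
      exact H.im_le x ε hε.1 hε.2
    · filter_upwards [H.tendsto] with x hx
      exact ((Complex.continuous_ofReal.comp Complex.continuous_im).tendsto _ |>.comp hx).const_mul _
  refine tendsto_nhds_unique (h1.congr' ?_) h2
  filter_upwards [eventually_mem_Ioc] with ε hε using H.twoSided_eq_integral hε.1 hε.2 t

lemma integral_im_boundary (H : IsResolventAmplitude R h h' h₀ C Ψ) (h0 : R 0 = 1) :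
    ∫ x, (h₀ x).im = Real.pi := by
  have h1 := H.eq_integral 0
  simp only [neg_zero, zero_mul, Complex.ofReal_zero, Complex.exp_zero, one_mul] at h1
  rw [h0, integral_complex_ofReal, Complex.real_smul, ← Complex.ofReal_mul, ← Complex.ofReal_one,
    Complex.ofReal_inj] at h1
  field_simp at h1
  exact h1.symm

/-- The amplitude decays like `1 / t`. -/
theorem mul_norm_le (H : IsResolventAmplitude R h h' h₀ C Ψ) {t : ℝ} (ht : 0 < t) :
    t * ‖R t‖ ≤ (2 * Real.pi)⁻¹ * ∫ x, Ψ x := by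
  have hK : ∀ ε : ℝ, 0 < ε → ε ≤ 1 →
      t * (Real.exp (-ε * t) * ‖R t‖) ≤ (2 * Real.pi)⁻¹ * ∫ x, Ψ x := by
    -- Fourier inversion is applied to `g`, a multiple of `t` times the damped amplitude: its
    -- transform is the derivative along the line, bounded by `Ψ` uniformly in `ε`.
    intro ε hε hε1
    set g : ℝ → ℂ := fun t : ℝ => (-2 * Real.pi * Complex.I * t) • oneSided R ε t with hg
    have hgi : Integrable fun t : ℝ => t • oneSided R ε t := by
      have h1 : IntegrableOn (fun t : ℝ => t * Real.exp (-ε * t)) (Ioi 0) := by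
        have := integrableOn_rpow_mul_exp_neg_mul_rpow (s := 1) (p := 1) (by norm_num) one_pos hε
        simpa using this
      have h2 : (fun t : ℝ => t • oneSided R ε t)
          = (Ioi (0 : ℝ)).indicator fun t => t • ((Real.exp (-ε * t) : ℂ) * R t) := by
        ext t
        unfold oneSided
        by_cases ht : t ∈ Ioi (0 : ℝ)
        · rw [indicator_of_mem ht, indicator_of_mem ht]
        · rw [indicator_of_notMem ht, indicator_of_notMem ht, smul_zero]
      have hc := H.continuous
      rw [h2, integrable_indicator_iff measurableSet_Ioi]
      refine Integrable.mono' h1 (Continuous.aestronglyMeasurable (by fun_prop))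
        ((ae_restrict_iff' measurableSet_Ioi).2 (ae_of_all _ fun t ht => ?_))
      rw [norm_smul, Real.norm_of_nonneg (le_of_lt ht)]
      exact mul_le_mul_of_nonneg_left (H.norm_exp_mul_le ε t) (le_of_lt ht)
    have hgi' : Integrable g := by
      refine (hgi.const_mul (-2 * Real.pi * Complex.I)).congr (ae_of_all _ fun t => ?_)
      simp only [hg, Complex.real_smul, smul_eq_mul]
      ring
    -- The factor `t` removes the jump of the indicator at `0`, so inversion holds at every point.
    have hgc : Continuous g := by
      have h1 : g = fun t : ℝ => (-2 * Real.pi * Complex.I * (max t 0 : ℝ)) *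
          ((Real.exp (-ε * t) : ℂ) * R t) := by
        ext t
        simp only [hg, oneSided, smul_eq_mul]
        by_cases ht : t ∈ Ioi (0 : ℝ)
        · rw [indicator_of_mem ht, max_eq_left (le_of_lt ht)]
        · rw [indicator_of_notMem ht, max_eq_right (not_lt.1 ht)]; simp
      have := H.continuous
      rw [h1]
      fun_prop
    have hFg : ∀ w : ℝ, 𝓕 g w = 2 * Real.pi * Complex.I *
        h' (((-2 * Real.pi * w : ℝ) : ℂ) + ε * Complex.I) := by
      intro w
      have h1 := Real.hasDerivAt_fourier (H.integrable_oneSided hε) hgi w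
      have h2 : HasDerivAt (𝓕 (oneSided R ε)) (2 * Real.pi * Complex.I *
          h' (((-2 * Real.pi * w : ℝ) : ℂ) + ε * Complex.I)) w := by
        have h3 : 𝓕 (oneSided R ε)
            = fun w : ℝ => -Complex.I * h (-2 * Real.pi * w + ε * Complex.I) := by
          ext w; exact H.fourier_oneSided hε w
        rw [h3, cast_line]
        have h4 : HasDerivAt (fun w : ℂ => -2 * Real.pi * w + ε * Complex.I) (-2 * Real.pi * 1)
            (w : ℂ) := ((hasDerivAt_id (w : ℂ)).const_mul _).add_const _
        have h5 := (HasDerivAt.comp (w : ℂ)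
          (H.hasDerivAt (-2 * Real.pi * w + ε * Complex.I) (by simpa using hε)) h4).comp_ofReal
        refine (h5.const_mul (-Complex.I)).congr_deriv ?_
        ring
      exact h1.unique h2
    have hFgb : ∀ᵐ w : ℝ, ‖𝓕 g w‖ ≤ 2 * Real.pi * Ψ (-2 * Real.pi * w) := by
      filter_upwards [Measure.ae_ne volume (0 : ℝ)] with w hw
      rw [hFg, norm_mul]
      have h1 : ‖(2 * Real.pi * Complex.I : ℂ)‖ = 2 * Real.pi := by
        simp [abs_of_pos Real.pi_pos]
      rw [h1]
      gcongr
      exact H.norm_deriv_le _ ε (by simp [Real.pi_ne_zero, hw]) hε hε1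
    have hΨ : Integrable fun w : ℝ => 2 * Real.pi * Ψ (-2 * Real.pi * w) :=
      (H.integrable_bound.comp_mul_left' (R := -2 * Real.pi) (by simp [Real.pi_ne_zero])).const_mul _
    have hFi : Integrable (𝓕 g) := by
      have hL : Continuous fun p : ℝ × ℝ => (innerₗ ℝ) p.1 p.2 := continuous_inner
      refine Integrable.mono' hΨ (Continuous.aestronglyMeasurable ?_) hFgb
      exact VectorFourier.fourierIntegral_continuous Real.continuous_fourierChar hL hgi'
    have hinv := congrFun (hgc.fourierInv_fourier_eq hgi' hFi) t
    have h6 : ‖g t‖ ≤ ∫ x, Ψ x := by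
      rw [← hinv, Real.fourierInv_eq']
      refine (norm_integral_le_of_norm_le hΨ ?_).trans (le_of_eq ?_)
      · filter_upwards [hFgb] with w hw
        rw [norm_smul, Complex.norm_exp_ofReal_mul_I, one_mul]
        exact hw
      · rw [integral_const_mul, integral_comp_neg_two_pi_mul, smul_eq_mul, mul_inv_cancel_left₀]
        positivity
    have h7 : ‖g t‖ = 2 * Real.pi * (t * (Real.exp (-ε * t) * ‖R t‖)) := by
      simp only [hg, oneSided, smul_eq_mul]
      rw [indicator_of_mem (show t ∈ Ioi (0 : ℝ) from ht), norm_mul, norm_mul _ (R t),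
        Complex.norm_real, Real.norm_of_nonneg (Real.exp_pos _).le]
      have h8 : ‖(-2 * Real.pi * Complex.I * t : ℂ)‖ = 2 * Real.pi * t := by
        simp [abs_of_pos Real.pi_pos, abs_of_pos ht]
      rw [h8]
      ring
    rw [h7] at h6
    rwa [inv_mul_eq_div, le_div_iff₀' (by positivity)]
  have hlim : Tendsto (fun ε : ℝ => t * (Real.exp (-ε * t) * ‖R t‖)) (𝓝[>] 0)
      (𝓝 (t * ‖R t‖)) := by
    have : Continuous fun ε : ℝ => t * (Real.exp (-ε * t) * ‖R t‖) := by fun_prop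
    have h2 := this.tendsto 0
    simp only [neg_zero, zero_mul, Real.exp_zero, one_mul] at h2
    exact h2.mono_left nhdsWithin_le_nhds
  refine le_of_tendsto hlim ?_
  filter_upwards [eventually_mem_Ioc] with ε hε using hK ε hε.1 hε.2

/-- The bounds `|R| ≤ 1` and `t |R| ≤ K` add up to `(1 + t²) |R|² ≤ 1 + K²`. -/
lemma integrableOn_norm_sq (H : IsResolventAmplitude R h h' h₀ C Ψ) :
    IntegrableOn (fun t => ‖R t‖ ^ 2) (Ioi 0) := by
  set K := (2 * Real.pi)⁻¹ * ∫ x, Ψ x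
  have hc := H.continuous
  refine Integrable.mono' (g := fun t : ℝ => (1 + K ^ 2) * (1 + t ^ 2)⁻¹)
    (integrable_bound_inv _).integrableOn (Continuous.aestronglyMeasurable (by fun_prop))
    ((ae_restrict_iff' measurableSet_Ioi).2 (ae_of_all _ fun t ht => ?_))
  have ht' : 0 < t := ht
  have h1 := H.mul_norm_le ht'
  have h2 := H.norm_le_one t
  have h3 := norm_nonneg (R t)
  rw [Real.norm_of_nonneg (by positivity), ← div_eq_mul_inv, le_div_iff₀ (by positivity)]
  have h4 : (t * ‖R t‖) ^ 2 ≤ K ^ 2 := pow_le_pow_left₀ (by positivity) h1 2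
  nlinarith

lemma memLp_two (H : IsResolventAmplitude R h h' h₀ C Ψ) : MemLp R 2 := by
  rw [memLp_two_iff_integrable_sq_norm H.continuous.aestronglyMeasurable]
  have h1 := H.integrableOn_norm_sq
  have h3 : IntegrableOn (fun t => ‖R t‖ ^ 2) (Iio 0) := by
    have := h1.comp_neg
    simpa [H.map_neg] using this
  rw [← integrableOn_univ, ← Iio_union_Ici (a := (0 : ℝ))]
  exact h3.union ((integrableOn_Ici_iff_integrableOn_Ioi (by simp)).2 h1)

lemma tendsto_integral_exp (H : IsResolventAmplitude R h h' h₀ C Ψ) :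
    Tendsto (fun ε : ℝ => ∫ t in Ioi (0 : ℝ), Real.exp (-ε * t) ^ 2 * ‖R t‖ ^ 2) (𝓝[>] 0)
      (𝓝 (∫ t in Ioi (0 : ℝ), ‖R t‖ ^ 2)) := by
  have hc := H.continuous
  refine tendsto_integral_filter_of_dominated_convergence (fun t : ℝ => ‖R t‖ ^ 2)
      ?_ ?_ H.integrableOn_norm_sq ?_
  · exact Eventually.of_forall fun ε => Continuous.aestronglyMeasurable (by fun_prop)
  · filter_upwards [eventually_mem_Ioc] with ε hε
    refine (ae_restrict_iff' measurableSet_Ioi).2 (ae_of_all _ fun t ht => ?_)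
    have ht' : 0 < t := ht
    rw [Real.norm_of_nonneg (by positivity)]
    refine mul_le_of_le_one_left (by positivity) (pow_le_one₀ (Real.exp_pos _).le ?_)
    rw [Real.exp_le_one_iff]
    nlinarith [hε.1]
  · refine ae_of_all _ fun t => ?_
    have : Continuous fun ε : ℝ => Real.exp (-ε * t) ^ 2 * ‖R t‖ ^ 2 := by fun_prop
    have h2 := this.tendsto 0
    simp only [neg_zero, zero_mul, Real.exp_zero, one_pow, one_mul] at h2
    exact h2.mono_left nhdsWithin_le_nhds

/-- The damping is removed by dominated convergence on both sides, under `|R|²` in time and `C/(1 +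
x²)` in energy. This form of the sojourn time serves the comparison with `1/Γ`. -/
theorem integral_norm_sq_eq (H : IsResolventAmplitude R h h' h₀ C Ψ) :
    ∫ t in Ioi (0 : ℝ), ‖R t‖ ^ 2 = (2 * Real.pi)⁻¹ * ∫ x, ‖h₀ x‖ ^ 2 := by
  have h2 : Tendsto (fun ε : ℝ => (2 * Real.pi)⁻¹ * ∫ x : ℝ, ‖h (x + ε * Complex.I)‖ ^ 2) (𝓝[>] 0)
      (𝓝 ((2 * Real.pi)⁻¹ * ∫ x, ‖h₀ x‖ ^ 2)) := by
    refine Tendsto.const_mul _ ?_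
    refine tendsto_integral_filter_of_dominated_convergence (fun x : ℝ => C * (1 + x ^ 2)⁻¹)
      ?_ ?_ (integrable_bound_inv C) ?_
    · filter_upwards [eventually_mem_Ioc] with ε hε
      exact ((H.continuous_line hε.1).norm.pow 2).aestronglyMeasurable
    · filter_upwards [eventually_mem_Ioc] with ε hε
      refine ae_of_all _ fun x => ?_
      rw [Real.norm_of_nonneg (by positivity)]
      exact H.norm_sq_le x ε hε.1 hε.2
    · filter_upwards [H.tendsto] with x hx using hx.norm.pow 2
  refine tendsto_nhds_unique (H.tendsto_integral_exp.congr' ?_) h2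
  filter_upwards [eventually_mem_Ioc] with ε hε using H.integral_exp_norm_sq hε.1

lemma memLp_twoSided (H : IsResolventAmplitude R h h' h₀ C Ψ) (hε : 0 < ε) :
    MemLp (twoSided R ε) 2 := by
  refine H.memLp_two.mono H.continuous_twoSided.aestronglyMeasurable (ae_of_all _ fun t => ?_)
  unfold twoSided
  rw [norm_mul, Complex.norm_real, Real.norm_of_nonneg (Real.exp_pos _).le]
  refine mul_le_of_le_one_left (norm_nonneg _) (Real.exp_le_one_iff.2 ?_)
  nlinarith [abs_nonneg t]

lemma integral_exp_norm_sq_eq_im (H : IsResolventAmplitude R h h' h₀ C Ψ) (hε : 0 < ε) :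
    ∫ t in Ioi (0 : ℝ), Real.exp (-ε * t) ^ 2 * ‖R t‖ ^ 2
      = (Real.pi)⁻¹ * ∫ x : ℝ, (h (x + ε * Complex.I)).im ^ 2 := by
  have h1 := integral_norm_sq_fourier (H.integrable_twoSided hε) (H.memLp_twoSided hε)
  have h2 : ∫ w, ‖𝓕 (twoSided R ε) w‖ ^ 2
      = (2 * Real.pi)⁻¹ * ∫ x : ℝ, 4 * (h (x + ε * Complex.I)).im ^ 2 := by
    rw [← smul_eq_mul, ← integral_comp_neg_two_pi_mul fun x : ℝ => 4 * (h (x + ε * Complex.I)).im ^ 2]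
    congr 1
    ext w
    rw [H.fourier_twoSided hε, cast_line, Complex.norm_real, Real.norm_eq_abs, sq_abs]
    ring
  have h3 : ∫ t, ‖twoSided R ε t‖ ^ 2
      = 2 * ∫ t in Ioi (0 : ℝ), Real.exp (-ε * t) ^ 2 * ‖R t‖ ^ 2 := by
    rw [← integral_comp_abs]
    congr 1
    ext t
    unfold twoSided
    rw [norm_mul, mul_pow, Complex.norm_real, Real.norm_of_nonneg (Real.exp_pos _).le]
    rcases abs_choice t with ht | ht
    · rw [ht]
    · rw [ht, H.map_neg, RCLike.norm_conj]
  rw [h2, h3, integral_const_mul] at h1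
  field_simp at h1 ⊢
  linarith

/-- The two-sided counterpart: it expresses the sojourn time through the spectral density alone, as
the uncertainty bound needs. -/
theorem integral_norm_sq_eq_im (H : IsResolventAmplitude R h h' h₀ C Ψ) :
    ∫ t in Ioi (0 : ℝ), ‖R t‖ ^ 2 = (Real.pi)⁻¹ * ∫ x, (h₀ x).im ^ 2 := by
  have h2 : Tendsto (fun ε : ℝ => (Real.pi)⁻¹ * ∫ x : ℝ, (h (x + ε * Complex.I)).im ^ 2) (𝓝[>] 0)
      (𝓝 ((Real.pi)⁻¹ * ∫ x, (h₀ x).im ^ 2)) := by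
    refine Tendsto.const_mul _ ?_
    refine tendsto_integral_filter_of_dominated_convergence (fun x : ℝ => C * (1 + x ^ 2)⁻¹)
      ?_ ?_ (integrable_bound_inv C) ?_
    · filter_upwards [eventually_mem_Ioc] with ε hε
      exact ((Complex.continuous_im.comp (H.continuous_line hε.1)).pow 2).aestronglyMeasurable
    · filter_upwards [eventually_mem_Ioc] with ε hε
      refine ae_of_all _ fun x => ?_
      rw [Real.norm_of_nonneg (by positivity)]
      refine le_trans ?_ (H.norm_sq_le x ε hε.1 hε.2)
      rw [← sq_abs]
      exact pow_le_pow_left₀ (abs_nonneg _) (Complex.abs_im_le_norm _) 2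
    · filter_upwards [H.tendsto] with x hx
      exact ((Complex.continuous_im.tendsto _).comp hx).pow 2
  refine tendsto_nhds_unique (H.tendsto_integral_exp.congr' ?_) h2
  filter_upwards [eventually_mem_Ioc] with ε hε using H.integral_exp_norm_sq_eq_im hε.1

end IsResolventAmplitude

end Laplace

/-! ### Explicit estimates and integrals for `G` -/

section FormFactor

/-- The rational function which agrees with `G` on the half line. -/
noncomputable def ratG (k : ℝ) : ℝ := k * ((k ^ 2 + 9 / 4) ^ 4)⁻¹

/-- The derivative of `ratG`. -/
noncomputable def derivRatG (k : ℝ) : ℝ := (9 / 4 - 7 * k ^ 2) * ((k ^ 2 + 9 / 4) ^ 5)⁻¹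

/-- The second derivative of `ratG`. -/
noncomputable def deriv2RatG (k : ℝ) : ℝ := k * (56 * k ^ 2 - 54) * ((k ^ 2 + 9 / 4) ^ 6)⁻¹

lemma G_eq_ratG {k : ℝ} (hk : 0 ≤ k) : G k = ratG k := by
  unfold G formFactor ratG
  rw [mul_pow, Real.sq_sqrt hk, inv_pow, ← pow_mul, show ((3 : ℝ) / 2) ^ 2 = 9 / 4 by norm_num]

lemma G_of_nonpos {k : ℝ} (hk : k ≤ 0) : G k = 0 := by
  unfold G formFactor
  rw [Real.sqrt_eq_zero_of_nonpos hk]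
  simp

lemma G_eq_ratG_max (k : ℝ) : G k = ratG (max k 0) := by
  rcases le_total k 0 with h | h
  · rw [G_of_nonpos h, max_eq_right h]; simp [ratG]
  · rw [G_eq_ratG h, max_eq_left h]

lemma hasDerivAt_ratG (k : ℝ) : HasDerivAt ratG (derivRatG k) k := by
  have h0 : k ^ 2 + 9 / 4 ≠ 0 := by positivity
  have h1 : HasDerivAt (fun k : ℝ => (k ^ 2 + 9 / 4) ^ 4)
      (4 * (k ^ 2 + 9 / 4) ^ 3 * (2 * k)) k := by
    have := (((hasDerivAt_id k).pow 2).add_const (9 / 4 : ℝ)).pow 4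
    refine this.congr_deriv ?_
    simp
  refine ((hasDerivAt_id k).mul (h1.inv (by positivity))).congr_deriv ?_
  unfold derivRatG
  simp only [id, Pi.inv_apply]
  field_simp
  ring

lemma hasDerivAt_derivRatG (k : ℝ) : HasDerivAt derivRatG (deriv2RatG k) k := by
  have h0 : k ^ 2 + 9 / 4 ≠ 0 := by positivity
  have h1 : HasDerivAt (fun k : ℝ => (k ^ 2 + 9 / 4) ^ 5)
      (5 * (k ^ 2 + 9 / 4) ^ 4 * (2 * k)) k := by
    have := (((hasDerivAt_id k).pow 2).add_const (9 / 4 : ℝ)).pow 5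
    refine this.congr_deriv ?_
    simp
  have h2 : HasDerivAt (fun k : ℝ => 9 / 4 - 7 * k ^ 2) (-(7 * (2 * k))) k := by
    have := (((hasDerivAt_id k).pow 2).const_mul (7 : ℝ)).const_sub (9 / 4)
    refine this.congr_deriv ?_
    simp
  refine (h2.mul (h1.inv (by positivity))).congr_deriv ?_
  unfold deriv2RatG
  simp only [Pi.inv_apply]
  field_simp
  ring

/-- The constant rounds up `(4/9)⁴ ≈ 0.0390`, the value at `k = 0`. This Lipschitz constant of `G`
has to be nearly sharp near the threshold for the physical estimates. -/
lemma abs_derivRatG_le (k : ℝ) : |derivRatG k| ≤ 1 / 25 := by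
  have h0 : 0 < k ^ 2 + 9 / 4 := by positivity
  unfold derivRatG
  rw [abs_mul, abs_of_pos (inv_pos.2 (pow_pos h0 5)), ← div_eq_mul_inv,
    div_le_div_iff₀ (by positivity) (by positivity), one_mul]
  have hu : 0 ≤ k ^ 2 := sq_nonneg k
  have h1 : (k ^ 2 + 9 / 4) ^ 5 = (k ^ 2) ^ 5 + 45 / 4 * (k ^ 2) ^ 4 + 405 / 8 * (k ^ 2) ^ 3
      + 3645 / 32 * (k ^ 2) ^ 2 + 32805 / 256 * k ^ 2 + 59049 / 1024 := by ring
  rw [h1]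
  have h2 := pow_nonneg hu 5
  have h3 := pow_nonneg hu 4
  have h4 := pow_nonneg hu 3
  rcases abs_cases (9 / 4 - 7 * k ^ 2) with ⟨h, _⟩ | ⟨h, _⟩ <;> rw [h] <;>
    nlinarith [sq_nonneg (k ^ 2 - 1 / 4)]

lemma abs_derivRatG_le_inv (k : ℝ) : |derivRatG k| ≤ (1 + k ^ 2)⁻¹ := by
  have h0 : 0 < k ^ 2 + 9 / 4 := by positivity
  unfold derivRatG
  rw [abs_mul, abs_of_pos (inv_pos.2 (pow_pos h0 5)), ← div_eq_mul_inv, ← one_div,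
    div_le_div_iff₀ (by positivity) (by positivity)]
  have hu : 0 ≤ k ^ 2 := sq_nonneg k
  have h1 : |9 / 4 - 7 * k ^ 2| ≤ 7 * (k ^ 2 + 9 / 4) := by
    rw [abs_le]; constructor <;> nlinarith
  have h2 : (7 : ℝ) ≤ (k ^ 2 + 9 / 4) ^ 3 := by
    calc (7 : ℝ) ≤ (9 / 4) ^ 3 := by norm_num
      _ ≤ _ := by gcongr; linarith
  calc |9 / 4 - 7 * k ^ 2| * (1 + k ^ 2) ≤ 7 * (k ^ 2 + 9 / 4) * (k ^ 2 + 9 / 4) :=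
        mul_le_mul h1 (by linarith) (by positivity) (by positivity)
    _ = 7 * (k ^ 2 + 9 / 4) ^ 2 := by ring
    _ ≤ (k ^ 2 + 9 / 4) ^ 3 * (k ^ 2 + 9 / 4) ^ 2 := by gcongr
    _ = 1 * (k ^ 2 + 9 / 4) ^ 5 := by ring

lemma abs_deriv2RatG_le (k : ℝ) : |deriv2RatG k| ≤ 1 := by
  have h0 : 0 < k ^ 2 + 9 / 4 := by positivity
  unfold deriv2RatG
  rw [abs_mul, abs_of_pos (inv_pos.2 (pow_pos h0 6)), ← div_eq_mul_inv, div_le_one (by positivity),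
    abs_mul]
  have hu : 0 ≤ k ^ 2 := sq_nonneg k
  have h1 : |k| ≤ k ^ 2 + 9 / 4 := by
    rw [abs_le]; constructor <;> nlinarith [sq_nonneg (k - 1), sq_nonneg (k + 1)]
  have h2 : |56 * k ^ 2 - 54| ≤ 56 * (k ^ 2 + 9 / 4) := by
    rw [abs_le]; constructor <;> nlinarith
  have h3 : (56 : ℝ) ≤ (k ^ 2 + 9 / 4) ^ 4 + 31 := by
    have : (9 / 4 : ℝ) ^ 4 ≤ (k ^ 2 + 9 / 4) ^ 4 := by gcongr; linarith
    nlinarith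
  have h4 : |56 * k ^ 2 - 54| ≤ (k ^ 2 + 9 / 4) ^ 5 := by
    have h5 : (k ^ 2 + 9 / 4) ^ 5 = (k ^ 2) ^ 5 + 45 / 4 * (k ^ 2) ^ 4 + 405 / 8 * (k ^ 2) ^ 3
      + 3645 / 32 * (k ^ 2) ^ 2 + 32805 / 256 * k ^ 2 + 59049 / 1024 := by ring
    rw [h5, abs_le]
    have h2 := pow_nonneg hu 5
    have h3 := pow_nonneg hu 4
    have h4 := pow_nonneg hu 3
    constructor <;> nlinarith
  calc |k| * |56 * k ^ 2 - 54| ≤ (k ^ 2 + 9 / 4) * (k ^ 2 + 9 / 4) ^ 5 := by gcongr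
    _ = _ := by ring

lemma abs_ratG_sub_le (x y : ℝ) : |ratG x - ratG y| ≤ 1 / 25 * |x - y| :=
  convex_univ.norm_image_sub_le_of_norm_hasDerivWithin_le
    (fun k _ => (hasDerivAt_ratG k).hasDerivWithinAt) (fun k _ => abs_derivRatG_le k)
    (mem_univ y) (mem_univ x)

lemma abs_derivRatG_sub_le (x y : ℝ) : |derivRatG x - derivRatG y| ≤ 1 * |x - y| :=
  convex_univ.norm_image_sub_le_of_norm_hasDerivWithin_le
    (fun k _ => (hasDerivAt_derivRatG k).hasDerivWithinAt) (fun k _ => abs_deriv2RatG_le k)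
    (mem_univ y) (mem_univ x)

lemma abs_G_sub_le (x y : ℝ) : |G x - G y| ≤ 1 / 25 * |x - y| := by
  rw [G_eq_ratG_max, G_eq_ratG_max]
  exact (abs_ratG_sub_le _ _).trans
    (mul_le_mul_of_nonneg_left (abs_max_sub_max_le_abs x y 0) (by norm_num))

lemma G_le (k : ℝ) : G k ≤ 1 / 25 := by
  have h0 : 0 < (max k 0) ^ 2 + 9 / 4 := by positivity
  rw [G_eq_ratG_max]
  unfold ratG
  set u := max k 0
  rw [← div_eq_mul_inv, div_le_div_iff₀ (by positivity) (by positivity)]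
  have h1 : u ≤ (u ^ 2 + 9 / 4) := by nlinarith [sq_nonneg (u - 1)]
  have h3 : (11 : ℝ) ≤ (u ^ 2 + 9 / 4) ^ 3 := by
    calc (11 : ℝ) ≤ (9 / 4) ^ 3 := by norm_num
      _ ≤ _ := by gcongr; nlinarith [sq_nonneg u]
  have h4 : 3 * u ≤ u ^ 2 + 9 / 4 := by nlinarith [sq_nonneg (u - 3 / 2)]
  have h5 : (u ^ 2 + 9 / 4) ^ 4 = (u ^ 2 + 9 / 4) ^ 3 * (u ^ 2 + 9 / 4) := by ring
  rw [h5]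
  have hu : 0 ≤ u := le_max_right _ _
  nlinarith

lemma G_div_eq {k : ℝ} (hk : 0 < k) : G k / k = ((k ^ 2 + 9 / 4) ^ 4)⁻¹ := by
  rw [G_eq_ratG hk.le, ratG]
  field_simp

lemma G_div_le {k : ℝ} (hk : 0 < k) : G k / k ≤ 1 / 25 := by
  rw [G_div_eq hk, ← one_div]
  refine one_div_le_one_div_of_le (by norm_num) ?_
  calc (25 : ℝ) ≤ (9 / 4) ^ 4 := by norm_num
      _ ≤ _ := by gcongr; nlinarith [sq_nonneg k]

lemma G_div_nonneg (k : ℝ) (hk : 0 ≤ k) : 0 ≤ G k / k := div_nonneg (G_nonneg k) hk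

lemma G_pos {k : ℝ} (hk : 0 < k) : 0 < G k := by
  rw [G_eq_ratG hk.le, ratG]; positivity

lemma continuous_G : Continuous G := by
  unfold G formFactor
  have : ∀ k : ℝ, (k ^ 2 + (3 / 2) ^ 2) ^ 2 ≠ 0 := fun k => by positivity
  fun_prop (disch := exact this _)

lemma continuous_derivRatG : Continuous derivRatG :=
  continuous_iff_continuousAt.2 fun k => (hasDerivAt_derivRatG k).continuousAt

lemma integrable_derivRatG : Integrable derivRatG :=
  integrable_inv_one_add_sq.mono' continuous_derivRatG.aestronglyMeasurable
    (ae_of_all _ abs_derivRatG_le_inv)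

lemma integrableOn_G_div : IntegrableOn (fun k => G k / k) (Ioi 0) := by
  refine Integrable.mono' integrable_inv_one_add_sq.integrableOn
    ((continuous_G.measurable.div measurable_id).aestronglyMeasurable)
    ((ae_restrict_iff' measurableSet_Ioi).2 (ae_of_all _ fun k hk => ?_))
  have hk' : 0 < k := hk
  rw [Real.norm_of_nonneg (G_div_nonneg k hk'.le), G_div_eq hk']
  refine inv_anti₀ (by positivity) ?_
  calc 1 + k ^ 2 ≤ k ^ 2 + 9 / 4 := by linarith
    _ ≤ (k ^ 2 + 9 / 4) ^ 4 := le_self_pow₀ (by nlinarith [sq_nonneg k]) (by norm_num)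

lemma integral_G : ∫ k in Ioi (0 : ℝ), G k = 32 / 2187 := by
  have hd : ∀ k ∈ Ioi (0 : ℝ),
      HasDerivAt (fun k : ℝ => -(6 * (k ^ 2 + 9 / 4) ^ 3)⁻¹) (G k) k := by
    intro k hk
    have hk' : 0 < k := hk
    have h1 : HasDerivAt (fun k : ℝ => 6 * (k ^ 2 + 9 / 4) ^ 3)
        (6 * (3 * (k ^ 2 + 9 / 4) ^ 2 * (2 * k))) k := by
      have := ((((hasDerivAt_id k).pow 2).add_const (9 / 4 : ℝ)).pow 3).const_mul 6
      refine this.congr_deriv ?_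
      simp
    refine (h1.inv (by positivity)).neg.congr_deriv ?_
    rw [G_eq_ratG hk'.le, ratG]
    field_simp
    norm_num
  have hc : ContinuousWithinAt (fun k : ℝ => -(6 * (k ^ 2 + 9 / 4) ^ 3)⁻¹) (Ici 0) 0 := by
    have : Continuous (fun k : ℝ => -(6 * (k ^ 2 + 9 / 4) ^ 3)⁻¹) := by
      have : ∀ k : ℝ, 6 * (k ^ 2 + 9 / 4) ^ 3 ≠ 0 := fun k => by positivity
      fun_prop (disch := exact this _)
    exact this.continuousWithinAt
  have hl : Tendsto (fun k : ℝ => -(6 * (k ^ 2 + 9 / 4) ^ 3)⁻¹) atTop (𝓝 0) := by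
    have h1 : Tendsto (fun k : ℝ => 6 * (k ^ 2 + 9 / 4) ^ 3) atTop atTop := by
      refine Tendsto.const_mul_atTop (by norm_num) ?_
      exact (tendsto_pow_atTop (by norm_num)).comp
        (tendsto_atTop_add_const_right _ _ (tendsto_pow_atTop (by norm_num)))
    simpa using h1.inv_tendsto_atTop.neg
  rw [integral_Ioi_of_hasDerivAt_of_tendsto hc hd integrableOn_G hl]
  norm_num

/-- The integral `∫₀^∞ G(k) / k dk` is `5π / (32 a⁷)` with `a = 3/2`. -/
lemma integral_G_div : ∫ k in Ioi (0 : ℝ), G k / k = 20 * Real.pi / 2187 := by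
  -- Primitive of `(k² + 9/4)⁻⁴` from three applications of the reduction formula for `∫ (k² + b)⁻ⁿ
  -- dk`, down to the arctangent.
  have hd : ∀ k ∈ Ioi (0 : ℝ),
      HasDerivAt (fun k : ℝ => 2 / 27 * k * ((k ^ 2 + 9 / 4) ^ 3)⁻¹
        + 10 / 243 * k * ((k ^ 2 + 9 / 4) ^ 2)⁻¹ + 20 / 729 * k * (k ^ 2 + 9 / 4)⁻¹
        + 40 / 2187 * Real.arctan (2 / 3 * k)) (G k / k) k := by
    intro k hk
    have hk' : 0 < k := hk
    have h0 : k ^ 2 + 9 / 4 ≠ 0 := by positivity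
    have h1 : HasDerivAt (fun k : ℝ => k ^ 2 + 9 / 4) (2 * k) k := by
      have := ((hasDerivAt_id k).pow 2).add_const (9 / 4 : ℝ)
      refine this.congr_deriv ?_
      simp
    have h2 : HasDerivAt (fun k : ℝ => (k ^ 2 + 9 / 4) ^ 2) (2 * (k ^ 2 + 9 / 4) * (2 * k)) k := by
      refine (h1.pow 2).congr_deriv ?_
      simp
    have h3 : HasDerivAt (fun k : ℝ => (k ^ 2 + 9 / 4) ^ 3)
        (3 * (k ^ 2 + 9 / 4) ^ 2 * (2 * k)) k := by
      refine (h1.pow 3).congr_deriv ?_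
      simp
    have h4 : HasDerivAt (fun k : ℝ => Real.arctan (2 / 3 * k))
        (1 / (1 + (2 / 3 * k) ^ 2) * (2 / 3 * 1)) k :=
      ((hasDerivAt_id k).const_mul (2 / 3 : ℝ)).arctan
    have h5 : HasDerivAt (fun k : ℝ => 2 / 27 * k) (2 / 27 * 1) k :=
      (hasDerivAt_id k).const_mul _
    have h6 : HasDerivAt (fun k : ℝ => 10 / 243 * k) (10 / 243 * 1) k :=
      (hasDerivAt_id k).const_mul _
    have h7 : HasDerivAt (fun k : ℝ => 20 / 729 * k) (20 / 729 * 1) k :=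
      (hasDerivAt_id k).const_mul _
    refine ((((h5.mul (h3.inv (by positivity))).add (h6.mul (h2.inv (by positivity)))).add
      (h7.mul (h1.inv h0))).add (h4.const_mul (40 / 2187))).congr_deriv ?_
    rw [G_div_eq hk']
    have h8 : 1 + (2 / 3 * k) ^ 2 = 4 / 9 * (k ^ 2 + 9 / 4) := by ring
    simp only [h8, Pi.inv_apply]
    field_simp
    ring
  have hc : ContinuousWithinAt (fun k : ℝ => 2 / 27 * k * ((k ^ 2 + 9 / 4) ^ 3)⁻¹
        + 10 / 243 * k * ((k ^ 2 + 9 / 4) ^ 2)⁻¹ + 20 / 729 * k * (k ^ 2 + 9 / 4)⁻¹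
        + 40 / 2187 * Real.arctan (2 / 3 * k)) (Ici 0) 0 := by
    have : ∀ k : ℝ, k ^ 2 + 9 / 4 ≠ 0 := fun k => by positivity
    have h1 : ∀ k : ℝ, (k ^ 2 + 9 / 4) ^ 2 ≠ 0 := fun k => by positivity
    have h2 : ∀ k : ℝ, (k ^ 2 + 9 / 4) ^ 3 ≠ 0 := fun k => by positivity
    refine Continuous.continuousWithinAt ?_
    have := Real.continuous_arctan
    fun_prop (disch := first | exact this _ | exact h1 _ | exact h2 _ | positivity)
  have hq : ∀ n : ℕ, 1 ≤ n → ∀ c : ℝ,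
      Tendsto (fun k : ℝ => c * k * ((k ^ 2 + 9 / 4) ^ n)⁻¹) atTop (𝓝 0) := by
    intro n hn c
    have h1 : Tendsto (fun k : ℝ => |c| * k⁻¹) atTop (𝓝 0) := by
      simpa using tendsto_inv_atTop_zero.const_mul |c|
    refine squeeze_zero_norm' ?_ h1
    filter_upwards [eventually_gt_atTop 0] with k hk
    rw [mul_assoc, norm_mul, Real.norm_eq_abs, Real.norm_of_nonneg (by positivity)]
    gcongr
    rw [← div_eq_mul_inv, ← one_div, div_le_div_iff₀ (by positivity) hk]
    calc k * k ≤ k ^ 2 + 9 / 4 := by nlinarith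
      _ ≤ (k ^ 2 + 9 / 4) ^ n := le_self_pow₀ (by nlinarith [sq_nonneg k]) (by omega)
      _ = _ := (one_mul _).symm
  have ha : Tendsto (fun k : ℝ => 40 / 2187 * Real.arctan (2 / 3 * k)) atTop
      (𝓝 (40 / 2187 * (Real.pi / 2))) := by
    refine Tendsto.const_mul _ ?_
    exact (tendsto_nhds_of_tendsto_nhdsWithin Real.tendsto_arctan_atTop).comp
      (tendsto_id.const_mul_atTop (by norm_num))
  have hl := (((hq 3 (by norm_num) (2 / 27)).add (hq 2 (by norm_num) (10 / 243))).add
    (by simpa using hq 1 le_rfl (20 / 729))).add ha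
  rw [integral_Ioi_of_hasDerivAt_of_tendsto hc hd integrableOn_G_div hl]
  simp
  ring

lemma integral_G_div_le : ∫ k in Ioi (0 : ℝ), G k / k ≤ 0.0288 := by
  rw [integral_G_div]
  have := Real.pi_lt_d4
  norm_num at this ⊢
  linarith

end FormFactor

/-! ### Boundary values and derivatives of Cauchy transforms -/

section CauchyTransform

/-- The function `φ` with its value at `x` subtracted on the interval `(x - δ, x + δ]`. -/
noncomputable def subtracted (φ : ℝ → ℝ) (x δ k : ℝ) : ℝ :=
  φ k - (Ioc (x - δ) (x + δ)).indicator (fun _ => φ x) k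

variable {φ : ℝ → ℝ} {x δ ε : ℝ}

lemma integrableOn_subtracted (hφ : IntegrableOn φ (Ioi 0)) :
    IntegrableOn (subtracted φ x δ) (Ioi 0) := by
  refine Integrable.sub hφ (Integrable.integrableOn ?_)
  exact (integrable_indicator_iff measurableSet_Ioc).2 (by simp)

/-- On an interval symmetric about `x` the logarithmic part of the primitive cancels, leaving a
purely imaginary value which tends to `πi` as `ε → 0`. -/
lemma integral_inv_sub_line (hε : 0 < ε) :
    ∫ k in (x - δ)..(x + δ), ((k : ℂ) - (x + ε * Complex.I))⁻¹
      = 2 * Real.arctan (δ / ε) * Complex.I := by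
  have hz : ∀ k : ℝ, (k : ℂ) - (x + ε * Complex.I) ≠ 0 :=
    ofReal_sub_ne_zero (by simpa using hε.ne')
  have hd : ∀ k : ℝ, HasDerivAt (fun k : ℝ => ((1 / 2 * Real.log ((k - x) ^ 2 + ε ^ 2) : ℝ) : ℂ)
      + ((Real.arctan ((k - x) / ε) : ℝ) : ℂ) * Complex.I)
      (((k : ℂ) - (x + ε * Complex.I))⁻¹) k := by
    intro k
    have h0 : HasDerivAt (fun k : ℝ => k - x) 1 k := (hasDerivAt_id k).sub_const x
    have hp : (k - x) ^ 2 + ε ^ 2 ≠ 0 := by positivity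
    have h1 : HasDerivAt (fun k : ℝ => 1 / 2 * Real.log ((k - x) ^ 2 + ε ^ 2))
        ((k - x) / ((k - x) ^ 2 + ε ^ 2)) k := by
      refine ((((h0.pow 2).add_const (ε ^ 2)).log hp).const_mul (1 / 2)).congr_deriv ?_
      simp
      field_simp
    have h2 : HasDerivAt (fun k : ℝ => Real.arctan ((k - x) / ε))
        (ε / ((k - x) ^ 2 + ε ^ 2)) k := by
      refine (h0.div_const ε).arctan.congr_deriv ?_
      field_simp
      ring
    refine (h1.ofReal_comp.add (h2.ofReal_comp.mul_const Complex.I)).congr_deriv ?_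
    have hp' : ((k : ℂ) - x) ^ 2 + ε ^ 2 ≠ 0 := by exact_mod_cast hp
    have h3 := hz k
    push_cast
    field_simp
    linear_combination (-(ε : ℂ) ^ 2) * Complex.I_sq
  rw [intervalIntegral.integral_eq_sub_of_hasDerivAt (fun k _ => hd k)]
  · have h1 : x + δ - x = δ := by ring
    have h2 : x - δ - x = -δ := by ring
    rw [h1, h2, neg_sq, neg_div, Real.arctan_neg]
    push_cast
    ring
  · refine Continuous.intervalIntegrable ?_ _ _
    exact Continuous.inv₀ (by fun_prop) hz

/-- The condition `δ ≤ x` keeps the symmetric window inside the half line, so the subtracted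
constant contributes exactly the arctangent term. -/
lemma cauchyTransform_eq_add (hφ : IntegrableOn φ (Ioi 0)) (hδ : 0 < δ) (hδx : δ ≤ x)
    (hε : 0 < ε) : cauchyTransform φ (x + ε * Complex.I)
      = cauchyTransform (subtracted φ x δ) (x + ε * Complex.I)
        + φ x * (2 * Real.arctan (δ / ε) * Complex.I) := by
  have hz : ((x : ℂ) + ε * Complex.I).im ≠ 0 := by simpa using hε.ne'
  have hI : IntegrableOn ((Ioc (x - δ) (x + δ)).indicator fun _ => φ x) (Ioi 0) :=
    Integrable.integrableOn ((integrable_indicator_iff measurableSet_Ioc).2 (by simp))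
  have h1 : cauchyTransform (subtracted φ x δ) (x + ε * Complex.I)
      = cauchyTransform φ (x + ε * Complex.I)
        - cauchyTransform ((Ioc (x - δ) (x + δ)).indicator fun _ => φ x) (x + ε * Complex.I) := by
    unfold cauchyTransform
    rw [← integral_sub (integrableOn_div_sub hφ hz) (integrableOn_div_sub hI hz)]
    congr 1
    ext k
    simp only [subtracted]
    push_cast
    ring
  have h2 : cauchyTransform ((Ioc (x - δ) (x + δ)).indicator fun _ => φ x) (x + ε * Complex.I)
      = φ x * (2 * Real.arctan (δ / ε) * Complex.I) := by
    rw [← integral_inv_sub_line (x := x) (δ := δ) hε, intervalIntegral.integral_of_le (by linarith),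
      ← integral_const_mul, cauchyTransform]
    have h3 : ∀ k : ℝ, (((Ioc (x - δ) (x + δ)).indicator (fun _ => φ x) k : ℝ) : ℂ)
        / (k - (x + ε * Complex.I)) = (Ioc (x - δ) (x + δ)).indicator
          (fun k : ℝ => (φ x : ℂ) * ((k : ℂ) - (x + ε * Complex.I))⁻¹) k := by
      intro k
      by_cases hk : k ∈ Ioc (x - δ) (x + δ)
      · rw [indicator_of_mem hk, indicator_of_mem hk, div_eq_mul_inv]
      · rw [indicator_of_notMem hk, indicator_of_notMem hk]; simp
    simp only [h3]
    rw [setIntegral_indicator measurableSet_Ioc, inter_eq_right.2]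
    intro k hk
    have := hk.1
    simp only [mem_Ioi]
    linarith
  rw [h1, h2]
  ring

lemma abs_sub_le_norm (x ε k : ℝ) : |k - x| ≤ ‖(k : ℂ) - (x + ε * Complex.I)‖ := by
  have := Complex.abs_re_le_norm ((k : ℂ) - (x + ε * Complex.I))
  simpa using this

lemma norm_div_sub_le {m : ℝ → ℝ} (hm : ∀ k, 0 < k → |φ k| ≤ m k * |k - x|)
    (hm0 : ∀ k, 0 < k → 0 ≤ m k) (hε : 0 < ε) {k : ℝ} (hk : 0 < k) :
    ‖(φ k : ℂ) / (k - (x + ε * Complex.I))‖ ≤ m k := by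
  have hz : (k : ℂ) - (x + ε * Complex.I) ≠ 0 := ofReal_sub_ne_zero (by simpa using hε.ne') k
  rw [norm_div, Complex.norm_real, div_le_iff₀ (norm_pos_iff.2 hz)]
  exact (hm k hk).trans (mul_le_mul_of_nonneg_left (abs_sub_le_norm x ε k) (hm0 k hk))

lemma norm_cauchyTransform_le {m : ℝ → ℝ} (hm : ∀ k, 0 < k → |φ k| ≤ m k * |k - x|)
    (hm0 : ∀ k, 0 < k → 0 ≤ m k) (hmi : IntegrableOn m (Ioi 0)) (hε : 0 < ε) :
    ‖cauchyTransform φ (x + ε * Complex.I)‖ ≤ ∫ k in Ioi (0 : ℝ), m k :=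
  norm_integral_le_of_norm_le hmi ((ae_restrict_iff' measurableSet_Ioi).2
    (ae_of_all _ fun _ hk => norm_div_sub_le hm hm0 hε hk))

lemma tendsto_cauchyTransform {m : ℝ → ℝ} (hφ : IntegrableOn φ (Ioi 0))
    (hm : ∀ k, 0 < k → |φ k| ≤ m k * |k - x|)
    (hm0 : ∀ k, 0 < k → 0 ≤ m k) (hmi : IntegrableOn m (Ioi 0)) :
    Tendsto (fun ε : ℝ => cauchyTransform φ (x + ε * Complex.I)) (𝓝[>] 0)
      (𝓝 ((∫ k in Ioi (0 : ℝ), φ k / (k - x) : ℝ) : ℂ)) := by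
  rw [← integral_complex_ofReal]
  refine tendsto_integral_filter_of_dominated_convergence m ?_ ?_ hmi ?_
  · filter_upwards [self_mem_nhdsWithin] with ε hε
    have hε' : 0 < ε := hε
    exact (integrableOn_div_sub hφ (by simpa using hε'.ne')).aestronglyMeasurable
  · filter_upwards [self_mem_nhdsWithin] with ε hε
    exact (ae_restrict_iff' measurableSet_Ioi).2
      (ae_of_all _ fun _ hk => norm_div_sub_le hm hm0 hε hk)
  · filter_upwards [Measure.ae_ne (volume.restrict (Ioi (0 : ℝ))) x] with k hk
    have h1 : (k : ℂ) - (x + ((0 : ℝ) : ℂ) * Complex.I) ≠ 0 := by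
      simpa [sub_eq_zero] using hk
    have h2 : ContinuousAt (fun ε : ℝ => (φ k : ℂ) / (k - (x + ε * Complex.I))) 0 :=
      ContinuousAt.div (by fun_prop) (by fun_prop) h1
    have h3 := h2.tendsto.mono_left (nhdsWithin_le_nhds (s := Ioi 0))
    simpa using h3

lemma abs_subtracted_le {L : ℝ} {q : ℝ → ℝ} (hL : ∀ k, 0 < k → |φ k - φ x| ≤ L * |k - x|)
    (hq : ∀ k, 0 < k → δ ≤ |k - x| → |φ k| ≤ q k * |k - x|) (hq0 : ∀ k, 0 < k → 0 ≤ q k)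
    {k : ℝ} (hk : 0 < k) : |subtracted φ x δ k|
      ≤ ((Ioc (x - δ) (x + δ)).indicator (fun _ => L) k + q k) * |k - x| := by
  unfold subtracted
  by_cases h : k ∈ Ioc (x - δ) (x + δ)
  · rw [indicator_of_mem h, indicator_of_mem h]
    refine (hL k hk).trans (mul_le_mul_of_nonneg_right ?_ (abs_nonneg _))
    linarith [hq0 k hk]
  · rw [indicator_of_notMem h, indicator_of_notMem h, sub_zero, zero_add]
    refine hq k hk ?_
    by_contra! h1
    rw [abs_lt] at h1
    exact h ⟨by linarith, by linarith⟩

lemma integrableOn_majorant {q : ℝ → ℝ} (hq : IntegrableOn q (Ioi 0)) (L : ℝ) :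
    IntegrableOn (fun k => (Ioc (x - δ) (x + δ)).indicator (fun _ => L) k + q k) (Ioi 0) :=
  Integrable.add (Integrable.integrableOn
    ((integrable_indicator_iff measurableSet_Ioc).2 (by simp))) hq

lemma integral_majorant {q : ℝ → ℝ} (hq : IntegrableOn q (Ioi 0)) (L : ℝ) (hδ : 0 < δ)
    (hδx : δ ≤ x) :
    ∫ k in Ioi (0 : ℝ), ((Ioc (x - δ) (x + δ)).indicator (fun _ => L) k + q k)
      = 2 * δ * L + ∫ k in Ioi (0 : ℝ), q k := by
  rw [integral_add (Integrable.integrableOn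
    ((integrable_indicator_iff measurableSet_Ioc).2 (by simp))) hq,
    setIntegral_indicator measurableSet_Ioc, inter_eq_right.2, setIntegral_const]
  · congr 1
    rw [Measure.real, Real.volume_Ioc, ENNReal.toReal_ofReal (by linarith), smul_eq_mul]
    ring
  · intro k hk
    have := hk.1
    simp only [mem_Ioi]
    linarith

/-- The regular part of a Cauchy transform near the positive real axis is bounded by means of a
Lipschitz constant near the singularity and of an integrable majorant away from it. -/
lemma norm_cauchyTransform_subtracted_le {L : ℝ} {q : ℝ → ℝ}
    (hL : ∀ k, 0 < k → |φ k - φ x| ≤ L * |k - x|)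
    (hq : ∀ k, 0 < k → δ ≤ |k - x| → |φ k| ≤ q k * |k - x|) (hq0 : ∀ k, 0 < k → 0 ≤ q k)
    (hqi : IntegrableOn q (Ioi 0)) (hL0 : 0 ≤ L) (hδ : 0 < δ) (hδx : δ ≤ x) (hε : 0 < ε) :
    ‖cauchyTransform (subtracted φ x δ) (x + ε * Complex.I)‖
      ≤ 2 * δ * L + ∫ k in Ioi (0 : ℝ), q k := by
  rw [← integral_majorant hqi L hδ hδx]
  exact norm_cauchyTransform_le (fun k hk => abs_subtracted_le hL hq hq0 hk)
    (fun k hk => add_nonneg (indicator_nonneg (fun _ _ => hL0) k) (hq0 k hk))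
    (integrableOn_majorant hqi L) hε

/-- The subtracted term is purely imaginary, so the real part satisfies the bound of the regular
part without the contribution `π |φ x|`. -/
lemma abs_re_cauchyTransform_le {L : ℝ} {q : ℝ → ℝ} (hφ : IntegrableOn φ (Ioi 0))
    (hL : ∀ k, 0 < k → |φ k - φ x| ≤ L * |k - x|)
    (hq : ∀ k, 0 < k → δ ≤ |k - x| → |φ k| ≤ q k * |k - x|) (hq0 : ∀ k, 0 < k → 0 ≤ q k)
    (hqi : IntegrableOn q (Ioi 0)) (hL0 : 0 ≤ L) (hδ : 0 < δ) (hδx : δ ≤ x) (hε : 0 < ε) :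
    |(cauchyTransform φ (x + ε * Complex.I)).re| ≤ 2 * δ * L + ∫ k in Ioi (0 : ℝ), q k := by
  refine le_trans ?_ (norm_cauchyTransform_subtracted_le hL hq hq0 hqi hL0 hδ hδx hε)
  rw [cauchyTransform_eq_add hφ hδ hδx hε]
  refine le_trans (le_of_eq ?_) (Complex.abs_re_le_norm _)
  congr 1
  rw [Complex.add_re, Complex.re_ofReal_mul]
  generalize Real.arctan (δ / ε) = a
  simp

lemma norm_cauchyTransform_le_add {L : ℝ} {q : ℝ → ℝ} (hφ : IntegrableOn φ (Ioi 0))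
    (hL : ∀ k, 0 < k → |φ k - φ x| ≤ L * |k - x|)
    (hq : ∀ k, 0 < k → δ ≤ |k - x| → |φ k| ≤ q k * |k - x|) (hq0 : ∀ k, 0 < k → 0 ≤ q k)
    (hqi : IntegrableOn q (Ioi 0)) (hL0 : 0 ≤ L) (hδ : 0 < δ) (hδx : δ ≤ x) (hε : 0 < ε) :
    ‖cauchyTransform φ (x + ε * Complex.I)‖
      ≤ 2 * δ * L + (∫ k in Ioi (0 : ℝ), q k) + Real.pi * |φ x| := by
  rw [cauchyTransform_eq_add hφ hδ hδx hε]
  refine (norm_add_le _ _).trans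
    (add_le_add (norm_cauchyTransform_subtracted_le hL hq hq0 hqi hL0 hδ hδx hε) ?_)
  rw [norm_mul, norm_mul, norm_mul, Complex.norm_I, Complex.norm_real, Complex.norm_real, mul_one,
    mul_comm]
  refine mul_le_mul_of_nonneg_right ?_ (norm_nonneg _)
  have h1 := Real.arctan_lt_pi_div_two (δ / ε)
  have h2 : 0 ≤ Real.arctan (δ / ε) := Real.arctan_nonneg.2 (by positivity)
  rw [Real.norm_of_nonneg h2]
  simp
  linarith

/-- Sokhotski–Plemelj: the regular part converges by domination to the principal value, and the
arctangent term to `πi φ(x)`. -/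
lemma tendsto_cauchyTransform_of_pos {L : ℝ} {q : ℝ → ℝ} (hφ : IntegrableOn φ (Ioi 0))
    (hL : ∀ k, 0 < k → |φ k - φ x| ≤ L * |k - x|)
    (hq : ∀ k, 0 < k → δ ≤ |k - x| → |φ k| ≤ q k * |k - x|) (hq0 : ∀ k, 0 < k → 0 ≤ q k)
    (hqi : IntegrableOn q (Ioi 0)) (hL0 : 0 ≤ L) (hδ : 0 < δ) (hδx : δ ≤ x) :
    Tendsto (fun ε : ℝ => cauchyTransform φ (x + ε * Complex.I)) (𝓝[>] 0)
      (𝓝 (((∫ k in Ioi (0 : ℝ), subtracted φ x δ k / (k - x) : ℝ) : ℂ)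
        + ((Real.pi * φ x : ℝ) : ℂ) * Complex.I)) := by
  have h1 := tendsto_cauchyTransform (x := x) (integrableOn_subtracted (x := x) (δ := δ) hφ)
    (fun k hk => abs_subtracted_le hL hq hq0 hk)
    (fun k hk => add_nonneg (indicator_nonneg (fun _ _ => hL0) k) (hq0 k hk))
    (integrableOn_majorant hqi L)
  have h2 : Tendsto (fun ε : ℝ => (φ x : ℂ) * (2 * Real.arctan (δ / ε) * Complex.I)) (𝓝[>] 0)
      (𝓝 (((Real.pi * φ x : ℝ) : ℂ) * Complex.I)) := by
    have h3 : Tendsto (fun ε : ℝ => Real.arctan (δ / ε)) (𝓝[>] 0) (𝓝 (Real.pi / 2)) :=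
      (tendsto_nhds_of_tendsto_nhdsWithin Real.tendsto_arctan_atTop).comp
        (tendsto_inv_nhdsGT_zero.const_mul_atTop hδ)
    have h4 := ((Complex.continuous_ofReal.tendsto _).comp h3).const_mul (2 * (φ x : ℂ))
      |>.mul_const Complex.I
    convert h4 using 2
    · simp only [Function.comp_apply]; ring
    · push_cast; ring
  refine (h1.add h2).congr' ?_
  filter_upwards [self_mem_nhdsWithin] with ε hε
  rw [cauchyTransform_eq_add hφ hδ hδx hε]

/-- The derivative of a Cauchy transform is the Cauchy transform of the derivative. -/
theorem hasDerivAt_cauchyTransform {g g' : ℝ → ℝ} (hg : IntegrableOn g (Ioi 0))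
    (hg' : IntegrableOn g' (Ioi 0)) (hd : ∀ k, 0 < k → HasDerivAt g (g' k) k)
    (hc : ContinuousWithinAt g (Ici 0) 0) (h0 : g 0 = 0) (hlim : Tendsto g atTop (𝓝 0)) {z : ℂ}
    (hz : 0 < z.im) : HasDerivAt (cauchyTransform g) (cauchyTransform g' z) z := by
  have hgi := hg
  set δ := z.im / 2 with hδ
  have hδ0 : 0 < δ := by positivity
  have hball : ∀ w ∈ Metric.ball z δ, δ < w.im := by
    intro w hw
    rw [mem_ball_iff_norm] at hw
    have := (Complex.abs_im_le_norm (w - z)).trans_lt hw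
    rw [Complex.sub_im, abs_lt] at this
    linarith [this.1]
  have hmeas : ∀ w : ℂ, AEStronglyMeasurable (fun k : ℝ => (g k : ℂ) / (k - w))
      (volume.restrict (Ioi 0)) := fun w =>
    ((Complex.continuous_ofReal.comp_aestronglyMeasurable hgi.aestronglyMeasurable).mul
      (Measurable.aestronglyMeasurable (f := fun k : ℝ => ((k : ℂ) - w)⁻¹) (by fun_prop))).congr
        (ae_of_all _ fun k => by simp [div_eq_mul_inv])
  have hsq : ∀ w : ℂ, δ < w.im → ∀ k : ℝ, ‖(g k : ℂ) / ((k : ℂ) - w) ^ 2‖ ≤ |g k| * (δ⁻¹) ^ 2 := by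
    intro w hw k
    rw [div_eq_mul_inv, norm_mul, Complex.norm_real, ← inv_pow, norm_pow, Real.norm_eq_abs]
    have hw0 : 0 < w.im := hδ0.trans hw
    gcongr
    refine (norm_inv_ofReal_sub_le hw0.ne' k).trans (inv_anti₀ hδ0 ?_)
    rw [abs_of_pos hw0]
    exact hw.le
  have hzim : δ < z.im := by rw [hδ]; linarith
  have h1 := hasDerivAt_integral_of_dominated_loc_of_deriv_le
    (F := fun (w : ℂ) (k : ℝ) => (g k : ℂ) / (k - w))
    (F' := fun (w : ℂ) (k : ℝ) => (g k : ℂ) / ((k : ℂ) - w) ^ 2)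
    (μ := volume.restrict (Ioi (0 : ℝ))) (x₀ := z) (bound := fun k => |g k| * (δ⁻¹) ^ 2)
    (Metric.ball_mem_nhds z hδ0) (Eventually.of_forall hmeas) (integrableOn_div_sub hg hz.ne')
    ?_ (ae_of_all _ fun k w hw => hsq w (hball w hw) k) (hg.abs.mul_const _)
    (ae_of_all _ fun k w hw => ?_)
  · have h2 : IntegrableOn (fun k : ℝ => (g k : ℂ) / ((k : ℂ) - z) ^ 2) (Ioi 0) := h1.1
    have h3 := integrableOn_div_sub hg' hz.ne'
    have h4 : ∀ k ∈ Ioi (0 : ℝ), HasDerivAt (fun k : ℝ => (g k : ℂ) / (k - z))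
        ((g' k : ℂ) / (k - z) - (g k : ℂ) / ((k : ℂ) - z) ^ 2) k := by
      intro k hk
      have hne := ofReal_sub_ne_zero hz.ne' k
      have h5 : HasDerivAt (fun k : ℝ => (k : ℂ) - z) 1 k :=
        ((hasDerivAt_id (k : ℂ)).sub_const z).comp_ofReal
      refine ((hd k hk).ofReal_comp.div h5 hne).congr_deriv ?_
      field_simp
    have h6 : ContinuousWithinAt (fun k : ℝ => (g k : ℂ) / (k - z)) (Ici 0) 0 := by
      refine ContinuousWithinAt.div ?_ (by fun_prop) (ofReal_sub_ne_zero hz.ne' 0)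
      exact Complex.continuous_ofReal.continuousAt.comp_continuousWithinAt hc
    have h7 : Tendsto (fun k : ℝ => (g k : ℂ) / (k - z)) atTop (𝓝 0) := by
      have h8 : Tendsto (fun k : ℝ => |g k| * |z.im|⁻¹) atTop (𝓝 0) := by
        simpa using hlim.abs.mul_const (|z.im|⁻¹)
      refine squeeze_zero_norm (fun k => ?_) h8
      rw [div_eq_mul_inv, norm_mul, Complex.norm_real, Real.norm_eq_abs]
      gcongr
      exact norm_inv_ofReal_sub_le hz.ne' k
    -- Integration by parts: `g(k)/(k - z)` vanishes at both ends, so the integrals of `g'/(k - z)`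
    -- and `g/(k - z)²` agree.
    have h9 := integral_Ioi_of_hasDerivAt_of_tendsto h6 h4 (h3.sub h2) h7
    rw [integral_sub h3 h2, h0] at h9
    simp only [Complex.ofReal_zero, zero_div, sub_zero] at h9
    rw [sub_eq_zero] at h9
    refine h1.2.congr_deriv ?_
    rw [← h9, cauchyTransform]
  · exact ((Complex.continuous_ofReal.comp_aestronglyMeasurable hgi.aestronglyMeasurable).mul
      (Measurable.aestronglyMeasurable (f := fun k : ℝ => (((k : ℂ) - z) ^ 2)⁻¹) (by fun_prop))).congr
        (ae_of_all _ fun k => by simp [div_eq_mul_inv])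
  · have hne := ofReal_sub_ne_zero (hδ0.trans (hball w hw)).ne' k
    have h5 : HasDerivAt (fun w : ℂ => (k : ℂ) - w) (-1) w := (hasDerivAt_id w).const_sub _
    refine ((hasDerivAt_const w (g k : ℂ)).div h5 hne).congr_deriv ?_
    simp

end CauchyTransform

/-! ### The self-energy and its behaviour at the threshold -/

section SelfEnergy

variable {x ε : ℝ}

lemma abs_G_le_of_nonpos (hx : x ≤ 0) {k : ℝ} (hk : 0 < k) : |G k| ≤ G k / k * |k - x| := by
  rw [abs_of_nonneg (G_nonneg k), abs_of_nonneg (by linarith)]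
  calc G k = G k / k * k := by field_simp
    _ ≤ _ := mul_le_mul_of_nonneg_left (by linarith) (G_div_nonneg k hk.le)

lemma norm_cauchyTransform_G_le_of_nonpos (hx : x ≤ 0) (hε : 0 < ε) :
    ‖cauchyTransform G (x + ε * Complex.I)‖ ≤ ∫ k in Ioi (0 : ℝ), G k / k :=
  norm_cauchyTransform_le (fun _ hk => abs_G_le_of_nonpos hx hk)
    (fun k hk => G_div_nonneg k hk.le) integrableOn_G_div hε

lemma two_mul_le_of_le_abs {k : ℝ} (hk : 0 < k) (h : x ≤ |k - x|) : 2 * x ≤ k := by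
  rcases abs_cases (k - x) with ⟨h1, _⟩ | ⟨h1, _⟩ <;> linarith

lemma abs_G_le_of_le_abs {k : ℝ} (hk : 0 < k) (h : x ≤ |k - x|) :
    |G k| ≤ 2 * (G k / k) * |k - x| := by
  have h1 := two_mul_le_of_le_abs hk h
  rw [abs_of_nonneg (G_nonneg k), abs_of_nonneg (by linarith)]
  calc G k = G k / k * k := by field_simp
    _ ≤ G k / k * (2 * (k - x)) :=
      mul_le_mul_of_nonneg_left (by linarith) (G_div_nonneg k hk.le)
    _ = _ := by ring

/-- Bound for the level shift near the threshold. -/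
lemma abs_re_cauchyTransform_G_le {c : ℝ} (hx : 0 < x) (hc : x < c) (hε : 0 < ε) :
    |(cauchyTransform G (x + ε * Complex.I)).re|
      ≤ (∫ k in Ioi (0 : ℝ), G k / k) * (1 + x / (c - x)) + (c + 2 * x) / 25 := by
  have hcx : 0 < c - x := sub_pos.2 hc
  have hind : Integrable ((Ioc (0 : ℝ) c).indicator fun _ => (1 / 25 : ℝ)) :=
    (integrable_indicator_iff measurableSet_Ioc).2 (by simp)
  -- Window `(0, 2x]` with the Lipschitz constant costs `2x/25`. Beyond it `1/(k - x) = (1/k)(1 +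
  -- x/(k - x))`; the correction is at most `1/25` after multiplication by `G/k` when `k ≤ c`, and
  -- its factor is at most `x/(c - x)` when `k > c`. Letting `x` and then `c` tend to `0` recovers
  -- `∫ G/k`.
  have h := abs_re_cauchyTransform_le (x := x) (δ := x) (ε := ε) (L := 1 / 25)
    (q := fun k => G k / k * (1 + x / (c - x)) + (Ioc (0 : ℝ) c).indicator (fun _ => 1 / 25) k)
    integrableOn_G (fun k _ => abs_G_sub_le k x) ?_ ?_
    ((integrableOn_G_div.mul_const _).add hind.integrableOn) (by norm_num) hx le_rfl hε
  · refine h.trans (le_of_eq ?_)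
    rw [integral_add (integrableOn_G_div.mul_const _) hind.integrableOn, integral_mul_const,
      setIntegral_indicator measurableSet_Ioc, inter_eq_right.2 (fun k hk => hk.1),
      setIntegral_const, Measure.real, Real.volume_Ioc, ENNReal.toReal_ofReal (by linarith),
      smul_eq_mul]
    ring
  · intro k hk hkx
    have h1 := two_mul_le_of_le_abs hk hkx
    have hk' : 0 < k - x := by linarith
    rw [abs_of_nonneg (G_nonneg k), abs_of_pos hk']
    have hg := G_div_nonneg k hk.le
    have h2 : G k = G k / k * (1 + x / (k - x)) * (k - x) := by field_simp; ring
    by_cases hkc : k ≤ c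
    · rw [indicator_of_mem (show k ∈ Ioc 0 c from ⟨hk, hkc⟩)]
      conv_lhs => rw [h2]
      refine mul_le_mul_of_nonneg_right ?_ hk'.le
      have h3 : x / (k - x) ≤ 1 := (div_le_one hk').2 (by linarith)
      have h4 : G k / k * (x / (k - x)) ≤ 1 / 25 * 1 :=
        mul_le_mul (G_div_le hk) h3 (by positivity) (by norm_num)
      have h5 : 0 ≤ G k / k * (x / (c - x)) := by positivity
      nlinarith
    · rw [indicator_of_notMem (fun h => hkc h.2), add_zero]
      conv_lhs => rw [h2]
      push Not at hkc
      gcongr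
  · intro k hk
    have hg := G_div_nonneg k hk.le
    exact add_nonneg (by positivity) (indicator_nonneg (fun _ _ => by norm_num) k)

/-- A crude uniform bound for use away from the threshold. The half-width of the window is `x` up to
`1` and then stays `1`, so that the Lipschitz contribution does not grow. -/
lemma norm_cauchyTransform_G_le_one (x : ℝ) (hε : 0 < ε) :
    ‖cauchyTransform G (x + ε * Complex.I)‖ ≤ 1 := by
  have hs := integral_G_div_le
  have hpi := Real.pi_lt_d2
  norm_num at hs hpi
  rcases le_or_gt x 0 with hx | hx
  · exact (norm_cauchyTransform_G_le_of_nonpos hx hε).trans (by linarith)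
  have hG : Real.pi * |G x| ≤ 4 * (1 / 25) := by
    rw [abs_of_nonneg (G_nonneg x)]
    exact mul_le_mul (by linarith) (G_le x) (G_nonneg x) (by norm_num)
  rcases le_or_gt x 1 with hx1 | hx1
  · have h := norm_cauchyTransform_le_add (x := x) (δ := x) (ε := ε) (L := 1 / 25)
      (q := fun k => 2 * (G k / k)) integrableOn_G (fun k _ => abs_G_sub_le k x)
      (fun k hk hkx => abs_G_le_of_le_abs hk hkx)
      (fun k hk => by have := G_div_nonneg k hk.le; positivity)
      (integrableOn_G_div.const_mul 2) (by norm_num) hx le_rfl hε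
    rw [integral_const_mul] at h
    linarith
  · have h := norm_cauchyTransform_le_add (x := x) (δ := 1) (ε := ε) (L := 1 / 25)
      (q := G) integrableOn_G (fun k _ => abs_G_sub_le k x)
      (fun k hk hkx => by
        rw [abs_of_nonneg (G_nonneg k)]; exact le_mul_of_one_le_right (G_nonneg k) hkx)
      (fun k hk => G_nonneg k) integrableOn_G (by norm_num) one_pos hx1.le hε
    rw [integral_G] at h
    linarith

lemma exists_tendsto_cauchyTransform_G (x : ℝ) :
    ∃ p : ℝ, Tendsto (fun ε : ℝ => cauchyTransform G (x + ε * Complex.I)) (𝓝[>] 0)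
      (𝓝 ((p : ℂ) + ((Real.pi * G x : ℝ) : ℂ) * Complex.I)) := by
  rcases le_or_gt x 0 with hx | hx
  · refine ⟨∫ k in Ioi (0 : ℝ), G k / (k - x), ?_⟩
    rw [G_of_nonpos hx, mul_zero, Complex.ofReal_zero, zero_mul, add_zero]
    exact tendsto_cauchyTransform integrableOn_G (fun k hk => abs_G_le_of_nonpos hx hk)
      (fun k hk => G_div_nonneg k hk.le) integrableOn_G_div
  · exact ⟨_, tendsto_cauchyTransform_of_pos (x := x) (δ := x) (L := 1 / 25)
      (q := fun k => 2 * (G k / k)) integrableOn_G (fun k _ => abs_G_sub_le k x)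
      (fun k hk hkx => abs_G_le_of_le_abs hk hkx)
      (fun k hk => by have := G_div_nonneg k hk.le; positivity)
      (integrableOn_G_div.const_mul 2) (by norm_num) hx le_rfl⟩

/-- The principal value of `∫₀^∞ G(k) / (k - x) dk`: the real part of the boundary value of the
Cauchy transform. -/
noncomputable def levelShift (x : ℝ) : ℝ := (exists_tendsto_cauchyTransform_G x).choose

lemma tendsto_cauchyTransform_G (x : ℝ) :
    Tendsto (fun ε : ℝ => cauchyTransform G (x + ε * Complex.I)) (𝓝[>] 0)
      (𝓝 ((levelShift x : ℂ) + ((Real.pi * G x : ℝ) : ℂ) * Complex.I)) :=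
  (exists_tendsto_cauchyTransform_G x).choose_spec

lemma abs_levelShift_le {B : ℝ}
    (h : ∀ ε : ℝ, 0 < ε → |(cauchyTransform G (x + ε * Complex.I)).re| ≤ B) :
    |levelShift x| ≤ B := by
  have h1 := ((Complex.continuous_re.tendsto _).comp (tendsto_cauchyTransform_G x)).abs
  have h2 : ((levelShift x : ℂ) + ((Real.pi * G x : ℝ) : ℂ) * Complex.I).re = levelShift x := by
    rw [Complex.add_re, Complex.re_ofReal_mul]
    simp
  rw [h2] at h1
  refine le_of_tendsto h1 ?_
  filter_upwards [self_mem_nhdsWithin] with ε hε using h ε hε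

lemma abs_levelShift_le_one (x : ℝ) : |levelShift x| ≤ 1 :=
  abs_levelShift_le fun _ hε =>
    (Complex.abs_re_le_norm _).trans (norm_cauchyTransform_G_le_one x hε)

lemma abs_levelShift_le_of_pos {c : ℝ} (hx : 0 < x) (hc : x < c) :
    |levelShift x| ≤ (∫ k in Ioi (0 : ℝ), G k / k) * (1 + x / (c - x)) + (c + 2 * x) / 25 :=
  abs_levelShift_le fun _ hε => abs_re_cauchyTransform_G_le hx hc hε

lemma tendsto_G_atTop : Tendsto G atTop (𝓝 0) := by
  have h1 : Tendsto (fun k : ℝ => k⁻¹) atTop (𝓝 0) := tendsto_inv_atTop_zero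
  refine squeeze_zero' (Eventually.of_forall G_nonneg) ?_ h1
  filter_upwards [eventually_gt_atTop 0] with k hk
  have h2 := G_div_eq hk
  rw [div_eq_iff hk.ne'] at h2
  rw [h2, inv_mul_eq_div, ← one_div, div_le_div_iff₀ (by positivity) hk]
  calc k * k ≤ k ^ 2 + 9 / 4 := by nlinarith
    _ ≤ (k ^ 2 + 9 / 4) ^ 4 := le_self_pow₀ (by nlinarith [sq_nonneg k]) (by norm_num)
    _ = _ := (one_mul _).symm

lemma hasDerivAt_cauchyTransform_G {z : ℂ} (hz : 0 < z.im) :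
    HasDerivAt (cauchyTransform G) (cauchyTransform derivRatG z) z := by
  refine hasDerivAt_cauchyTransform integrableOn_G integrable_derivRatG.integrableOn
    (fun k hk => ?_) continuous_G.continuousWithinAt (G_of_nonpos le_rfl) tendsto_G_atTop hz
  refine (hasDerivAt_ratG k).congr_of_eventuallyEq ?_
  filter_upwards [eventually_gt_nhds hk] with y hy using G_eq_ratG hy.le

lemma integrableOn_rpow_mul_inv :
    IntegrableOn (fun k : ℝ => k ^ (-(1 / 2) : ℝ) * (1 + k ^ 2)⁻¹) (Ioi 0) := by
  have hm : Measurable fun k : ℝ => k ^ (-(1 / 2) : ℝ) * (1 + k ^ 2)⁻¹ := by fun_prop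
  rw [← Ioc_union_Ioi_eq_Ioi zero_le_one]
  refine IntegrableOn.union ?_ ?_
  · have h1 : IntegrableOn (fun k : ℝ => k ^ (-(1 / 2) : ℝ)) (Ioc 0 1) :=
      (intervalIntegrable_iff_integrableOn_Ioc_of_le zero_le_one).1
        (intervalIntegral.intervalIntegrable_rpow' (by norm_num))
    refine Integrable.mono' h1 hm.aestronglyMeasurable
      ((ae_restrict_iff' measurableSet_Ioc).2 (ae_of_all _ fun k hk => ?_))
    have hk0 : 0 < k := hk.1
    rw [Real.norm_of_nonneg (by positivity)]
    refine mul_le_of_le_one_right (by positivity) (inv_le_one_of_one_le₀ ?_)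
    nlinarith [sq_nonneg k]
  · refine Integrable.mono' integrable_inv_one_add_sq.integrableOn hm.aestronglyMeasurable
      ((ae_restrict_iff' measurableSet_Ioi).2 (ae_of_all _ fun k hk => ?_))
    have hk0 : 1 < k := hk
    have hk1 : 0 < k := by linarith
    rw [Real.norm_of_nonneg (by positivity)]
    refine mul_le_of_le_one_left (by positivity) ?_
    exact Real.rpow_le_one_of_one_le_of_nonpos hk0.le (by norm_num)

lemma integrable_comp_abs {f : ℝ → ℝ} (hf : IntegrableOn f (Ioi 0)) :
    Integrable fun x => f |x| := by
  have h : IntegrableOn (fun x : ℝ => f |x|) (Ioi 0) :=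
    hf.congr_fun (fun x hx => by simp only [abs_of_pos (mem_Ioi.1 hx)]) measurableSet_Ioi
  have h2 := h.comp_neg
  simp only [abs_neg, Set.neg_Ioi, neg_zero] at h2
  rw [← integrableOn_univ, ← Iio_union_Ici (a := (0 : ℝ))]
  exact h2.union ((integrableOn_Ici_iff_integrableOn_Ioi (by simp)).2 h)

lemma integrable_abs_rpow_mul_inv :
    Integrable fun x : ℝ => |x| ^ (-(1 / 2) : ℝ) * (1 + x ^ 2)⁻¹ := by
  simpa only [sq_abs] using integrable_comp_abs integrableOn_rpow_mul_inv

lemma rpow_neg_half_mul_self {y : ℝ} (hy : 0 < y) : y ^ (-(1 / 2) : ℝ) * √y = 1 := by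
  rw [Real.rpow_neg hy.le, ← Real.sqrt_eq_rpow]
  exact inv_mul_cancel₀ (Real.sqrt_pos.2 hy).ne'

/-- Applied with `y = |x|` and `d = |k - x|`: it splits `1/|k - x|` between `|x|^(-1/2)` and
`k^(-1/2)`, both locally integrable. -/
lemma one_le_rpow_mul {y k d : ℝ} (hy : 0 < y) (hk : 0 < k) (hyd : y ≤ d) (hkd : k ≤ 2 * d) :
    1 ≤ 2 * y ^ (-(1 / 2) : ℝ) * k ^ (-(1 / 2) : ℝ) * d := by
  have h1 := rpow_neg_half_mul_self hy
  have h2 := rpow_neg_half_mul_self hk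
  have h3 : 0 ≤ y ^ (-(1 / 2) : ℝ) := by positivity
  have h4 : 0 ≤ k ^ (-(1 / 2) : ℝ) := by positivity
  have h5 : √y * √k ≤ 2 * d := by
    rw [← Real.sqrt_mul hy.le]
    refine Real.sqrt_le_iff.2 ⟨by linarith, ?_⟩
    nlinarith
  calc (1 : ℝ) = (y ^ (-(1 / 2) : ℝ) * √y) * (k ^ (-(1 / 2) : ℝ) * √k) := by rw [h1, h2, one_mul]
    _ = y ^ (-(1 / 2) : ℝ) * k ^ (-(1 / 2) : ℝ) * (√y * √k) := by ring
    _ ≤ y ^ (-(1 / 2) : ℝ) * k ^ (-(1 / 2) : ℝ) * (2 * d) := by gcongr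
    _ = _ := by ring

/-- `G'` does not vanish at `0+`, so its Cauchy transform is singular at the threshold. The cruder
power `|x|^(-1/2)` suffices, because it is integrable near `0`. -/
lemma exists_norm_cauchyTransform_derivRatG_le : ∃ K : ℝ, 0 ≤ K ∧ ∀ x ε : ℝ, x ≠ 0 → 0 < ε →
    ‖cauchyTransform derivRatG (x + ε * Complex.I)‖ ≤ K * (1 + |x| ^ (-(1 / 2) : ℝ)) := by
  set A : ℝ → ℝ := fun k => (1 + k ^ 2)⁻¹ with hA
  set B : ℝ → ℝ := fun k => k ^ (-(1 / 2) : ℝ) * (1 + k ^ 2)⁻¹ with hB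
  set a := ∫ k in Ioi (0 : ℝ), A k
  set b := ∫ k in Ioi (0 : ℝ), B k
  have hAi : IntegrableOn A (Ioi 0) := integrable_inv_one_add_sq.integrableOn
  have hBi : IntegrableOn B (Ioi 0) := integrableOn_rpow_mul_inv
  have ha : 0 ≤ a := setIntegral_nonneg measurableSet_Ioi fun k _ => by simp only [hA]; positivity
  have hb : 0 ≤ b := setIntegral_nonneg measurableSet_Ioi fun k hk => by
    have : (0 : ℝ) < k := hk
    simp only [hB]; positivity
  refine ⟨2 + a + 2 * b + Real.pi, by positivity, fun x ε hx hε => ?_⟩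
  set y := |x| ^ (-(1 / 2) : ℝ) with hy
  have hxp : 0 < |x| := abs_pos.2 hx
  have hy0 : 0 ≤ y := by positivity
  have hq0 : ∀ k : ℝ, 0 < k → 0 ≤ A k + 2 * y * B k := fun k hk => by
    simp only [hA, hB]; positivity
  have hqi : IntegrableOn (fun k => A k + 2 * y * B k) (Ioi 0) := hAi.add (hBi.const_mul _)
  have hqint : ∫ k in Ioi (0 : ℝ), (A k + 2 * y * B k) = a + 2 * y * b := by
    rw [integral_add hAi (hBi.const_mul _), integral_const_mul]
  have hfar : ∀ k : ℝ, 0 < k → |x| ≤ |k - x| → k ≤ 2 * |k - x| →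
      |derivRatG k| ≤ (A k + 2 * y * B k) * |k - x| := by
    intro k hk h1 h2
    have h3 := one_le_rpow_mul hxp hk h1 h2
    have hAk : 0 ≤ A k := by simp only [hA]; positivity
    calc |derivRatG k| ≤ A k := abs_derivRatG_le_inv k
      _ ≤ A k * (2 * y * k ^ (-(1 / 2) : ℝ) * |k - x|) := le_mul_of_one_le_right hAk h3
      _ = 2 * y * B k * |k - x| := by simp only [hA, hB]; ring
      _ ≤ _ := mul_le_mul_of_nonneg_right (by linarith) (abs_nonneg _)
  rcases lt_or_gt_of_ne hx with hx0 | hx0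
  · have h := norm_cauchyTransform_le (x := x) (ε := ε) (φ := derivRatG)
      (m := fun k => A k + 2 * y * B k) (fun k hk => hfar k hk ?_ ?_) hq0 hqi hε
    · rw [hqint] at h
      nlinarith [Real.pi_pos]
    · rw [abs_of_neg hx0, abs_of_pos (by linarith)]; linarith
    · rw [abs_of_pos (by linarith)]; linarith
  · have hG : Real.pi * |derivRatG x| ≤ Real.pi * 1 :=
      mul_le_mul_of_nonneg_left ((abs_derivRatG_le x).trans (by norm_num)) Real.pi_nonneg
    have h := norm_cauchyTransform_le_add (x := x) (δ := min x 1) (ε := ε) (L := 1)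
      (q := fun k => A k + 2 * y * B k) integrable_derivRatG.integrableOn
      (fun k _ => abs_derivRatG_sub_le k x) ?_ hq0 hqi zero_le_one
      (lt_min hx0 one_pos) (min_le_left _ _) hε
    · rw [hqint] at h
      have := min_le_right x 1
      nlinarith [Real.pi_pos]
    · intro k hk hkx
      rcases le_or_gt x 1 with hx1 | hx1
      · rw [min_eq_left hx1] at hkx
        have h2 := two_mul_le_of_le_abs hk hkx
        refine hfar k hk (by rwa [abs_of_pos hx0]) ?_
        rw [abs_of_pos (by linarith)]
        linarith
      · rw [min_eq_right hx1.le] at hkx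
        have hAk : 0 ≤ A k := by simp only [hA]; positivity
        have hBk : 0 ≤ B k := by simp only [hB]; positivity
        calc |derivRatG k| ≤ A k := abs_derivRatG_le_inv k
          _ ≤ A k * |k - x| := le_mul_of_one_le_right hAk hkx
          _ ≤ _ := mul_le_mul_of_nonneg_right (by nlinarith) (abs_nonneg _)

/-- The Poisson kernel is at least `1/(2ε)` on `[x, x + ε]`, an interval of length `ε`; the
resulting bound does not depend on `ε`. -/
lemma half_le_im_cauchyTransform_G {m : ℝ} (hx : 0 < x) (hε : 0 < ε) (hε1 : ε ≤ 1)
    (hm : ∀ k ∈ Icc x (x + 1), m ≤ G k) :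
    m / 2 ≤ (cauchyTransform G (x + ε * Complex.I)).im := by
  have him : ((x : ℂ) + ε * Complex.I).im = ε := by simp
  have hre : ((x : ℂ) + ε * Complex.I).re = x := by simp
  have hne : ((x : ℂ) + ε * Complex.I).im ≠ 0 := by rw [him]; exact hε.ne'
  rw [im_cauchyTransform integrableOn_G hne, him, hre]
  have hi : IntegrableOn (fun k => G k * (ε / ((k - x) ^ 2 + ε ^ 2))) (Ioi 0) := by
    have h := (integrableOn_div_sub integrableOn_G hne).im
    refine h.congr (ae_of_all _ fun k => ?_)
    change ((G k : ℂ) / (k - (x + ε * Complex.I))).im = _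
    rw [div_eq_mul_inv, Complex.im_ofReal_mul, im_inv_ofReal_sub, him, hre]
  have hsub : Icc x (x + ε) ⊆ Ioi 0 := fun k hk => lt_of_lt_of_le hx hk.1
  have hnn : ∀ k, 0 ≤ G k * (ε / ((k - x) ^ 2 + ε ^ 2)) := fun k =>
    mul_nonneg (G_nonneg k) (by positivity)
  calc m / 2 = ∫ k in Icc x (x + ε), m / (2 * ε) := by
        rw [setIntegral_const, Measure.real, Real.volume_Icc, ENNReal.toReal_ofReal (by linarith),
          smul_eq_mul]
        field_simp
        ring
    _ ≤ ∫ k in Icc x (x + ε), G k * (ε / ((k - x) ^ 2 + ε ^ 2)) := by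
        refine setIntegral_mono_on (by simp) (hi.mono_set hsub) measurableSet_Icc fun k hk => ?_
        have h1 : m ≤ G k := hm k ⟨hk.1, hk.2.trans (by linarith)⟩
        have h2 : 1 / (2 * ε) ≤ ε / ((k - x) ^ 2 + ε ^ 2) := by
          rw [div_le_div_iff₀ (by positivity) (by positivity)]
          nlinarith [hk.1, hk.2]
        calc m / (2 * ε) = m * (1 / (2 * ε)) := by ring
          _ ≤ _ := mul_le_mul h1 h2 (by positivity) (G_nonneg k)
    _ ≤ _ := setIntegral_mono_set hi (ae_of_all _ hnn) (Eventually.of_forall hsub)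

end SelfEnergy

/-! ### A uniform lower bound for the denominator -/

section LowerBound

variable {E₀ β : ℝ}

lemma re_denominator_line (E₀ β x ε : ℝ) : (denominator E₀ β (x + ε * Complex.I)).re
    = E₀ - x - β ^ 2 * (cauchyTransform G (x + ε * Complex.I)).re := by
  unfold denominator
  rw [Complex.sub_re, Complex.sub_re, ← Complex.ofReal_pow, Complex.re_ofReal_mul]
  simp

lemma im_denominator_line (E₀ β x ε : ℝ) : (denominator E₀ β (x + ε * Complex.I)).im
    = -ε - β ^ 2 * (cauchyTransform G (x + ε * Complex.I)).im := by
  unfold denominator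
  rw [Complex.sub_im, Complex.sub_im, ← Complex.ofReal_pow, Complex.im_ofReal_mul]
  simp

lemma integral_G_div_nonneg : 0 ≤ ∫ k in Ioi (0 : ℝ), G k / k :=
  setIntegral_nonneg measurableSet_Ioi fun k hk => G_div_nonneg k (le_of_lt hk)

/-- For `x ≤ 0` the real part of `F` is at least `E₀ - β² ∫ G/k + |x|`: the hypothesis is exactly
what excludes a zero at or below the threshold. -/
lemma exists_le_norm_denominator_of_nonpos (hE : β ^ 2 * (∫ k in Ioi (0 : ℝ), G k / k) < E₀) :
    ∃ c : ℝ, 0 < c ∧ ∀ x ε : ℝ, x ≤ 0 → 0 < ε →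
      c * (1 + |x|) ≤ ‖denominator E₀ β (x + ε * Complex.I)‖ := by
  set s := ∫ k in Ioi (0 : ℝ), G k / k
  refine ⟨min (E₀ - β ^ 2 * s) 1, lt_min (by linarith) one_pos, fun x ε hx hε => ?_⟩
  refine le_trans ?_ ((le_abs_self _).trans (Complex.abs_re_le_norm _))
  rw [re_denominator_line, abs_of_nonpos hx]
  have h1 := (le_abs_self _).trans
    ((Complex.abs_re_le_norm _).trans (norm_cauchyTransform_G_le_of_nonpos hx hε))
  have h2 := mul_le_mul_of_nonneg_left h1 (sq_nonneg β)
  have h3 := min_le_left (E₀ - β ^ 2 * s) 1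
  have h4 := min_le_right (E₀ - β ^ 2 * s) 1
  nlinarith

/-- Just above the threshold `G` is too small for `Im F` to help. For `x ≤ η²` the real part of the
Cauchy transform exceeds `∫ G/k` by at most `η`, and `η` is chosen so that this uses only part of
the gap `d`. -/
lemma exists_le_norm_denominator_of_small (hE : β ^ 2 * (∫ k in Ioi (0 : ℝ), G k / k) < E₀) :
    ∃ c η : ℝ, 0 < c ∧ 0 < η ∧ ∀ x ε : ℝ, 0 < x → x ≤ η → 0 < ε →
      c * (1 + |x|) ≤ ‖denominator E₀ β (x + ε * Complex.I)‖ := by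
  have hs0 := integral_G_div_nonneg
  have hs1 := integral_G_div_le
  set s := ∫ k in Ioi (0 : ℝ), G k / k
  set d := E₀ - β ^ 2 * s with hd
  have hd0 : 0 < d := by linarith
  set η := min (1 / 2) (d / (2 * (β ^ 2 + 1)))
  have hη0 : 0 < η := lt_min (by norm_num) (by positivity)
  have hη1 : η ≤ 1 / 2 := min_le_left _ _
  have hη2 : η * (2 * (β ^ 2 + 1)) ≤ d :=
    (le_div_iff₀ (by positivity)).1 (min_le_right _ _)
  refine ⟨d / 4, η ^ 2, by positivity, by positivity, fun x ε hx hxη hε => ?_⟩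
  refine le_trans ?_ ((le_abs_self _).trans (Complex.abs_re_le_norm _))
  rw [re_denominator_line, abs_of_pos hx]
  have hxη' : x ≤ η / 2 := by nlinarith
  have h1 := (le_abs_self _).trans (abs_re_cauchyTransform_G_le hx (c := η) (by linarith) hε)
  have h2 : x / (η - x) ≤ 2 * η := by
    rw [div_le_iff₀ (by linarith)]
    nlinarith
  have h3 : (cauchyTransform G (x + ε * Complex.I)).re ≤ s + η := by
    norm_num at hs1
    nlinarith
  have h4 := mul_le_mul_of_nonneg_left h3 (sq_nonneg β)
  nlinarith

/-- On a compact range above the threshold `G` has a positive minimum, so the imaginary part alone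
bounds `F` from below. This is where `β ≠ 0` enters. -/
lemma exists_le_norm_denominator_of_mid {η Λ : ℝ} (hη : 0 < η) (hβ : 0 < β) :
    ∃ c : ℝ, 0 < c ∧ ∀ x ε : ℝ, η ≤ x → x ≤ Λ → 0 < ε → ε ≤ 1 →
      c * (1 + |x|) ≤ ‖denominator E₀ β (x + ε * Complex.I)‖ := by
  rcases lt_or_ge Λ η with hΛ | hΛ
  · exact ⟨1, one_pos, fun x ε h1 h2 => absurd (h1.trans h2) (not_le.2 hΛ)⟩
  obtain ⟨k₀, hk₀, hmin⟩ := isCompact_Icc.exists_isMinOn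
    (nonempty_Icc.2 (show η ≤ Λ + 1 by linarith)) continuous_G.continuousOn
  have hm : 0 < G k₀ := G_pos (hη.trans_le hk₀.1)
  have hΛ0 : 0 < 1 + Λ := by linarith
  refine ⟨β ^ 2 * (G k₀ / 2) / (1 + Λ), by positivity, fun x ε h1 h2 hε hε1 => ?_⟩
  have h3 := half_le_im_cauchyTransform_G (m := G k₀) (hη.trans_le h1) hε hε1
    fun k hk => hmin ⟨h1.trans hk.1, hk.2.trans (by linarith)⟩
  refine le_trans ?_ ((neg_le_abs _).trans (Complex.abs_im_le_norm _))
  rw [im_denominator_line, abs_of_pos (hη.trans_le h1)]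
  have h4 := mul_le_mul_of_nonneg_left h3 (sq_nonneg β)
  calc β ^ 2 * (G k₀ / 2) / (1 + Λ) * (1 + x) ≤ β ^ 2 * (G k₀ / 2) / (1 + Λ) * (1 + Λ) := by
        gcongr
    _ = β ^ 2 * (G k₀ / 2) := div_mul_cancel₀ _ hΛ0.ne'
    _ ≤ _ := by linarith

lemma half_mul_le_norm_denominator {x ε : ℝ} (hE₀ : 0 < E₀) (hx : 2 * (E₀ + β ^ 2) + 1 ≤ x)
    (hε : 0 < ε) : 1 / 2 * (1 + |x|) ≤ ‖denominator E₀ β (x + ε * Complex.I)‖ := by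
  refine le_trans ?_ ((neg_le_abs _).trans (Complex.abs_re_le_norm _))
  rw [re_denominator_line, abs_of_nonneg (by nlinarith [sq_nonneg β])]
  have h1 := (neg_le_abs _).trans
    ((Complex.abs_re_le_norm _).trans (norm_cauchyTransform_G_le_one x hε))
  nlinarith [sq_nonneg β]

lemma exists_le_norm_denominator (hE₀ : 0 < E₀) (hβ : 0 < β)
    (hE : β ^ 2 * (∫ k in Ioi (0 : ℝ), G k / k) < E₀) :
    ∃ c : ℝ, 0 < c ∧ ∀ x ε : ℝ, 0 < ε → ε ≤ 1 →
      c * (1 + |x|) ≤ ‖denominator E₀ β (x + ε * Complex.I)‖ := by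
  obtain ⟨c₁, hc₁, h₁⟩ := exists_le_norm_denominator_of_nonpos hE
  obtain ⟨c₂, η, hc₂, hη, h₂⟩ := exists_le_norm_denominator_of_small hE
  obtain ⟨c₃, hc₃, h₃⟩ := exists_le_norm_denominator_of_mid (E₀ := E₀) (Λ := 2 * (E₀ + β ^ 2) + 1) hη hβ
  refine ⟨min (min c₁ c₂) (min c₃ (1 / 2)),
    lt_min (lt_min hc₁ hc₂) (lt_min hc₃ (by norm_num)), fun x ε hε hε1 => ?_⟩
  have key : ∀ c : ℝ, min (min c₁ c₂) (min c₃ (1 / 2)) ≤ c →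
      c * (1 + |x|) ≤ ‖denominator E₀ β (x + ε * Complex.I)‖ →
      min (min c₁ c₂) (min c₃ (1 / 2)) * (1 + |x|) ≤ ‖denominator E₀ β (x + ε * Complex.I)‖ :=
    fun c hc h => (mul_le_mul_of_nonneg_right hc (by positivity)).trans h
  rcases le_or_gt x 0 with hx | hx
  · exact key c₁ ((min_le_left _ _).trans (min_le_left _ _)) (h₁ x ε hx hε)
  rcases le_or_gt x η with hxη | hxη
  · exact key c₂ ((min_le_left _ _).trans (min_le_right _ _)) (h₂ x ε hx hxη hε)
  rcases le_or_gt x (2 * (E₀ + β ^ 2) + 1) with hxΛ | hxΛ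
  · exact key c₃ ((min_le_right _ _).trans (min_le_left _ _)) (h₃ x ε hxη.le hxΛ hε hε1)
  · exact key (1 / 2) ((min_le_right _ _).trans (min_le_right _ _))
      (half_mul_le_norm_denominator hE₀ hxΛ.le hε)

end LowerBound

/-! ### Boundary values of the resolvent -/

section Boundary

/-- The boundary value `F(x + i0)` of the denominator. -/
noncomputable def boundaryDenominator (E₀ β x : ℝ) : ℂ :=
  E₀ - x - β ^ 2 * (levelShift x + ((Real.pi * G x : ℝ) : ℂ) * Complex.I)

lemma re_boundaryDenominator (E₀ β x : ℝ) :
    (boundaryDenominator E₀ β x).re = E₀ - x - β ^ 2 * levelShift x := by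
  unfold boundaryDenominator
  rw [Complex.sub_re, Complex.sub_re, ← Complex.ofReal_pow, Complex.re_ofReal_mul, Complex.add_re,
    Complex.re_ofReal_mul]
  simp

lemma im_boundaryDenominator (E₀ β x : ℝ) :
    (boundaryDenominator E₀ β x).im = -(Real.pi * β ^ 2 * G x) := by
  unfold boundaryDenominator
  rw [Complex.sub_im, Complex.sub_im, ← Complex.ofReal_pow, Complex.im_ofReal_mul, Complex.add_im,
    Complex.im_ofReal_mul]
  simp
  ring

lemma tendsto_denominator (E₀ β x : ℝ) :
    Tendsto (fun ε : ℝ => denominator E₀ β (x + ε * Complex.I)) (𝓝[>] 0)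
      (𝓝 (boundaryDenominator E₀ β x)) := by
  unfold denominator boundaryDenominator
  refine Tendsto.sub ?_ ((tendsto_cauchyTransform_G x).const_mul _)
  have h : Continuous fun ε : ℝ => (E₀ : ℂ) - (x + ε * Complex.I) := by fun_prop
  have h1 := (h.tendsto 0).mono_left (nhdsWithin_le_nhds (s := Ioi 0))
  simpa using h1

/-- Shows that the spectral density is nonnegative, and links it to the integrand of the sojourn
time; the lifetime estimate rests on this identity. -/
lemma im_inv_boundaryDenominator (E₀ β x : ℝ) : ((boundaryDenominator E₀ β x)⁻¹).im
    = Real.pi * β ^ 2 * G x * ‖(boundaryDenominator E₀ β x)⁻¹‖ ^ 2 := by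
  rw [Complex.inv_im, im_boundaryDenominator, norm_inv, inv_pow, Complex.normSq_eq_norm_sq, neg_neg,
    div_eq_mul_inv]

lemma inv_sq_le {c y : ℝ} (hc : 0 < c) {w : ℂ} (h : c * (1 + |y|) ≤ ‖w‖) :
    (‖w‖ ^ 2)⁻¹ ≤ (c ^ 2)⁻¹ * (1 + y ^ 2)⁻¹ := by
  rw [← mul_inv]
  refine inv_anti₀ (by positivity) ?_
  calc c ^ 2 * (1 + y ^ 2) ≤ (c * (1 + |y|)) ^ 2 := by
        rw [mul_pow]
        refine mul_le_mul_of_nonneg_left ?_ (sq_nonneg c)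
        nlinarith [abs_nonneg y, sq_abs y]
    _ ≤ _ := pow_le_pow_left₀ (by positivity) h 2

lemma hasDerivAt_denominator (E₀ β : ℝ) {z : ℂ} (hz : 0 < z.im) :
    HasDerivAt (denominator E₀ β) (-1 - β ^ 2 * cauchyTransform derivRatG z) z := by
  have h := ((hasDerivAt_const z (E₀ : ℂ)).sub (hasDerivAt_id z)).sub
    ((hasDerivAt_cauchyTransform_G hz).const_mul ((β : ℂ) ^ 2))
  exact h.congr_deriv (by ring)

theorem exists_isResolventAmplitude {E₀ β : ℝ} (hE₀ : 0 < E₀) (hβ : 0 < β)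
    (hE : β ^ 2 * (∫ k in Ioi (0 : ℝ), G k / k) < E₀) {U : ℝ → Space ≃ₗᵢ[ℂ] Space}
    (hU : IsUnitaryGroupOf (hamiltonian E₀ β) U) :
    ∃ (C : ℝ) (Ψ : ℝ → ℝ), IsResolventAmplitude (returnAmplitude U Φ₁)
      (fun z => (denominator E₀ β z)⁻¹)
      (fun z => -(-1 - β ^ 2 * cauchyTransform derivRatG z) / denominator E₀ β z ^ 2)
      (fun x => (boundaryDenominator E₀ β x)⁻¹) C Ψ := by
  obtain ⟨c, hc, hF⟩ := exists_le_norm_denominator hE₀ hβ hE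
  obtain ⟨K, hK, hd⟩ := exists_norm_cauchyTransform_derivRatG_le
  -- From `|F|⁻² ≤ c⁻²/(1 + x²)`: the factor `1 + β²` bounds `|Im F|` for `ε ≤ 1`, and `Ψ` bounds
  -- `|F'|/|F|²`, with the threshold singularity of `F'` in its second term.
  refine ⟨(1 + β ^ 2) * (c ^ 2)⁻¹,
    fun x => (c ^ 2)⁻¹ * ((1 + β ^ 2 * K) * (1 + x ^ 2)⁻¹
      + β ^ 2 * K * (|x| ^ (-(1 / 2) : ℝ) * (1 + x ^ 2)⁻¹)), ?_⟩
  constructor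
  · exact hU.continuous_returnAmplitude Φ₁
  · intro t
    have := IsUnitaryGroupOf.norm_returnAmplitude_le (U := U) Φ₁ t
    rwa [norm_Φ₁, one_pow] at this
  · exact hU.returnAmplitude_neg Φ₁
  · exact fun z hz => integral_exp_mul_returnAmplitude hU hz
  · intro x ε hε hε1
    rw [norm_inv, inv_pow]
    refine (inv_sq_le hc (hF x ε hε hε1)).trans ?_
    have : 0 < (c ^ 2)⁻¹ * (1 + x ^ 2)⁻¹ := by positivity
    nlinarith [sq_nonneg β]
  · intro x ε hε hε1
    have h1 : |(denominator E₀ β (x + ε * Complex.I)).im| ≤ 1 + β ^ 2 := by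
      rw [im_denominator_line]
      have h := (Complex.abs_im_le_norm _).trans (norm_cauchyTransform_G_le_one x hε)
      have h2 := abs_le.1 h
      rw [abs_le]
      constructor <;> nlinarith [sq_nonneg β]
    rw [Complex.inv_im, Complex.normSq_eq_norm_sq, abs_div, abs_neg, abs_of_nonneg (sq_nonneg ‖_‖),
      div_eq_mul_inv, mul_assoc]
    exact mul_le_mul h1 (inv_sq_le hc (hF x ε hε hε1)) (by positivity) (by positivity)
  · intro z hz
    exact (hasDerivAt_denominator E₀ β hz).fun_inv (denominator_ne_zero E₀ β hz.ne')
  · intro x ε hx hε hε1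
    rw [norm_div, norm_neg, norm_pow, div_eq_mul_inv]
    have h1 : ‖-1 - (β : ℂ) ^ 2 * cauchyTransform derivRatG (x + ε * Complex.I)‖
        ≤ 1 + β ^ 2 * (K * (1 + |x| ^ (-(1 / 2) : ℝ))) := by
      refine (norm_sub_le _ _).trans ?_
      rw [norm_neg, norm_one, norm_mul, norm_pow, Complex.norm_real, Real.norm_eq_abs, sq_abs]
      gcongr
      exact hd x ε hx hε
    refine (mul_le_mul h1 (inv_sq_le hc (hF x ε hε hε1)) (by positivity) (by positivity)).trans
      (le_of_eq (by ring))
  · exact ((integrable_inv_one_add_sq.const_mul _).add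
      (integrable_abs_rpow_mul_inv.const_mul _)).const_mul _
  · refine ae_of_all _ fun x => (tendsto_denominator E₀ β x).inv₀ ?_
    have h1 : c * (1 + |x|) ≤ ‖boundaryDenominator E₀ β x‖ := by
      refine ge_of_tendsto (tendsto_denominator E₀ β x).norm ?_
      filter_upwards [IsResolventAmplitude.eventually_mem_Ioc] with ε hε using hF x ε hε.1 hε.2
    exact norm_pos_iff.1 (lt_of_lt_of_le (by positivity) h1)

end Boundary

/-! ### The variance of the spectral density without the spectral theorem -/

section Variance

variable {E : Type*} [NormedAddCommGroup E] [InnerProductSpace ℂ E]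
  {H : E →ₗ.[ℂ] E} {U : ℝ → E ≃ₗᵢ[ℂ] E} {ψ φ : E} {ρ : ℝ → ℝ}

lemma norm_sub_exp_smul_sq (hψ : ‖ψ‖ = 1) (t μ : ℝ) :
    ‖U t ψ - Complex.exp (((-t * μ : ℝ) : ℂ) * Complex.I) • ψ‖ ^ 2
      = 2 * (1 - (Complex.exp (((t * μ : ℝ) : ℂ) * Complex.I) * returnAmplitude U ψ t).re) := by
  have h : ⟪U t ψ, Complex.exp (((-t * μ : ℝ) : ℂ) * Complex.I) • ψ⟫_ℂ
      = starRingEnd ℂ (Complex.exp (((t * μ : ℝ) : ℂ) * Complex.I) * returnAmplitude U ψ t) := by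
    rw [inner_smul_right, map_mul, returnAmplitude, inner_conj_symm, ← Complex.exp_conj, map_mul,
      Complex.conj_ofReal, Complex.conj_I]
    congr 2
    push_cast
    ring
  rw [@norm_sub_sq ℂ, h, LinearIsometryEquiv.norm_map, norm_smul, Complex.norm_exp_ofReal_mul_I, hψ,
    RCLike.re_to_complex, Complex.conj_re]
  ring

lemma integrable_exp_mul (hρ : Integrable ρ) (t : ℝ) :
    Integrable fun x : ℝ => Complex.exp (((-t * x : ℝ) : ℂ) * Complex.I) * (ρ x : ℂ) := by
  refine hρ.ofReal.bdd_mul (c := 1) (Continuous.aestronglyMeasurable (by fun_prop))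
    (ae_of_all _ fun x => ?_)
  rw [Complex.norm_exp_ofReal_mul_I]

lemma two_mul_one_sub_cos (t u : ℝ) :
    2 * (1 - Real.cos (t * u)) = t ^ 2 * (u ^ 2 * Real.sinc (t * u / 2) ^ 2) := by
  have h1 : Real.cos (t * u) = 1 - 2 * Real.sin (t * u / 2) ^ 2 := by
    rw [← Real.cos_sq_add_sin_sq (t * u / 2), ← sub_eq_zero]
    have := Real.cos_two_mul (t * u / 2)
    rw [show 2 * (t * u / 2) = t * u by ring] at this
    rw [this]
    nlinarith [Real.cos_sq_add_sin_sq (t * u / 2)]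
  have h2 : Real.sin (t * u / 2) = t * u / 2 * Real.sinc (t * u / 2) := by
    rcases eq_or_ne (t * u / 2) 0 with h | h
    · rw [h]; simp
    · rw [Real.sinc_of_ne_zero h, mul_div_cancel₀ _ h]
  rw [h1, h2]
  ring

/-- Written through the density, the square is `∫ ρ · 2(1 - cos t(x - μ))`; the `sinc` form isolates
the factor `t²` and a regularized second moment. -/
lemma norm_sub_exp_smul_sq_eq_integral (hψ : ‖ψ‖ = 1) (hρ : Integrable ρ) (h1 : ∫ x, ρ x = 1)
    (hR : ∀ t, returnAmplitude U ψ t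
      = ∫ x, Complex.exp (((-t * x : ℝ) : ℂ) * Complex.I) * (ρ x : ℂ)) (t μ : ℝ) :
    ‖U t ψ - Complex.exp (((-t * μ : ℝ) : ℂ) * Complex.I) • ψ‖ ^ 2
      = t ^ 2 * ∫ x, ρ x * (x - μ) ^ 2 * Real.sinc (t * (x - μ) / 2) ^ 2 := by
  have hcos : Integrable fun x => Real.cos (t * (x - μ)) * ρ x := by
    refine hρ.bdd_mul (c := 1) (Continuous.aestronglyMeasurable (by fun_prop))
      (ae_of_all _ fun x => Real.abs_cos_le_one _)
  rw [norm_sub_exp_smul_sq hψ, hR, ← integral_const_mul, ← RCLike.re_to_complex,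
    ← integral_re ((integrable_exp_mul hρ t).const_mul _), ← integral_const_mul]
  have h2 : ∀ x : ℝ, RCLike.re (Complex.exp (((t * μ : ℝ) : ℂ) * Complex.I)
      * (Complex.exp (((-t * x : ℝ) : ℂ) * Complex.I) * (ρ x : ℂ)))
      = Real.cos (t * (x - μ)) * ρ x := by
    intro x
    rw [← mul_assoc, ← Complex.exp_add, ← add_mul, ← Complex.ofReal_add, RCLike.re_to_complex,
      Complex.re_mul_ofReal, Complex.exp_ofReal_mul_I_re, ← Real.cos_neg]
    congr 2
    ring
  simp only [h2]
  rw [← h1, ← integral_sub hρ hcos, ← integral_const_mul]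
  refine integral_congr_ae (ae_of_all _ fun x => ?_)
  have h3 := two_mul_one_sub_cos t (x - μ)
  simp only
  linear_combination ρ x * h3

/-- The same quotient evaluated from the generator: `U t ψ - exp(-itμ) ψ` has derivative `-i(φ -
μψ)` at `0`. -/
lemma tendsto_norm_sub_exp_smul (hU : IsUnitaryGroupOf H U) (h : (ψ, φ) ∈ H.graph) (μ : ℝ) :
    Tendsto (fun t : ℝ => (t ^ 2)⁻¹ *
      ‖U t ψ - Complex.exp (((-t * μ : ℝ) : ℂ) * Complex.I) • ψ‖ ^ 2) (𝓝[≠] 0)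
      (𝓝 (‖φ - (μ : ℂ) • ψ‖ ^ 2)) := by
  have h1 := (hU.generator ψ φ).1 h
  have h2 : HasDerivAt (fun t : ℝ => Complex.exp (((-t * μ : ℝ) : ℂ) * Complex.I))
      (-(μ * Complex.I)) 0 := by
    have h3 : HasDerivAt (fun t : ℝ => ((-t * μ : ℝ) : ℂ) * Complex.I)
        (((-1 * μ : ℝ) : ℂ) * Complex.I) 0 :=
      ((((hasDerivAt_id (0 : ℝ)).neg).mul_const μ).ofReal_comp).mul_const _
    exact h3.cexp.congr_deriv (by simp)
  have h4 := (h1.sub (h2.smul_const ψ)).tendsto_slope.norm.pow 2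
  have h5 : ‖-(Complex.I • φ) - -(↑μ * Complex.I) • ψ‖ = ‖φ - (μ : ℂ) • ψ‖ := by
    have : -(Complex.I • φ) - -((μ : ℂ) * Complex.I) • ψ = -Complex.I • (φ - (μ : ℂ) • ψ) := by
      rw [smul_sub, smul_smul, neg_smul, neg_smul, neg_mul, neg_smul, mul_comm]
    rw [this, norm_smul, norm_neg, Complex.norm_I, one_mul]
  rw [h5] at h4
  refine h4.congr fun t => ?_
  rw [slope_def_module]
  simp only [Pi.sub_apply, sub_zero, neg_zero, zero_mul, Complex.ofReal_zero, Complex.exp_zero,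
    one_smul, hU.map_zero, sub_self, norm_smul, mul_pow]
  rw [norm_inv, inv_pow, Real.norm_eq_abs, sq_abs]

/-- The spectral variance is bounded by `‖(H - μ) ψ‖²`. -/
theorem variance_le (hU : IsUnitaryGroupOf H U) (h : (ψ, φ) ∈ H.graph) (hψ : ‖ψ‖ = 1)
    (hρ : Integrable ρ) (hρ0 : ∀ x, 0 ≤ ρ x) (h1 : ∫ x, ρ x = 1)
    (hR : ∀ t, returnAmplitude U ψ t
      = ∫ x, Complex.exp (((-t * x : ℝ) : ℂ) * Complex.I) * (ρ x : ℂ)) (μ : ℝ) :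
    Integrable (fun x => ρ x * (x - μ) ^ 2) ∧
      ∫ x, ρ x * (x - μ) ^ 2 ≤ ‖φ - (μ : ℂ) • ψ‖ ^ 2 := by
  set V := ‖φ - (μ : ℂ) • ψ‖ ^ 2
  set s : ℕ → ℝ := fun n => 1 / ((n : ℝ) + 1)
  have hs0 : ∀ n, 0 < s n := fun n => by positivity
  have hs : Tendsto s atTop (𝓝 0) := tendsto_one_div_add_atTop_nhds_zero_nat
  have hs' : Tendsto s atTop (𝓝[≠] 0) :=
    tendsto_nhdsWithin_iff.2 ⟨hs, Eventually.of_forall fun n => (hs0 n).ne'⟩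
  set f : ℕ → ℝ → ℝ := fun n x => ρ x * (x - μ) ^ 2 * Real.sinc (s n * (x - μ) / 2) ^ 2
  have hf0 : ∀ n x, 0 ≤ f n x := fun n x =>
    mul_nonneg (mul_nonneg (hρ0 x) (sq_nonneg _)) (sq_nonneg _)
  have hm : AEStronglyMeasurable (fun x => ρ x * (x - μ) ^ 2) :=
    hρ.aestronglyMeasurable.mul (Continuous.aestronglyMeasurable (by fun_prop))
  have hfm : ∀ n, AEStronglyMeasurable (f n) := fun n => by
    have := Real.continuous_sinc
    exact hm.mul (Continuous.aestronglyMeasurable (by fun_prop))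
  have hfi : ∀ n, Integrable (f n) := by
    intro n
    refine (hρ.const_mul (4 * (s n ^ 2)⁻¹)).mono' (hfm n) (ae_of_all _ fun x => ?_)
    rw [Real.norm_of_nonneg (hf0 n x)]
    have h3 := two_mul_one_sub_cos (s n) (x - μ)
    have h4 := Real.neg_one_le_cos (s n * (x - μ))
    have h5 : (x - μ) ^ 2 * Real.sinc (s n * (x - μ) / 2) ^ 2 ≤ 4 * (s n ^ 2)⁻¹ := by
      rw [← div_eq_mul_inv, le_div_iff₀ (pow_pos (hs0 n) 2)]
      linarith
    calc f n x = ρ x * ((x - μ) ^ 2 * Real.sinc (s n * (x - μ) / 2) ^ 2) := mul_assoc _ _ _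
      _ ≤ ρ x * (4 * (s n ^ 2)⁻¹) := mul_le_mul_of_nonneg_left h5 (hρ0 x)
      _ = _ := mul_comm _ _
  have hint : Tendsto (fun n => ∫ x, f n x) atTop (𝓝 V) := by
    refine ((tendsto_norm_sub_exp_smul hU h μ).comp hs').congr fun n => ?_
    simp only [Function.comp_apply]
    rw [norm_sub_exp_smul_sq_eq_integral hψ hρ h1 hR, ← mul_assoc,
      inv_mul_cancel₀ (pow_ne_zero 2 (hs0 n).ne'), one_mul]
  have hlim : ∀ x, Tendsto (fun n => f n x) atTop (𝓝 (ρ x * (x - μ) ^ 2)) := by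
    intro x
    have hc : Continuous fun t : ℝ => ρ x * (x - μ) ^ 2 * Real.sinc (t * (x - μ) / 2) ^ 2 := by
      have := Real.continuous_sinc
      fun_prop
    have := (hc.tendsto 0).comp hs
    simpa [Function.comp_def] using this
  -- Fatou's lemma as the `sinc` factors tend to `1`: it yields finiteness and the one-sided bound,
  -- which is all that is needed.
  have hl : ∫⁻ x, ENNReal.ofReal (ρ x * (x - μ) ^ 2) ≤ ENNReal.ofReal V := by
    calc ∫⁻ x, ENNReal.ofReal (ρ x * (x - μ) ^ 2)
        = ∫⁻ x, liminf (fun n => ENNReal.ofReal (f n x)) atTop :=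
          lintegral_congr fun x => ((ENNReal.tendsto_ofReal (hlim x)).liminf_eq).symm
      _ ≤ liminf (fun n => ∫⁻ x, ENNReal.ofReal (f n x)) atTop :=
          lintegral_liminf_le' fun n => (hfm n).aemeasurable.ennreal_ofReal
      _ = ENNReal.ofReal V := by
          refine (Tendsto.liminf_eq ?_)
          refine (ENNReal.tendsto_ofReal hint).congr fun n => ?_
          rw [ofReal_integral_eq_lintegral_ofReal (hfi n) (ae_of_all _ (hf0 n))]
  have hnn : ∀ x, 0 ≤ ρ x * (x - μ) ^ 2 := fun x => mul_nonneg (hρ0 x) (sq_nonneg _)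
  have hI : Integrable (fun x => ρ x * (x - μ) ^ 2) := by
    refine ⟨hm, ?_⟩
    rw [hasFiniteIntegral_iff_ofReal (ae_of_all _ hnn)]
    exact hl.trans_lt ENNReal.ofReal_lt_top
  refine ⟨hI, ?_⟩
  rw [← ofReal_integral_eq_lintegral_ofReal hI (ae_of_all _ hnn)] at hl
  exact (ENNReal.ofReal_le_ofReal_iff (sq_nonneg _)).1 hl

end Variance

/-! ### The variational inequality for densities -/

section Parabola

lemma integral_parabola_sq {L : ℝ} (hL : 0 < L) (μ c : ℝ) :
    ∫ x in (μ - L)..(μ + L), (c * (1 - (x - μ) ^ 2 / L ^ 2)) ^ 2 = c ^ 2 * L * (16 / 15) := by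
  have hd : ∀ x : ℝ, HasDerivAt (fun x : ℝ => c ^ 2 * ((x - μ) - 2 * (x - μ) ^ 3 / (3 * L ^ 2)
      + (x - μ) ^ 5 / (5 * L ^ 4))) ((c * (1 - (x - μ) ^ 2 / L ^ 2)) ^ 2) x := by
    intro x
    have h0 := (hasDerivAt_id x).sub_const μ
    have h1 := (((h0.sub (((h0.pow 3).const_mul 2).div_const (3 * L ^ 2))).add
      ((h0.pow 5).div_const (5 * L ^ 4))).const_mul (c ^ 2))
    refine h1.congr_deriv ?_
    simp only [id]
    field_simp
    push_cast
    ring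
  rw [intervalIntegral.integral_eq_sub_of_hasDerivAt (fun x _ => hd x)
    (Continuous.intervalIntegrable (by fun_prop) _ _)]
  field_simp
  ring

/-- Among densities of given variance the parabola minimizes the integral of the square. -/
theorem le_mul_integral_sq {ρ : ℝ → ℝ} {μ σ : ℝ} (hσ : 0 < σ) (hρ : Integrable ρ)
    (hρ0 : ∀ x, 0 ≤ ρ x) (h1 : ∫ x, ρ x = 1) (hρ2 : Integrable fun x => ρ x ^ 2)
    (hv : Integrable fun x => ρ x * (x - μ) ^ 2) (hvσ : ∫ x, ρ x * (x - μ) ^ 2 ≤ σ ^ 2) :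
    3 * √5 / 25 ≤ (∫ x, ρ x ^ 2) * σ := by
  have h5 : √5 ^ 2 = 5 := Real.sq_sqrt (by norm_num)
  have h50 : 0 < √5 := Real.sqrt_pos.2 (by norm_num)
  -- With this `L` and `c = 3/(4L)`, the truncated parabola `c (1 - (x - μ)²/L²)₊` has mass `1` and
  -- variance `L²/5 = σ²`.
  set L := √5 * σ with hL
  have hL0 : 0 < L := by positivity
  have hL2 : L ^ 2 = 5 * σ ^ 2 := by rw [hL, mul_pow, h5]
  set c := 3 / (4 * L) with hc
  have hc0 : 0 < c := by positivity
  set p : ℝ → ℝ := (Ioc (μ - L) (μ + L)).indicator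
    fun x => (c * (1 - (x - μ) ^ 2 / L ^ 2)) ^ 2 with hp
  have hpi : Integrable p :=
    (integrable_indicator_iff measurableSet_Ioc).2 ((Continuous.integrableOn_Icc
      (by fun_prop)).mono_set Ioc_subset_Icc_self)
  have hpint : ∫ x, p x = c ^ 2 * L * (16 / 15) := by
    rw [hp, integral_indicator measurableSet_Ioc, ← integral_parabola_sq hL0 μ c,
      intervalIntegral.integral_of_le (by linarith)]
  -- Inside the window this is `2ρq ≤ ρ² + q²` for the parabola `q`. Outside, `q ≤ 0` and `ρ ≥ 0`,
  -- so the untruncated `q` may stay in the linear term, which makes its integral depend only on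
  -- mass and variance.
  have hpt : ∀ x, 2 * c * ρ x - 2 * c / L ^ 2 * (ρ x * (x - μ) ^ 2) - p x ≤ ρ x ^ 2 := by
    intro x
    have hx : 2 * c * ρ x - 2 * c / L ^ 2 * (ρ x * (x - μ) ^ 2)
        = 2 * ρ x * (c * (1 - (x - μ) ^ 2 / L ^ 2)) := by ring
    rw [hx]
    by_cases hxm : x ∈ Ioc (μ - L) (μ + L)
    · rw [hp, indicator_of_mem hxm]
      nlinarith [sq_nonneg (ρ x - c * (1 - (x - μ) ^ 2 / L ^ 2))]
    · rw [hp, indicator_of_notMem hxm, sub_zero]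
      have hx2 : L ^ 2 ≤ (x - μ) ^ 2 := by
        rw [mem_Ioc, not_and_or, not_lt, not_le] at hxm
        rcases hxm with h | h <;> nlinarith
      have h2 : 1 - (x - μ) ^ 2 / L ^ 2 ≤ 0 := by
        rw [sub_nonpos, one_le_div (by positivity)]
        exact hx2
      have h3 : ρ x * (c * (1 - (x - μ) ^ 2 / L ^ 2)) ≤ 0 :=
        mul_nonpos_of_nonneg_of_nonpos (hρ0 x) (mul_nonpos_of_nonneg_of_nonpos hc0.le h2)
      nlinarith [sq_nonneg (ρ x)]
  have hi1 := hρ.const_mul (2 * c)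
  have hi2 := hv.const_mul (2 * c / L ^ 2)
  have hmono := integral_mono ((hi1.sub hi2).sub hpi) hρ2 hpt
  rw [integral_sub' (hi1.sub hi2) hpi, integral_sub' hi1 hi2, integral_const_mul,
    integral_const_mul, h1, hpint] at hmono
  have h6 : 2 * c / L ^ 2 * ∫ x, ρ x * (x - μ) ^ 2 ≤ 2 * c / 5 := by
    calc 2 * c / L ^ 2 * ∫ x, ρ x * (x - μ) ^ 2 ≤ 2 * c / L ^ 2 * σ ^ 2 := by gcongr
      _ = 2 * c / 5 := by rw [hL2]; field_simp
  have h7 : c ^ 2 * L * (16 / 15) = 4 / 5 * c := by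
    rw [hc]; field_simp; norm_num
  have h8 : 4 / 5 * c * σ = 3 * √5 / 25 := by
    rw [hc, hL]
    field_simp
    rw [h5]
    norm_num
  have h9 : 4 / 5 * c ≤ ∫ x, ρ x ^ 2 := by linarith
  calc 3 * √5 / 25 = 4 / 5 * c * σ := h8.symm
    _ ≤ _ := mul_le_mul_of_nonneg_right h9 hσ.le

end Parabola

/-! ### Average lifetime and vanishing of `t Q(t)` -/

section Decay

/-- Integration by parts: for a decaying `Q`, the average lifetime is the integral of `Q`. -/
lemma tendsto_neg_integral_mul_deriv {Q : ℝ → ℝ} (hQ : ContDiff ℝ 1 Q)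
    (hi : IntegrableOn Q (Ioi 0)) (h0 : Tendsto (fun t => t * Q t) atTop (𝓝 0)) :
    Tendsto (fun T : ℝ => -∫ t in (0 : ℝ)..T, t * deriv Q t) atTop (𝓝 (∫ t in Ioi (0 : ℝ), Q t)) := by
  have h1 : ∀ T : ℝ, -∫ t in (0 : ℝ)..T, t * deriv Q t = (∫ t in (0 : ℝ)..T, Q t) - T * Q T := by
    intro T
    rw [intervalIntegral.integral_mul_deriv_eq_deriv_mul (u := fun t => t) (u' := fun _ => 1)
      (fun x _ => hasDerivAt_id x)
      (fun x _ => (hQ.differentiable one_ne_zero x).hasDerivAt)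
      intervalIntegrable_const ((hQ.continuous_deriv le_rfl).intervalIntegrable _ _)]
    simp
  simp only [h1]
  simpa using (intervalIntegral_tendsto_integral_Ioi 0 hi tendsto_id).sub h0

variable {R : ℝ → ℂ} {h h' : ℂ → ℂ} {h₀ : ℝ → ℂ} {C : ℝ} {Ψ : ℝ → ℝ}

lemma IsResolventAmplitude.tendsto_mul_norm_sq (H : IsResolventAmplitude R h h' h₀ C Ψ) :
    Tendsto (fun t => t * ‖R t‖ ^ 2) atTop (𝓝 0) := by
  set K := (2 * Real.pi)⁻¹ * ∫ x, Ψ x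
  have h1 : Tendsto (fun t : ℝ => K ^ 2 * t⁻¹) atTop (𝓝 0) := by
    simpa using tendsto_inv_atTop_zero.const_mul (K ^ 2)
  refine squeeze_zero' ?_ ?_ h1
  · filter_upwards [eventually_gt_atTop 0] with t ht using by positivity
  · filter_upwards [eventually_gt_atTop 0] with t ht
    have h2 := pow_le_pow_left₀ (by positivity) (H.mul_norm_le ht) 2
    rw [← div_eq_mul_inv, le_div_iff₀ ht]
    calc t * ‖R t‖ ^ 2 * t = (t * ‖R t‖) ^ 2 := by ring
      _ ≤ K ^ 2 := h2

end Decay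

/-! ### Decay and the time–energy uncertainty bound -/

section Qualitative

variable {E₀ β : ℝ} {U : ℝ → Space ≃ₗᵢ[ℂ] Space}

lemma returnAmplitude_Φ₁_zero (hU : IsUnitaryGroupOf (hamiltonian E₀ β) U) :
    returnAmplitude U Φ₁ 0 = 1 := by
  unfold returnAmplitude
  rw [hU.map_zero, inner_self_eq_ofReal, norm_Φ₁]
  simp

lemma norm_hamiltonian_Φ₁_sub_sq (E₀ β : ℝ) :
    ‖hamiltonian E₀ β ⟨Φ₁, Φ₁_mem_domain E₀ β⟩ - (E₀ : ℂ) • Φ₁‖ ^ 2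
      = β ^ 2 * ∫ k in Ioi (0 : ℝ), G k := by
  have h : hamiltonian E₀ β ⟨Φ₁, Φ₁_mem_domain E₀ β⟩ - (E₀ : ℂ) • Φ₁
      = WithLp.toLp 2 ((0 : ℂ), (β : ℂ) • couplingVec) := by
    rw [hamiltonian_Φ₁]
    refine WithLp.ofLp_injective 2 (Prod.ext ?_ ?_)
    · change (E₀ : ℂ) - E₀ * 1 = 0
      ring
    · change (β : ℂ) • couplingVec - (E₀ : ℂ) • (0 : Photon) = (β : ℂ) • couplingVec
      rw [smul_zero, sub_zero]
  rw [h, WithLp.prod_norm_sq_eq_of_L2]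
  simp only [WithLp.toLp_fst, WithLp.toLp_snd, norm_smul, mul_pow, norm_couplingVec_sq]
  simp

/-- The density `Im(1/F)/π` has mass `1`, as `R(0) = 1`; its variance about the mean energy `E₀` is
at most `ΔE²`, and `τ = π ∫ ρ²`. The parabola inequality then gives the constant. -/
lemma le_sojournTime_mul_energyUncertainty (hE₀ : 0 < E₀) (hβ : 0 < β)
    (hE : β ^ 2 * (∫ k in Ioi (0 : ℝ), G k / k) < E₀)
    (hU : IsUnitaryGroupOf (hamiltonian E₀ β) U) (hΦ : Φ₁ ∈ (hamiltonian E₀ β).domain) :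
    3 * Real.pi * √5 / 25
      ≤ sojournTime U Φ₁ * energyUncertainty (hamiltonian E₀ β) ⟨Φ₁, hΦ⟩ := by
  obtain ⟨C, Ψ, H⟩ := exists_isResolventAmplitude hE₀ hβ hE hU
  set h₀ : ℝ → ℂ := fun x => (boundaryDenominator E₀ β x)⁻¹ with hh₀
  set ρ : ℝ → ℝ := fun x => Real.pi⁻¹ * (h₀ x).im with hρdef
  have hpi := Real.pi_pos
  have hρ : Integrable ρ := H.integrable_im_boundary.const_mul _
  have hρ0 : ∀ x, 0 ≤ ρ x := fun x => by
    have := G_nonneg x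
    simp only [hρdef, hh₀, im_inv_boundaryDenominator]
    positivity
  have h1 : ∫ x, ρ x = 1 := by
    rw [integral_const_mul, H.integral_im_boundary (returnAmplitude_Φ₁_zero hU),
      inv_mul_cancel₀ hpi.ne']
  have hR : ∀ t, returnAmplitude U Φ₁ t
      = ∫ x, Complex.exp (((-t * x : ℝ) : ℂ) * Complex.I) * (ρ x : ℂ) := by
    intro t
    rw [H.eq_integral t, ← integral_smul]
    refine integral_congr_ae (ae_of_all _ fun x => ?_)
    simp only [hρdef, Complex.real_smul]
    push_cast
    ring
  have hρ2 : Integrable fun x => ρ x ^ 2 := by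
    refine (H.integrable_norm_sq_boundary.const_mul (Real.pi⁻¹ ^ 2)).mono'
      (hρ.aestronglyMeasurable.pow 2) (ae_of_all _ fun x => ?_)
    rw [Real.norm_of_nonneg (sq_nonneg _), mul_pow]
    refine mul_le_mul_of_nonneg_left ?_ (by positivity)
    rw [← sq_abs]
    exact pow_le_pow_left₀ (abs_nonneg _) (Complex.abs_im_le_norm _) 2
  obtain ⟨hv, hvle⟩ := variance_le hU ((hamiltonian E₀ β).mem_graph ⟨Φ₁, Φ₁_mem_domain E₀ β⟩)
    norm_Φ₁ hρ hρ0 h1 hR E₀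
  rw [norm_hamiltonian_Φ₁_sub_sq] at hvle
  have hV : 0 < β ^ 2 * ∫ k in Ioi (0 : ℝ), G k := by rw [integral_G]; positivity
  rw [energyUncertainty_Φ₁]
  set σ := √(β ^ 2 * ∫ k in Ioi (0 : ℝ), G k) with hσ
  have hσ2 : σ ^ 2 = β ^ 2 * ∫ k in Ioi (0 : ℝ), G k := Real.sq_sqrt hV.le
  have hmain := le_mul_integral_sq (Real.sqrt_pos.2 hV) hρ hρ0 h1 hρ2 hv (hvle.trans hσ2.ge)
  have hτ : sojournTime U Φ₁ = Real.pi * ∫ x, ρ x ^ 2 := by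
    change ∫ t in Ioi (0 : ℝ), ‖returnAmplitude U Φ₁ t‖ ^ 2 = _
    rw [H.integral_norm_sq_eq_im]
    simp only [hρdef, mul_pow]
    rw [integral_const_mul]
    field_simp
  rw [hτ]
  calc 3 * Real.pi * √5 / 25 = Real.pi * (3 * √5 / 25) := by ring
    _ ≤ Real.pi * ((∫ x, ρ x ^ 2) * σ) := mul_le_mul_of_nonneg_left hmain hpi.le
    _ = _ := (mul_assoc _ _ _).symm

theorem decay_and_uncertainty (hE₀ : 0 < E₀) (hβ : 0 < β)
    (hE : β ^ 2 * (∫ k in Ioi (0 : ℝ), G k / k) < E₀)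
    (hU : IsUnitaryGroupOf (hamiltonian E₀ β) U) :
    MemLp (returnAmplitude U Φ₁) 2 volume ∧
      (∃ hΦ : Φ₁ ∈ (hamiltonian E₀ β).domain, 3 * Real.pi * √5 / 25 ≤ sojournTime U Φ₁ *
        energyUncertainty (hamiltonian E₀ β) ⟨Φ₁, hΦ⟩) ∧
      Tendsto (fun t : ℝ => t * returnProbability U Φ₁ t) atTop (𝓝 0) ∧
      ContDiff ℝ 1 (returnProbability U Φ₁) ∧
      Tendsto (fun T : ℝ => -∫ t in (0 : ℝ)..T, t * deriv (returnProbability U Φ₁) t)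
        atTop (𝓝 (sojournTime U Φ₁)) := by
  obtain ⟨C, Ψ, H⟩ := exists_isResolventAmplitude hE₀ hβ hE hU
  have hQ := hU.contDiff_returnProbability
    ((hamiltonian E₀ β).mem_graph ⟨Φ₁, Φ₁_mem_domain E₀ β⟩)
  exact ⟨H.memLp_two, ⟨Φ₁_mem_domain E₀ β,
    le_sojournTime_mul_energyUncertainty hE₀ hβ hE hU _⟩, H.tendsto_mul_norm_sq, hQ,
    tendsto_neg_integral_mul_deriv hQ H.integrableOn_norm_sq H.tendsto_mul_norm_sq⟩

end Qualitative

/-! ### Comparison of the sojourn time with `1/Γ` -/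

section Lifetime

variable {E₀ β : ℝ} {U : ℝ → Space ≃ₗᵢ[ℂ] Space}

/-- For `w = β² |1/F|²` one has `∫ G w = 1` and `Γ τ = G(E₀) ∫ w`, so the error is `∫ (G(E₀) - G)
w`. The part bounded by `κ G w` integrates to `κ`; the rest is majorized by a function of the
distance to `E₀`, hence the factor `2`. -/
lemma abs_halfWidth_mul_sojournTime_sub_one_le (hE₀ : 0 < E₀) (hβ : 0 < β)
    (hE : β ^ 2 * (∫ k in Ioi (0 : ℝ), G k / k) < E₀)
    (hU : IsUnitaryGroupOf (hamiltonian E₀ β) U) {κ : ℝ} {q : ℝ → ℝ}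
    (hq : IntegrableOn q (Ioi 0))
    (h : ∀ x, |G E₀ - G x| * (β ^ 2 * ‖(boundaryDenominator E₀ β x)⁻¹‖ ^ 2)
      ≤ κ * (G x * (β ^ 2 * ‖(boundaryDenominator E₀ β x)⁻¹‖ ^ 2)) + q |x - E₀|) :
    |halfWidth E₀ β * sojournTime U Φ₁ - 1| ≤ κ + 2 * ∫ u in Ioi (0 : ℝ), q u := by
  obtain ⟨C, Ψ, H⟩ := exists_isResolventAmplitude hE₀ hβ hE hU
  set w : ℝ → ℝ := fun x => β ^ 2 * ‖(boundaryDenominator E₀ β x)⁻¹‖ ^ 2 with hw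
  have hpi := Real.pi_pos
  have hwi : Integrable w := H.integrable_norm_sq_boundary.const_mul _
  have him : ∀ x, ((boundaryDenominator E₀ β x)⁻¹).im = Real.pi * (G x * w x) := fun x => by
    rw [im_inv_boundaryDenominator]; ring
  have hGwi : Integrable fun x => G x * w x := by
    refine (H.integrable_im_boundary.const_mul Real.pi⁻¹).congr (ae_of_all _ fun x => ?_)
    simp only [him]
    field_simp
  have hGw : ∫ x, G x * w x = 1 := by
    have h1 := H.integral_im_boundary (returnAmplitude_Φ₁_zero hU)
    simp only [him] at h1
    rw [integral_const_mul] at h1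
    exact mul_left_cancel₀ hpi.ne' (by rw [h1, mul_one])
  have hτ : halfWidth E₀ β * sojournTime U Φ₁ = ∫ x, G E₀ * w x := by
    change _ * ∫ t in Ioi (0 : ℝ), ‖returnAmplitude U Φ₁ t‖ ^ 2 = _
    rw [H.integral_norm_sq_eq, integral_const_mul, integral_const_mul, halfWidth]
    field_simp
  have hqi : Integrable fun x => q |x - E₀| := (integrable_comp_abs hq).comp_sub_right E₀
  have hqint : ∫ x, q |x - E₀| = 2 * ∫ u in Ioi (0 : ℝ), q u := by
    rw [integral_sub_right_eq_self (fun u => q |u|) E₀, integral_comp_abs]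
  rw [hτ, ← hGw, ← integral_sub (hwi.const_mul _) hGwi, ← hqint]
  calc |∫ x, (G E₀ * w x - G x * w x)| ≤ ∫ x, (κ * (G x * w x) + q |x - E₀|) := by
        rw [← Real.norm_eq_abs]
        refine norm_integral_le_of_norm_le ((hGwi.const_mul κ).add hqi) (ae_of_all _ fun x => ?_)
        have hw0 : 0 ≤ w x := by simp only [hw]; positivity
        rw [← sub_mul, Real.norm_eq_abs, abs_mul, abs_of_nonneg hw0]
        exact h x
    _ = κ + ∫ x, q |x - E₀| := by
        rw [integral_add (hGwi.const_mul κ) hqi, integral_const_mul, hGw, mul_one]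

/-- In the window `G x ≥ G E₀ - η/25`; the condition on `η` says that `κ` times this lower bound
still dominates `η/25`. -/
lemma abs_G_sub_le_mul {κ η x : ℝ} (hκ : 0 ≤ κ) (hη : η / 25 * (1 + κ) ≤ κ * G E₀)
    (hx : |x - E₀| ≤ η) : |G E₀ - G x| ≤ κ * G x := by
  have h1 := abs_G_sub_le E₀ x
  rw [abs_sub_comm E₀ x] at h1
  have h2 : |G E₀ - G x| ≤ η / 25 := by linarith
  have h3 := (abs_le.1 h2).2
  nlinarith

lemma abs_G_sub_le_const (x y : ℝ) : |G x - G y| ≤ 1 / 25 := by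
  have := G_nonneg x
  have := G_nonneg y
  have := G_le x
  have := G_le y
  rw [abs_le]
  constructor <;> linarith

lemma sq_mul_norm_inv_boundaryDenominator_le {x s : ℝ} (hs : β ^ 2 * |levelShift x| ≤ s)
    (hx : s < |x - E₀|) :
    β ^ 2 * ‖(boundaryDenominator E₀ β x)⁻¹‖ ^ 2 ≤ β ^ 2 / (|x - E₀| - s) ^ 2 := by
  have h1 : |x - E₀| - s ≤ ‖boundaryDenominator E₀ β x‖ := by
    refine le_trans ?_ (Complex.abs_re_le_norm _)
    rw [re_boundaryDenominator]
    have h2 := abs_sub_abs_le_abs_sub (E₀ - x) (β ^ 2 * levelShift x)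
    rw [abs_mul, abs_of_nonneg (sq_nonneg β), abs_sub_comm E₀ x] at h2
    linarith
  have h3 : 0 < |x - E₀| - s := sub_pos.2 hx
  rw [norm_inv, inv_pow, ← div_eq_mul_inv]
  gcongr

lemma abs_sojournTime_sub_le {Γ τ c : ℝ} (hΓ : 0 < Γ) (h : |Γ * τ - 1| ≤ c) :
    |τ - 1 / Γ| ≤ c / Γ := by
  have h1 : τ - 1 / Γ = (Γ * τ - 1) / Γ := by field_simp
  rw [h1, abs_div, abs_of_pos hΓ]
  gcongr

lemma halfWidth_pos (hE₀ : 0 < E₀) (hβ : 0 < β) : 0 < halfWidth E₀ β := by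
  have := G_pos hE₀
  unfold halfWidth
  positivity

/-- `ΔE` is linear in `β` and `Γ` quadratic, so `β² ≤ 1/4` suffices. The uncertainty inequality
would not: `0.843` is slightly larger than `3π√5/25`. -/
lemma mul_halfWidth_le_energyUncertainty (hβ2 : β ^ 2 ≤ 1 / 4)
    (hΦ : Φ₁ ∈ (hamiltonian E₀ β).domain) :
    0.843 * halfWidth E₀ β ≤ energyUncertainty (hamiltonian E₀ β) ⟨Φ₁, hΦ⟩ := by
  rw [energyUncertainty_Φ₁, integral_G]
  refine Real.le_sqrt_of_sq_le ?_
  have hpi := Real.pi_lt_d2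
  norm_num at hpi
  have hG : Real.pi * G E₀ ≤ 63 / 20 * (1 / 25) :=
    mul_le_mul (by linarith) (G_le _) (G_nonneg _) (by norm_num)
  have hG0 : 0 ≤ Real.pi * G E₀ := mul_nonneg Real.pi_nonneg (G_nonneg _)
  have h1 : (Real.pi * G E₀) ^ 2 ≤ (63 / 20 * (1 / 25)) ^ 2 := pow_le_pow_left₀ hG0 hG 2
  have h2 : (0.843 * halfWidth E₀ β) ^ 2
      = β ^ 2 * ((2 * 0.843) ^ 2 * (β ^ 2 * (Real.pi * G E₀) ^ 2)) := by
    unfold halfWidth; ring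
  rw [h2]
  refine mul_le_mul_of_nonneg_left ?_ (sq_nonneg β)
  have h3 : β ^ 2 * (Real.pi * G E₀) ^ 2 ≤ 1 / 4 * (63 / 20 * (1 / 25)) ^ 2 :=
    mul_le_mul hβ2 h1 (sq_nonneg _) (by norm_num)
  refine (mul_le_mul_of_nonneg_left h3 (by norm_num)).trans (by norm_num)

end Lifetime

/-! ### Small coupling -/

section SmallCoupling

variable {E₀ β : ℝ} {U : ℝ → Space ≃ₗᵢ[ℂ] Space}

lemma integrableOn_inv_sq {a : ℝ} (ha : 0 < a) : IntegrableOn (fun u : ℝ => (u ^ 2)⁻¹) (Ioi a) := by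
  have h := integrableOn_Ioi_rpow_of_lt (show (-2 : ℝ) < -1 by norm_num) ha
  refine h.congr_fun (fun u hu => ?_) measurableSet_Ioi
  have hu0 : 0 < u := ha.trans hu
  simp only
  rw [Real.rpow_neg hu0.le]
  norm_cast

lemma integral_inv_sq {a : ℝ} (ha : 0 < a) : ∫ u in Ioi a, (u ^ 2)⁻¹ = a⁻¹ := by
  have h := integral_Ioi_rpow_of_lt (show (-2 : ℝ) < -1 by norm_num) ha
  have h1 : ∫ u in Ioi a, (u ^ 2)⁻¹ = ∫ u in Ioi a, u ^ (-2 : ℝ) := by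
    refine setIntegral_congr_fun measurableSet_Ioi fun u hu => ?_
    have hu0 : 0 < u := ha.trans hu
    rw [Real.rpow_neg hu0.le]
    norm_cast
  rw [h1, h, show (-2 : ℝ) + 1 = -1 by norm_num, Real.rpow_neg_one]
  ring

/-- Outside the window the level shift times `β²` is at most `β² ≤ η/2`, hence at most half the
distance `u` to `E₀`. So `|F| ≥ u/2` and `w ≤ 4β²/u²`. -/
lemma abs_halfWidth_mul_sojournTime_sub_one_le_of_small {κ η : ℝ} (hE₀ : 0 < E₀) (hβ : 0 < β)
    (hβE : β ^ 2 ≤ E₀) (hκ : 0 ≤ κ) (hη0 : 0 < η) (hη : η / 25 * (1 + κ) ≤ κ * G E₀)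
    (hβη : β ^ 2 ≤ η / 2) (hU : IsUnitaryGroupOf (hamiltonian E₀ β) U) :
    |halfWidth E₀ β * sojournTime U Φ₁ - 1| ≤ κ + 8 * β ^ 2 / (25 * η) := by
  have hs := integral_G_div_le
  norm_num at hs
  have hE : β ^ 2 * (∫ k in Ioi (0 : ℝ), G k / k) < E₀ := by nlinarith [pow_pos hβ 2]
  set q : ℝ → ℝ := (Ioi η).indicator fun u => 4 * β ^ 2 / 25 * (u ^ 2)⁻¹ with hq
  have hqi : IntegrableOn q (Ioi 0) := Integrable.integrableOn
    ((integrable_indicator_iff measurableSet_Ioi).2 ((integrableOn_inv_sq hη0).const_mul _))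
  have hqint : ∫ u in Ioi (0 : ℝ), q u = 4 * β ^ 2 / 25 * η⁻¹ := by
    rw [hq, setIntegral_indicator measurableSet_Ioi, inter_eq_right.2 (Ioi_subset_Ioi hη0.le),
      integral_const_mul, integral_inv_sq hη0]
  refine (abs_halfWidth_mul_sojournTime_sub_one_le hE₀ hβ hE hU (κ := κ) hqi
    fun x => ?_).trans (le_of_eq ?_)
  · have hw0 : 0 ≤ β ^ 2 * ‖(boundaryDenominator E₀ β x)⁻¹‖ ^ 2 := by positivity
    rcases le_or_gt |x - E₀| η with hx | hx
    · rw [hq, indicator_of_notMem (by simpa using hx), add_zero, ← mul_assoc κ]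
      exact mul_le_mul_of_nonneg_right (abs_G_sub_le_mul hκ hη hx) hw0
    · rw [hq, indicator_of_mem (show |x - E₀| ∈ Ioi η from hx)]
      have h1 : β ^ 2 * |levelShift x| ≤ |x - E₀| / 2 := by
        nlinarith [abs_levelShift_le_one x, sq_nonneg β, abs_nonneg (levelShift x)]
      have hx0 : 0 < |x - E₀| := hη0.trans hx
      have h2 := sq_mul_norm_inv_boundaryDenominator_le h1 (half_lt_self hx0)
      have h3 := mul_le_mul (abs_G_sub_le_const E₀ x) h2 hw0 (by norm_num)
      have h4 : 0 ≤ κ * (G x * (β ^ 2 * ‖(boundaryDenominator E₀ β x)⁻¹‖ ^ 2)) :=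
        mul_nonneg hκ (mul_nonneg (G_nonneg x) hw0)
      refine (h3.trans (le_of_eq ?_)).trans (le_add_of_nonneg_left h4)
      field_simp
      ring
  · rw [hqint]
    field_simp
    ring

theorem exists_small_coupling (hE₀ : 0 < E₀) : ∃ b : ℝ, 0 < b ∧ ∀ β : ℝ, 0 < β → β < b →
    ∀ U : ℝ → Space ≃ₗᵢ[ℂ] Space, IsUnitaryGroupOf (hamiltonian E₀ β) U →
      |sojournTime U Φ₁ - 1 / halfWidth E₀ β| ≤ (1 / 10 ^ 4) / halfWidth E₀ β ∧
      ∃ hΦ : Φ₁ ∈ (hamiltonian E₀ β).domain,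
        0.843 * halfWidth E₀ β ≤ energyUncertainty (hamiltonian E₀ β) ⟨Φ₁, hΦ⟩ := by
  have hG := G_pos hE₀
  set κ : ℝ := 1 / 20000 with hκ
  set η : ℝ := 25 * (κ * G E₀) / (1 + κ) with hη
  have hη0 : 0 < η := by positivity
  have hηG : η / 25 * (1 + κ) ≤ κ * G E₀ := le_of_eq (by rw [hη]; field_simp)
  -- The window uses half of the error `10⁻⁴`. As `β² ≤ β < η/10⁴`, the tail `8β²/(25η)` is below
  -- `3.2·10⁻⁵` and fits into the other half.
  refine ⟨min (1 / 4) (min E₀ (η / 10 ^ 4)), by positivity, fun β hβ hb U hU => ?_⟩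
  have hb1 : β < 1 / 4 := hb.trans_le (min_le_left _ _)
  have hb2 : β < E₀ := hb.trans_le ((min_le_right _ _).trans (min_le_left _ _))
  have hb3 : β < η / 10 ^ 4 := hb.trans_le ((min_le_right _ _).trans (min_le_right _ _))
  have hββ : β ^ 2 ≤ β := by nlinarith
  refine ⟨abs_sojournTime_sub_le (halfWidth_pos hE₀ hβ) ?_, Φ₁_mem_domain E₀ β,
    mul_halfWidth_le_energyUncertainty (by linarith) _⟩
  refine (abs_halfWidth_mul_sojournTime_sub_one_le_of_small hE₀ hβ (by linarith) (by positivity)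
    hη0 hηG (by linarith) hU).trans ?_
  have h1 : 8 * β ^ 2 / (25 * η) ≤ 1 / 20000 := by
    rw [div_le_div_iff₀ (by positivity) (by norm_num)]
    linarith
  rw [hκ]
  linarith

end SmallCoupling

/-! ### Physical values of the parameters -/

section PhysicalValues

variable {E₀ β : ℝ} {U : ℝ → Space ≃ₗᵢ[ℂ] Space}

lemma continuousOn_div_sub_sq {s η X : ℝ} (hs : s < η) :
    ContinuousOn (fun u : ℝ => u / (u - s) ^ 2) (Icc η X) := by
  refine continuousOn_id.div (Continuous.continuousOn (by fun_prop)) fun u hu => ?_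
  have : 0 < u - s := by linarith [hu.1]
  positivity

/-- `log(u - s) - s/(u - s)` is a primitive; the upper-end term `s/(X - s)` is dropped by its sign.
-/
lemma integral_div_sub_sq_le {s η X : ℝ} (hs0 : 0 ≤ s) (hs : s < η) (hX : η ≤ X) :
    ∫ u in Ioc η X, u / (u - s) ^ 2 ≤ Real.log ((X - s) / (η - s)) + s / (η - s) := by
  have hηs : 0 < η - s := sub_pos.2 hs
  have hXs : 0 < X - s := by linarith
  have hd : ∀ u ∈ uIcc η X, HasDerivAt (fun u => Real.log (u - s) - s / (u - s))
      (u / (u - s) ^ 2) u := by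
    intro u hu
    rw [uIcc_of_le hX] at hu
    have hu0 : u - s ≠ 0 := by linarith [hu.1]
    have h0 := (hasDerivAt_id u).sub_const s
    refine ((h0.log hu0).sub ((hasDerivAt_const u s).div h0 hu0)).congr_deriv ?_
    simp only [id]
    field_simp
    ring
  rw [← intervalIntegral.integral_of_le hX, intervalIntegral.integral_eq_sub_of_hasDerivAt hd
    ((continuousOn_div_sub_sq hs).intervalIntegrable_of_Icc hX),
    Real.log_div hXs.ne' hηs.ne']
  have : 0 ≤ s / (X - s) := by positivity
  linarith

/-- Majorant of the deviation outside the resonance window, as a function of the distance `u` to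
the resonance. -/
noncomputable def deviationMajorant (β s η X : ℝ) : ℝ → ℝ :=
  (Ioc η X).indicator (fun u => β ^ 2 / 25 * (u / (u - s) ^ 2))
    + ((Ioc X 1).indicator (fun u => β ^ 2 / (25 * 0.99) * u⁻¹)
      + (Ioi 1).indicator fun u => β ^ 2 / (25 * 0.99) * (u ^ 2)⁻¹)

variable {s η X : ℝ}

lemma integrable_indicator_near (hs : s < η) (c : ℝ) :
    Integrable ((Ioc η X).indicator fun u => c * (u / (u - s) ^ 2)) :=
  (integrable_indicator_iff measurableSet_Ioc).2
    (((continuousOn_div_sub_sq hs).integrableOn_Icc.mono_set Ioc_subset_Icc_self).const_mul _)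

lemma integrable_indicator_mid (hX : 0 < X) (c : ℝ) :
    Integrable ((Ioc X 1).indicator fun u => c * u⁻¹) :=
  (integrable_indicator_iff measurableSet_Ioc).2 (Integrable.const_mul
    ((continuousOn_inv₀.mono fun _ hu => (hX.trans_le hu.1).ne').integrableOn_Icc.mono_set
      Ioc_subset_Icc_self) _)

lemma integrable_indicator_far (c : ℝ) :
    Integrable ((Ioi (1 : ℝ)).indicator fun u => c * (u ^ 2)⁻¹) :=
  (integrable_indicator_iff measurableSet_Ioi).2 ((integrableOn_inv_sq one_pos).const_mul _)

lemma integrable_deviationMajorant (hs : s < η) (hX : 0 < X) :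
    Integrable (deviationMajorant β s η X) :=
  (integrable_indicator_near hs _).add
    ((integrable_indicator_mid hX _).add (integrable_indicator_far _))

lemma integral_deviationMajorant_le (hs0 : 0 ≤ s) (hs : s < η) (hηX : η ≤ X) (hX : 0 < X)
    (hX1 : X ≤ 1) : ∫ u in Ioi (0 : ℝ), deviationMajorant β s η X u
      ≤ β ^ 2 / 25 * (Real.log ((X - s) / (η - s)) + s / (η - s))
        + β ^ 2 / (25 * 0.99) * (Real.log (1 / X) + 1) := by
  have h1 := integrable_indicator_near (X := X) hs (β ^ 2 / 25)
  have h2 := integrable_indicator_mid hX (β ^ 2 / (25 * 0.99))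
  have h3 := integrable_indicator_far (β ^ 2 / (25 * 0.99))
  unfold deviationMajorant
  rw [integral_add' h1.integrableOn (h2.add h3).integrableOn,
    integral_add' h2.integrableOn h3.integrableOn, setIntegral_indicator measurableSet_Ioc,
    setIntegral_indicator measurableSet_Ioc, setIntegral_indicator measurableSet_Ioi,
    inter_eq_right.2 (show Ioc η X ⊆ Ioi 0 from fun u hu => hs0.trans_lt (hs.trans hu.1)),
    inter_eq_right.2 (show Ioc X 1 ⊆ Ioi 0 from fun u hu => hX.trans hu.1),
    inter_eq_right.2 (Ioi_subset_Ioi zero_le_one), integral_const_mul, integral_const_mul,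
    integral_const_mul, integral_inv_sq one_pos, inv_one,
    ← intervalIntegral.integral_of_le hX1, integral_inv_of_pos hX one_pos]
  have h4 := mul_le_mul_of_nonneg_left (integral_div_sub_sq_le hs0 hs hηX)
    (show 0 ≤ β ^ 2 / 25 by positivity)
  linarith

lemma deviationMajorant_of_le (hηX : η ≤ X) (hX1 : X ≤ 1) {u : ℝ} (hu : u ≤ η) :
    deviationMajorant β s η X u = 0 := by
  unfold deviationMajorant
  rw [Pi.add_apply, Pi.add_apply, indicator_of_notMem (fun h => not_le.2 h.1 hu),
    indicator_of_notMem (fun h => not_le.2 h.1 (hu.trans hηX)),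
    indicator_of_notMem (fun h => not_le.2 (mem_Ioi.1 h) (hu.trans (hηX.trans hX1))), add_zero,
    add_zero]

lemma deviationMajorant_of_near (hX1 : X ≤ 1) {u : ℝ} (hu : η < u) (hu' : u ≤ X) :
    deviationMajorant β s η X u = β ^ 2 / 25 * (u / (u - s) ^ 2) := by
  unfold deviationMajorant
  rw [Pi.add_apply, Pi.add_apply, indicator_of_mem (show u ∈ Ioc η X from ⟨hu, hu'⟩),
    indicator_of_notMem (fun h => not_le.2 h.1 hu'),
    indicator_of_notMem (fun h => not_le.2 (mem_Ioi.1 h) (hu'.trans hX1)), add_zero, add_zero]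

lemma deviationMajorant_of_mid {u : ℝ} (hu : X < u) (hu' : u ≤ 1) :
    deviationMajorant β s η X u = β ^ 2 / (25 * 0.99) * u⁻¹ := by
  unfold deviationMajorant
  rw [Pi.add_apply, Pi.add_apply, indicator_of_notMem (fun h => not_le.2 hu h.2),
    indicator_of_mem (show u ∈ Ioc X 1 from ⟨hu, hu'⟩),
    indicator_of_notMem (fun h => not_le.2 (mem_Ioi.1 h) hu'), add_zero, zero_add]

lemma deviationMajorant_of_far (hX1 : X ≤ 1) {u : ℝ} (hu : 1 < u) :
    deviationMajorant β s η X u = β ^ 2 / (25 * 0.99) * (u ^ 2)⁻¹ := by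
  unfold deviationMajorant
  rw [Pi.add_apply, Pi.add_apply, indicator_of_notMem (fun h => not_le.2 hu (h.2.trans hX1)),
    indicator_of_notMem (fun h => not_le.2 hu h.2),
    indicator_of_mem (show u ∈ Ioi 1 from hu), zero_add, zero_add]

/-- Up to `X` the refined shift bound gives `|F| ≥ u - s`. Beyond `X` the shift is at most `0.005
u`, whence `|F|² ≥ 0.99 u²`; past distance `1` the Lipschitz bound for `G` is replaced by the
uniform one, so that the integral converges. -/
lemma mul_le_deviationMajorant {x : ℝ} (hs : s < η) (hX : 0 < X) (hX1 : X ≤ 1)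
    (hnear : η < |x - E₀| → |x - E₀| ≤ X → β ^ 2 * |levelShift x| ≤ s)
    (hfar : β ^ 2 ≤ 0.005 * X) (hx : η < |x - E₀|) :
    |G E₀ - G x| * (β ^ 2 * ‖(boundaryDenominator E₀ β x)⁻¹‖ ^ 2)
      ≤ deviationMajorant β s η X |x - E₀| := by
  have hw0 : 0 ≤ β ^ 2 * ‖(boundaryDenominator E₀ β x)⁻¹‖ ^ 2 := by positivity
  have hG := abs_G_sub_le E₀ x
  rw [abs_sub_comm E₀ x] at hG
  set u := |x - E₀|
  rcases le_or_gt u X with hu | hu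
  · rw [deviationMajorant_of_near hX1 hx hu]
    have h2 := sq_mul_norm_inv_boundaryDenominator_le (hnear hx hu) (hs.trans hx)
    refine (mul_le_mul hG h2 hw0 (by positivity)).trans (le_of_eq ?_)
    ring
  · have hu0 : 0 < u := hX.trans hu
    have h1 : β ^ 2 * |levelShift x| ≤ 0.005 * u := by
      have := mul_le_mul_of_nonneg_left (abs_levelShift_le_one x) (sq_nonneg β)
      norm_num at this hfar ⊢
      linarith
    have h2 := sq_mul_norm_inv_boundaryDenominator_le (x := x) (E₀ := E₀) h1
      (by norm_num; linarith)
    have h3 : β ^ 2 / (u - 0.005 * u) ^ 2 ≤ β ^ 2 / (0.99 * u ^ 2) := by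
      gcongr
      nlinarith [pow_pos hu0 2]
    have h4 := h2.trans h3
    rcases le_or_gt u 1 with hu1 | hu1
    · rw [deviationMajorant_of_mid hu hu1]
      refine (mul_le_mul hG h4 hw0 (by positivity)).trans (le_of_eq ?_)
      field_simp
    · rw [deviationMajorant_of_far hX1 hu1]
      refine (mul_le_mul (abs_G_sub_le_const E₀ x) h4 hw0 (by positivity)).trans (le_of_eq ?_)
      field_simp

lemma log_le_eleven {y : ℝ} (hy : 0 < y) (h : y ≤ 50000) : Real.log y ≤ 11 := by
  rw [Real.log_le_iff_le_exp hy]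
  have h1 : Real.exp 11 = Real.exp 1 ^ 11 := by rw [← Real.exp_nat_mul]; norm_num
  have h2 := pow_le_pow_left₀ (by norm_num) Real.exp_one_gt_d9.le 11
  rw [h1]
  refine h.trans (le_trans ?_ h2)
  norm_num

/-- Since `822 = 6·137`, one has `log(6/α) = log 822 + log(1/(137α))`. With `log 822 ≤ 7` and `log y
≤ y - 1`, the left side is at most `7α³ + α²/137`, which is increasing in `α`. -/
lemma cube_mul_log_le {α : ℝ} (hα : 0 < α) (hα1 : α ≤ 1 / 137) :
    α ^ 3 * (Real.log (6 / α) + 1) ≤ 8 / 137 ^ 3 := by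
  have h1 : Real.log 822 ≤ 7 := by
    rw [Real.log_le_iff_le_exp (by norm_num)]
    have h1 : Real.exp 7 = Real.exp 1 ^ 7 := by rw [← Real.exp_nat_mul]; norm_num
    have h2 := pow_le_pow_left₀ (by norm_num) Real.exp_one_gt_d9.le 7
    rw [h1]
    refine le_trans ?_ h2
    norm_num
  have h2 : Real.log (6 / α) = Real.log 822 + Real.log (1 / (137 * α)) := by
    rw [← Real.log_mul (by norm_num) (by positivity)]
    congr 1
    field_simp
    norm_num
  have h3 := Real.log_le_sub_one_of_pos (show 0 < 1 / (137 * α) by positivity)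
  have h4 : Real.log (6 / α) + 1 ≤ 7 + 1 / (137 * α) := by linarith
  have h5 : α ^ 3 * (7 + 1 / (137 * α)) = 7 * α ^ 3 + α ^ 2 / 137 := by field_simp
  have h6 := pow_le_pow_left₀ hα.le hα1 3
  have h7 := pow_le_pow_left₀ hα.le hα1 2
  have h8 := mul_le_mul_of_nonneg_left h4 (pow_pos hα 3).le
  rw [h5] at h8
  norm_num at h6 h7 ⊢
  linarith

/-- The threshold bound with `c = 2/25` gives a shift of at most `0.035` for `x` within `E₀/2` of
`E₀`; then `0.00201 · 0.035 < 7.04·10⁻⁵`. The crude bound `1` would exceed the resonance window. -/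
lemma mul_abs_levelShift_le {x : ℝ} (hE₀ : 0 < E₀) (hE₀' : E₀ ≤ 1 / 274)
    (hβ2 : β ^ 2 ≤ 0.00201 * E₀) (hx : |x - E₀| ≤ E₀ / 2) :
    β ^ 2 * |levelShift x| ≤ 7.04e-5 * E₀ := by
  have hx1 := abs_le.1 hx
  have hx0 : 0 < x := by linarith
  have h1 := abs_levelShift_le_of_pos hx0 (show x < 2 / 25 by linarith)
  have h2 := integral_G_div_le
  have h3 : x / (2 / 25 - x) ≤ 0.074 := by
    rw [div_le_iff₀ (by linarith)]
    norm_num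
    linarith
  have h4 : 0 ≤ x / (2 / 25 - x) := div_nonneg hx0.le (by linarith)
  have h5 : (∫ k in Ioi (0 : ℝ), G k / k) * (1 + x / (2 / 25 - x)) ≤ 0.0288 * (1 + 0.074) :=
    mul_le_mul h2 (by linarith) (by linarith) (by norm_num)
  have h6 : |levelShift x| ≤ 0.035 := by
    norm_num at h5 ⊢
    linarith
  refine (mul_le_mul hβ2 h6 (abs_nonneg _) (by positivity)).trans ?_
  norm_num
  linarith

theorem physical_values {α : ℝ} (hα : 0 < α) (hα1 : α ≤ 1 / 137) (hE : α / 3 ≤ E₀)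
    (hE' : E₀ ≤ α / 2) (hβ : 0 < β) (hβ2 : β ^ 2 ≤ 4 * Real.pi * α ^ 3)
    (hU : IsUnitaryGroupOf (hamiltonian E₀ β) U) :
    |sojournTime U Φ₁ - 1 / halfWidth E₀ β| ≤ (1 / 10 ^ 4) / halfWidth E₀ β ∧
      ∃ hΦ : Φ₁ ∈ (hamiltonian E₀ β).domain,
        0.843 * halfWidth E₀ β ≤ energyUncertainty (hamiltonian E₀ β) ⟨Φ₁, hΦ⟩ := by
  have hE₀ : 0 < E₀ := by linarith
  have hE₀' : E₀ ≤ 1 / 274 := by linarith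
  have hpi := Real.pi_lt_d4
  have hα3 : 0 < α ^ 3 := pow_pos hα 3
  have hβα : β ^ 2 ≤ 12.5664 * α ^ 3 := by
    refine hβ2.trans (mul_le_mul_of_nonneg_right ?_ hα3.le)
    norm_num at hpi ⊢
    linarith
  have hα2 := pow_le_pow_left₀ hα.le hα1 2
  have hβE : β ^ 2 ≤ 0.00201 * E₀ := by
    have h1 : α ^ 2 * α ≤ (1 / 137) ^ 2 * (3 * E₀) :=
      mul_le_mul hα2 (by linarith) hα.le (by norm_num)
    rw [← pow_succ] at h1
    norm_num at h1 hβα ⊢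
    linarith
  have hs1 := integral_G_div_le
  have hβs : β ^ 2 * (∫ k in Ioi (0 : ℝ), G k / k) < E₀ := by
    norm_num at hs1 hβE
    nlinarith [pow_pos hβ 2]
  refine ⟨abs_sojournTime_sub_le (halfWidth_pos hE₀ hβ) ?_, Φ₁_mem_domain E₀ β,
    mul_halfWidth_le_energyUncertainty (by norm_num at hβE; linarith) _⟩
  -- Most of the error `10⁻⁴` goes to the window: `G` is nearly linear near `0`, so `κ` permits `η`
  -- of almost the same relative size, and `η` must exceed the shift bound `s`. The gap `η - s =
  -- 1.16·10⁻⁵ E₀` enters only through a logarithm and the ratio `s/(η - s)`; with the factor `β²`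
  -- the tails stay below `10⁻⁵`.
  set κ : ℝ := 8.44e-5 with hκ
  set η : ℝ := 8.2e-5 * E₀ with hη
  set s : ℝ := 7.04e-5 * E₀ with hs
  set X : ℝ := E₀ / 2 with hX
  have hκ0 : 0 ≤ κ := by norm_num
  have hs0 : 0 ≤ s := by positivity
  have hsη : s < η := by rw [hs, hη]; norm_num; linarith
  have hηX : η ≤ X := by rw [hX, hη]; norm_num; linarith
  have hX0 : 0 < X := by positivity
  have hX1 : X ≤ 1 := by linarith
  have hηκ : η / 25 * (1 + κ) ≤ κ * G E₀ := by
    have h1 : E₀ ^ 2 + 9 / 4 ≤ 2.25002 := by norm_num; nlinarith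
    have h2 := pow_le_pow_left₀ (by positivity) h1 4
    rw [G_eq_ratG hE₀.le, ratG, ← div_eq_mul_inv, ← mul_div_assoc, le_div_iff₀ (by positivity)]
    refine (mul_le_mul_of_nonneg_left h2 (by positivity)).trans ?_
    rw [hη, hκ]
    norm_num
    linarith
  have hq := integrable_deviationMajorant (β := β) hsη hX0
  refine (abs_halfWidth_mul_sojournTime_sub_one_le hE₀ hβ hβs hU (κ := κ) hq.integrableOn
    fun x => ?_).trans ?_
  · have hw0 : 0 ≤ β ^ 2 * ‖(boundaryDenominator E₀ β x)⁻¹‖ ^ 2 := by positivity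
    rcases le_or_gt |x - E₀| η with hx | hx
    · rw [deviationMajorant_of_le hηX hX1 hx, add_zero, ← mul_assoc κ]
      exact mul_le_mul_of_nonneg_right (abs_G_sub_le_mul hκ0 hηκ hx) hw0
    · refine (mul_le_deviationMajorant hsη hX0 hX1
        (fun _ h => mul_abs_levelShift_le hE₀ hE₀' hβE h) ?_ hx).trans
        (le_add_of_nonneg_left (mul_nonneg hκ0 (mul_nonneg (G_nonneg x) hw0)))
      rw [hX]
      norm_num at hβE ⊢
      linarith
  · have h1 := integral_deviationMajorant_le (β := β) hs0 hsη hηX hX0 hX1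
    have hηs : η - s = 1.16e-5 * E₀ := by rw [hη, hs]; norm_num; ring
    have h2 : s / (η - s) ≤ 6.07 := by
      rw [hηs, hs, div_le_iff₀ (by positivity)]
      norm_num
      linarith
    have h3 : Real.log ((X - s) / (η - s)) ≤ 11 := by
      refine log_le_eleven (div_pos (by linarith) (by linarith)) ?_
      rw [hηs, div_le_iff₀ (by positivity), hX]
      norm_num
      linarith
    -- Here `1/X = 2/E₀ ≤ 6/α`, from `E₀ ≥ α/3`.
    have h4 : Real.log (1 / X) + 1 ≤ Real.log (6 / α) + 1 := by
      refine add_le_add_left (Real.log_le_log (by positivity) ?_) 1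
      rw [div_le_div_iff₀ hX0 hα, hX]
      linarith
    have hl0 : 0 ≤ Real.log (6 / α) + 1 := by
      have : 0 ≤ Real.log (6 / α) := Real.log_nonneg (by rw [le_div_iff₀ hα]; linarith)
      linarith
    have h5 : β ^ 2 * (Real.log (1 / X) + 1) ≤ 12.5664 * (8 / 137 ^ 3) := by
      calc β ^ 2 * (Real.log (1 / X) + 1) ≤ β ^ 2 * (Real.log (6 / α) + 1) :=
            mul_le_mul_of_nonneg_left h4 (sq_nonneg β)
        _ ≤ 12.5664 * α ^ 3 * (Real.log (6 / α) + 1) := mul_le_mul_of_nonneg_right hβα hl0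
        _ = 12.5664 * (α ^ 3 * (Real.log (6 / α) + 1)) := mul_assoc _ _ _
        _ ≤ _ := mul_le_mul_of_nonneg_left (cube_mul_log_le hα hα1) (by norm_num)
    have h6 : β ^ 2 ≤ 12.5664 * (1 / 137) ^ 3 :=
      hβα.trans (mul_le_mul_of_nonneg_left (pow_le_pow_left₀ hα.le hα1 3) (by norm_num))
    have h7 : β ^ 2 * (Real.log ((X - s) / (η - s)) + s / (η - s))
        ≤ 12.5664 * (1 / 137) ^ 3 * (11 + 6.07) := by
      calc _ ≤ β ^ 2 * (11 + 6.07) := mul_le_mul_of_nonneg_left (add_le_add h3 h2) (sq_nonneg β)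
        _ ≤ _ := mul_le_mul_of_nonneg_right h6 (by norm_num)
    have h8 : β ^ 2 / 25 * (Real.log ((X - s) / (η - s)) + s / (η - s))
        + β ^ 2 / (25 * 0.99) * (Real.log (1 / X) + 1)
        = β ^ 2 * (Real.log ((X - s) / (η - s)) + s / (η - s)) / 25
          + β ^ 2 * (Real.log (1 / X) + 1) / (25 * 0.99) := by ring
    rw [h8] at h1
    have h9 : β ^ 2 * (Real.log ((X - s) / (η - s)) + s / (η - s)) / 25
        ≤ 12.5664 * (1 / 137) ^ 3 * (11 + 6.07) / 25 := by gcongr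
    have h10 : β ^ 2 * (Real.log (1 / X) + 1) / (25 * 0.99)
        ≤ 12.5664 * (8 / 137 ^ 3) / (25 * 0.99) := by gcongr
    calc κ + 2 * ∫ u in Ioi (0 : ℝ), deviationMajorant β s η X u
        ≤ κ + 2 * (12.5664 * (1 / 137) ^ 3 * (11 + 6.07) / 25
          + 12.5664 * (8 / 137 ^ 3) / (25 * 0.99)) := by linarith
      _ ≤ 1 / 10 ^ 4 := by rw [hκ]; norm_num

end PhysicalValues

end WeisskopfWigner

theorem theorem5p2 :
    -- the dynamics `exp (-i t H)` exists and is unique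
    (∀ E₀ β : ℝ, ∃! U : ℝ → Space ≃ₗᵢ[ℂ] Space,
      IsUnitaryGroupOf (hamiltonian E₀ β) U) ∧
    -- the qualitative statements and the time-energy uncertainty bound
    (∀ E₀ β : ℝ, 0 < E₀ → 0 < β →
      β ^ 2 * (∫ k in Ioi (0 : ℝ), G k / k) < E₀ →
      ∀ U : ℝ → Space ≃ₗᵢ[ℂ] Space,
        IsUnitaryGroupOf (hamiltonian E₀ β) U →
        MemLp (returnAmplitude U Φ₁) 2
          volume ∧
        (∃ hΦ : Φ₁ ∈ (hamiltonian E₀ β).domain,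
          3 * Real.pi * √5 / 25 ≤ sojournTime U Φ₁ *
            energyUncertainty (hamiltonian E₀ β)
              ⟨Φ₁, hΦ⟩) ∧
        Tendsto (fun t : ℝ => t * returnProbability U Φ₁ t)
          atTop (𝓝 0) ∧
        ContDiff ℝ 1 (returnProbability U Φ₁) ∧
        Tendsto
          (fun T : ℝ => -∫ t in (0 : ℝ)..T,
            t * deriv (returnProbability U Φ₁) t)
          atTop (𝓝 (sojournTime U Φ₁))) ∧
    -- the quantitative statements for the physical values of the parameters
    (∀ α E₀ β : ℝ, 0 < α → α ≤ 1 / 137 → α / 3 ≤ E₀ → E₀ ≤ α / 2 →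
      0 < β → β ^ 2 ≤ 4 * Real.pi * α ^ 3 →
      ∀ U : ℝ → Space ≃ₗᵢ[ℂ] Space,
        IsUnitaryGroupOf (hamiltonian E₀ β) U →
        |sojournTime U Φ₁ - 1 / halfWidth E₀ β|
          ≤ (1 / 10 ^ 4) / halfWidth E₀ β ∧
        ∃ hΦ : Φ₁ ∈ (hamiltonian E₀ β).domain,
          0.843 * halfWidth E₀ β ≤
            energyUncertainty (hamiltonian E₀ β)
              ⟨Φ₁, hΦ⟩) ∧
    -- the quantitative statements for an arbitrary level spacing and small coupling
    (∀ E₀ : ℝ, 0 < E₀ → ∃ b : ℝ, 0 < b ∧ ∀ β : ℝ, 0 < β → β < b →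
      ∀ U : ℝ → Space ≃ₗᵢ[ℂ] Space,
        IsUnitaryGroupOf (hamiltonian E₀ β) U →
        |sojournTime U Φ₁ - 1 / halfWidth E₀ β|
          ≤ (1 / 10 ^ 4) / halfWidth E₀ β ∧
        ∃ hΦ : Φ₁ ∈ (hamiltonian E₀ β).domain,
          0.843 * halfWidth E₀ β ≤
            energyUncertainty (hamiltonian E₀ β)
              ⟨Φ₁, hΦ⟩) := by
  exact ⟨existsUnique_isUnitaryGroupOf_hamiltonian,
    fun _ _ hE₀ hβ hE _ hU => decay_and_uncertainty hE₀ hβ hE hU,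
    fun _ _ _ hα hα1 hE hE' hβ hβ2 _ hU => physical_values hα hα1 hE hE' hβ hβ2 hU,
    fun _ hE₀ => exists_small_coupling hE₀⟩
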